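/- Signature is $(-,+,+,+)$ and $R_{ab}=R^c{}_{acb}$ with $R^a{}_{bcd}=\partial_c\Gamma^a_{bd}-\partial_d\Gamma^a_{bc}+\dots$ (so round spheres have positive curvature). Let $\alpha,\beta\in\mathbb R$ and $\gamma,\kappa,\hbar>0$. Fourth-order gravity is the theory with gravitational action $\int\sqrt{-g}\,\bigl(\tfrac{\gamma}{\kappa^2}R-\alpha\hbar R^{ab}R_{ab}+\beta\hbar R^2\bigr)$; its field equations with matter $T_{ab}$ are $H_{ab}=-\tfrac1{2\hbar}T_{ab}$, where $$H_{ab}=-(\alpha-2\beta)\nabla_a\nabla_bR+\alpha\,\Box R_{ab}+\tfrac12(\alpha-4\beta)g_{ab}\Box R+2\alpha R^{cd}R_{acbd}-2\beta RR_{ab}-\tfrac12g_{ab}(\alpha R^{cd}R_{cd}-\beta R^2)-\tfrac{\gamma}{\hbar\kappa^2}\bigl(R_{ab}-\tfrac12g_{ab}R\bigr).$$ Einstein's equations (GR) are $\tfrac{\gamma}{\kappa^2}\bigl(R_{ab}-\tfrac12g_{ab}R\bigr)=\tfrac12T_{ab}$. A static spacetime is $\mathbb R\times S$ with metric $g=-N^2dt^2+h$,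 where $S$ is a connected smooth $3$-manifold (Hausdorff, $\sigma$-compact, without boundary, of any topology), $h$ is a smooth Riemannian metric on $S$ and $N>0$ is a smooth function on $S$. It is asymptotically flat if the complement of a compact subset of $S$ is identified with $\{y\in\mathbb R^3:\|y\|>r\}$, $r>0$, by a smooth chart whose image contains $\{\|y\|\ge r\}$, the part $\{\|y\|\ge r\}$ being closed in $S$, and in this chart, on $\|y\|>r$, for $k=0,1,2$, the $k$-th derivatives of $N^2-1$ and of $h_{ij}-\delta_{ij}$ are $O(\|y\|^{-1-k})$. (In particular $S$ has no inner boundary or horizon.) Matter is described by a time-independent tensor $T_{ab}$. **Theorem.** Assume $\alpha\neq0$ and $\alpha\neq3\beta$. Let $g$ be a static, asymptotically flat solution of Einstein's equations with matter $T_{ab}$. Then $R_{ab}=0$ if and only if $T_{ab}=0$ (vacuum), and: 1. if $\displaystyle\int_S\sqrt h\,d^3x\;T^a{}_bT^b{}_cT^c{}_a\ \ge\ 0$, then $g$, with the same $T_{ab}$, is also a solution of fourth-order gravity if and only if $R_{ab}=0$; 2. if $T_{ab}=\rho u_au_b+P(g_{ab}+u_au_b)$ is a barotropic perfect fluid, with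 $u$ unit timelike, $\rho\ge0$, $P=\omega\rho$ and $\omega\ge-3^{-1/3}$ everywhere ($\omega$ may be a function), then again $g$ is also a solution of fourth-order gravity if and only if $R_{ab}=0$. -/

import Mathlib

open MeasureTheory
open scoped Manifold ContDiff

noncomputable section

/-! ### Tensor calculus in a coordinate patch of a four-dimensional spacetime

`g` is the matrix of components of a metric, as a function of the four coordinates. -/

namespace Coord

/-- Coordinate points `(x⁰, x¹, x², x³)`. -/
abbrev Pt := Fin 4 → ℝ

/-- The partial derivative `∂_a f`. -/
def pd (a : Fin 4) (f : Pt → ℝ) (p : Pt) : ℝ := fderiv ℝ f p (Pi.single a 1)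

/-- Christoffel symbols of the Levi-Civita connection:
`Γ^a_{bc} = ½ g^{ad} (∂_b g_{dc} + ∂_c g_{db} - ∂_d g_{bc})`. -/
def christoffel (g : Pt → Matrix (Fin 4) (Fin 4) ℝ) (a b c : Fin 4) (p : Pt) : ℝ :=
  (1 / 2) * ∑ d, (g p)⁻¹ a d *
    (pd b (fun q => g q d c) p + pd c (fun q => g q d b) p - pd d (fun q => g q b c) p)

/-- Riemann tensor `R^a_{bcd} = ∂_c Γ^a_{bd} - ∂_d Γ^a_{bc} + Γ^a_{ce} Γ^e_{bd} - Γ^a_{de} Γ^e_{bc}`. -/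
def riemann (g : Pt → Matrix (Fin 4) (Fin 4) ℝ) (a b c d : Fin 4) (p : Pt) : ℝ :=
  pd c (christoffel g a b d) p - pd d (christoffel g a b c) p
    + ∑ e, (christoffel g a c e p * christoffel g e b d p
        - christoffel g a d e p * christoffel g e b c p)

/-- Riemann tensor with all indices lowered, `R_{abcd} = g_{ae} R^e_{bcd}`. -/
def riemannLow (g : Pt → Matrix (Fin 4) (Fin 4) ℝ) (a b c d : Fin 4) (p : Pt) : ℝ :=
  ∑ e, g p a e * riemann g e b c d p

/-- Ricci tensor `R_{ab} = R^c_{acb}` (positive on round spheres). -/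
def ricci (g : Pt → Matrix (Fin 4) (Fin 4) ℝ) (a b : Fin 4) (p : Pt) : ℝ :=
  ∑ c, riemann g c a c b p

/-- Scalar curvature `R = g^{ab} R_{ab}`. -/
def scalarCurv (g : Pt → Matrix (Fin 4) (Fin 4) ℝ) (p : Pt) : ℝ :=
  ∑ a, ∑ b, (g p)⁻¹ a b * ricci g a b p

/-- `R^{ab} = g^{ac} g^{bd} R_{cd}`. -/
def ricciUp (g : Pt → Matrix (Fin 4) (Fin 4) ℝ) (a b : Fin 4) (p : Pt) : ℝ :=
  ∑ c, ∑ d, (g p)⁻¹ a c * (g p)⁻¹ b d * ricci g c d p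

/-- The Hessian `∇_a ∇_b f` of a scalar. -/
def hess (g : Pt → Matrix (Fin 4) (Fin 4) ℝ) (f : Pt → ℝ) (a b : Fin 4) (p : Pt) : ℝ :=
  pd a (pd b f) p - ∑ c, christoffel g c a b p * pd c f p

/-- The wave operator `□ f = g^{ab} ∇_a ∇_b f` on scalars. -/
def boxScalar (g : Pt → Matrix (Fin 4) (Fin 4) ℝ) (f : Pt → ℝ) (p : Pt) : ℝ :=
  ∑ a, ∑ b, (g p)⁻¹ a b * hess g f a b p

/-- The covariant derivative `∇_c T_{ab}`. -/
def covD (g : Pt → Matrix (Fin 4) (Fin 4) ℝ) (T : Fin 4 → Fin 4 → Pt → ℝ)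
    (c a b : Fin 4) (p : Pt) : ℝ :=
  pd c (T a b) p
    - ∑ e, (christoffel g e c a p * T e b p + christoffel g e c b p * T a e p)

/-- The second covariant derivative `∇_d ∇_c T_{ab}`. -/
def covD2 (g : Pt → Matrix (Fin 4) (Fin 4) ℝ) (T : Fin 4 → Fin 4 → Pt → ℝ)
    (d c a b : Fin 4) (p : Pt) : ℝ :=
  pd d (covD g T c a b) p
    - ∑ e, (christoffel g e d c p * covD g T e a b p + christoffel g e d a p * covD g T c e b p
        + christoffel g e d b p * covD g T c a e p)

/-- The wave operator `□ T_{ab} = g^{dc} ∇_d ∇_c T_{ab}` on covariant two-tensors. -/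
def boxTensor (g : Pt → Matrix (Fin 4) (Fin 4) ℝ) (T : Fin 4 → Fin 4 → Pt → ℝ)
    (a b : Fin 4) (p : Pt) : ℝ :=
  ∑ d, ∑ c, (g p)⁻¹ d c * covD2 g T d c a b p

/-- Einstein tensor `R_{ab} - ½ g_{ab} R`. -/
def einstein (g : Pt → Matrix (Fin 4) (Fin 4) ℝ) (a b : Fin 4) (p : Pt) : ℝ :=
  ricci g a b p - (1 / 2) * g p a b * scalarCurv g p

/-- The tensor `H_{ab}` of fourth-order gravity,
`H_{ab} = -(α - 2β) ∇_a ∇_b R + α □ R_{ab} + ½ (α - 4β) g_{ab} □ R + 2α R^{cd} R_{acbd} - 2β R R_{ab}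
  - ½ g_{ab} (α R^{cd} R_{cd} - β R²) - γ / (ℏ κ²) (R_{ab} - ½ g_{ab} R)`.
It is `-1 / (ℏ √(-g))` times the variational derivative with respect to `g^{ab}` of the action
`∫ √(-g) (γ / κ² R - α ℏ R^{ab} R_{ab} + β ℏ R²)`, for signature `(-,+,+,+)` and the curvature
conventions above. -/
def fourthOrderH (α β γ κ hbar : ℝ) (g : Pt → Matrix (Fin 4) (Fin 4) ℝ)
    (a b : Fin 4) (p : Pt) : ℝ :=
  - (α - 2 * β) * hess g (scalarCurv g) a b p
    + α * boxTensor g (ricci g) a b p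
    + (1 / 2) * (α - 4 * β) * g p a b * boxScalar g (scalarCurv g) p
    + 2 * α * ∑ c, ∑ d, ricciUp g c d p * riemannLow g a c b d p
    - 2 * β * scalarCurv g p * ricci g a b p
    - (1 / 2) * g p a b *
        (α * (∑ c, ∑ d, ricciUp g c d p * ricci g c d p) - β * scalarCurv g p ^ 2)
    - γ / (hbar * κ ^ 2) * einstein g a b p

end Coord

/-! ### Static spacetimes -/

/-- The model space of the spatial slice. -/
abbrev E3 := EuclideanSpace ℝ (Fin 3)

variable (S : Type*) [TopologicalSpace S] [ChartedSpace E3 S] [IsManifold (𝓡 3) ∞ S]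

/-- A static spacetime `ℝ × S`: a smooth three-manifold `S` (the spatial slice) with a smooth
Riemannian metric `h` and a smooth positive lapse `N`; the spacetime metric is
`-N² dt² + h`, and `∂_t` is the hypersurface-orthogonal timelike Killing field with `λ = N²`. -/
structure StaticSpacetime where
  /-- the spatial metric -/
  h : Bundle.ContMDiffRiemannianMetric (𝓡 3) ∞ E3 (fun x : S => TangentSpace (𝓡 3) x)
  /-- the lapse -/
  N : S → ℝ
  N_pos : ∀ x, 0 < N x
  N_smooth : ContMDiff (𝓡 3) 𝓘(ℝ, ℝ) ∞ N

/-- Time-independent fields of bilinear forms on the tangent spaces `ℝ × T_x S` of the spacetime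
`ℝ × S`. -/
abbrev StaticTensor := (x : S) → LinearMap.BilinForm ℝ (ℝ × TangentSpace (𝓡 3) x)

variable {S}

/-- The spatial part `(p¹, p², p³)` of a coordinate point `p = (t, p¹, p², p³)`. -/
def spatial (p : Coord.Pt) : E3 := WithLp.toLp 2 (fun i : Fin 3 => p i.succ)

/-- The coordinate vector fields `∂_1, ∂_2, ∂_3` of a chart `e` of the slice, at the point with
coordinates `y`. -/
def spatialFrame (e : OpenPartialHomeomorph S E3) (y : E3) (i : Fin 3) :
    TangentSpace (𝓡 3) (e.symm y) :=
  mfderiv (𝓡 3) (𝓡 3) e.symm y (EuclideanSpace.single i (1 : ℝ))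

/-- The coordinate vector fields `∂_t, ∂_1, ∂_2, ∂_3` on `ℝ × S` of the coordinates `(t, e)`. -/
def frame (e : OpenPartialHomeomorph S E3) (y : E3) :
    Fin 4 → ℝ × TangentSpace (𝓡 3) (e.symm y) :=
  Fin.cons ((1 : ℝ), 0) (fun i : Fin 3 => ((0 : ℝ), spatialFrame e y i))

/-- The components of a static tensor in the coordinates `(t, e)`. -/
def StaticTensor.comp (T : StaticTensor S) (e : OpenPartialHomeomorph S E3) (p : Coord.Pt) :
    Matrix (Fin 4) (Fin 4) ℝ :=
  Matrix.of fun a b => T (e.symm (spatial p)) (frame e (spatial p) a) (frame e (spatial p) b)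

namespace StaticSpacetime

variable (M : StaticSpacetime S)

/-- The spacetime metric `-N² dt² + h`. -/
def metric : StaticTensor S := fun x =>
  LinearMap.mk₂ ℝ (fun v w => - M.N x ^ 2 * (v.1 * w.1) + M.h.inner x v.2 w.2)
    (fun u v w => by simp only [Prod.fst_add, Prod.snd_add, map_add, add_apply]; ring)
    (fun c v w => by
      simp only [Prod.smul_fst, Prod.smul_snd, map_smul, smul_apply, smul_eq_mul]; ring)
    (fun u v w => by simp only [Prod.fst_add, Prod.snd_add, map_add]; ring)
    (fun c v w => by simp only [Prod.smul_fst, Prod.smul_snd, map_smul, smul_eq_mul]; ring)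

/-- Components `g_{ab}` of the spacetime metric in the coordinates `(t, e)`. -/
def g (e : OpenPartialHomeomorph S E3) : Coord.Pt → Matrix (Fin 4) (Fin 4) ℝ := M.metric.comp e

/-- Components `h_{ij}` of the spatial metric in the chart `e`. -/
def hComp (e : OpenPartialHomeomorph S E3) (y : E3) : Matrix (Fin 3) (Fin 3) ℝ :=
  Matrix.of fun i j => M.h.inner (e.symm y) (spatialFrame e y i) (spatialFrame e y j)

/-- A tensorial equation `A_{ab} = B_{ab}` on the spacetime `ℝ × S`: the components agree at every
point in all coordinate systems `(t, e)`, where `e` is a chart of the smooth structure of `S`. -/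
def InAllCharts (P : OpenPartialHomeomorph S E3 → Coord.Pt → Fin 4 → Fin 4 → Prop) : Prop :=
  ∀ e ∈ IsManifold.maximalAtlas (𝓡 3) ∞ S, ∀ p : Coord.Pt, spatial p ∈ e.target →
    ∀ a b : Fin 4, P e p a b

/-- Einstein's equations `γ κ⁻² (R_{ab} - ½ g_{ab} R) = ½ T_{ab}`. -/
def SolvesEinstein (γ κ : ℝ) (T : StaticTensor S) : Prop :=
  InAllCharts (S := S) fun e p a b =>
    γ / κ ^ 2 * Coord.einstein (M.g e) a b p = (1 / 2) * T.comp e p a b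

/-- The equations of fourth-order gravity, `H_{ab} = -T_{ab} / (2 ℏ)`. -/
def SolvesFourthOrder (α β γ κ hbar : ℝ) (T : StaticTensor S) : Prop :=
  InAllCharts (S := S) fun e p a b =>
    Coord.fourthOrderH α β γ κ hbar (M.g e) a b p = - (1 / (2 * hbar)) * T.comp e p a b

/-- `R_{ab} = 0`. -/
def RicciFlat : Prop :=
  InAllCharts (S := S) fun e p a b => Coord.ricci (M.g e) a b p = 0

/-- Asymptotic flatness. The complement of a compact part of the slice is an end `{‖y‖ > r}` in some
chart of the smooth structure, and there `N² = 1 + O(1/‖y‖)` and `h_{ij} = δ_{ij} + O(1/‖y‖)`, with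
each of the first two derivatives decaying one power faster. (The slice has no inner boundary.) -/
def AsymptoticallyFlat : Prop :=
  ∃ Φ ∈ IsManifold.maximalAtlas (𝓡 3) ∞ S, ∃ r > (0 : ℝ), ∃ C : ℝ,
    {y : E3 | r ≤ ‖y‖} ⊆ Φ.target ∧
    IsCompact (Φ.symm '' {y : E3 | r < ‖y‖})ᶜ ∧
    IsClosed (Φ.symm '' {y : E3 | r ≤ ‖y‖}) ∧
    ∀ k ≤ 2, ∀ y : E3, r < ‖y‖ →
      ‖iteratedFDeriv ℝ k (fun z => M.N (Φ.symm z) ^ 2 - 1) y‖ ≤ C / ‖y‖ ^ (k + 1) ∧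
      ∀ i j : Fin 3,
        ‖iteratedFDeriv ℝ k (fun z => M.hComp Φ z i j - (1 : Matrix (Fin 3) (Fin 3) ℝ) i j) y‖
          ≤ C / ‖y‖ ^ (k + 1)

/-- The Riemannian volume measure `√h d³x` of the slice: the smallest measure that dominates, for
every chart `e`, the measure with density `√(det h_{ij})` with respect to Lebesgue measure in that
chart. (Two such chart measures agree on overlaps, so on each chart domain it is the chart measure.) -/
def volumeMeasure [MeasurableSpace S] : Measure S :=
  ⨆ e : IsManifold.maximalAtlas (𝓡 3) ∞ S,
    Measure.map e.1.symm
      (((volume : Measure E3).restrict e.1.target).withDensity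
        (fun y => ENNReal.ofReal (Real.sqrt (M.hComp e.1 y).det)))

/-- The scalar `T^a_b T^b_c T^c_a` on the slice, with `T^a_b = g^{ac} T_{cb}`; it is the trace of the
cube of the matrix `T^a_b` in any coordinates, for instance those of the preferred chart at `x`. -/
def cubicTrace (T : StaticTensor S) (x : S) : ℝ :=
  let e := chartAt E3 x
  let p : Coord.Pt := Fin.cons 0 (fun i : Fin 3 => e x i)
  Matrix.trace (((M.g e p)⁻¹ * T.comp e p) ^ 3)

/-- `T` is the stress-energy tensor `T_{ab} = ρ u_a u_b + P (g_{ab} + u_a u_b)` of a perfect fluid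
with energy density `ρ ≥ 0`, pressure `P = w ρ`, unit timelike four-velocity `u`, and `w ≥ w₀`
everywhere. -/
def IsBarotropicFluid (w₀ : ℝ) (T : StaticTensor S) : Prop :=
  ∃ (ρ w : S → ℝ) (u : (x : S) → ℝ × TangentSpace (𝓡 3) x), ∀ x,
    0 ≤ ρ x ∧ w₀ ≤ w x ∧ M.metric x (u x) (u x) = -1 ∧
    ∀ a b, T x a b = ρ x * (M.metric x (u x) a * M.metric x (u x) b)
      + w x * ρ x * (M.metric x a b + M.metric x (u x) a * M.metric x (u x) b)

end StaticSpacetime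

end

/-! Einstein's equations eliminate `T` from the equations of fourth-order gravity. Its Einstein term
cancels as well, and what remains is that the quadratic-curvature part of `H_{ab}` vanishes
(`SolvesEinstein.fourthOrderH_eq`). Two scalar consequences of this, integrated over the slice,
force the Ricci tensor to vanish.

The trace is `(2α - 6β) □R = 0`, so `□R = 0` and `□(R²) = 2 |∇R|²`. On static functions `□` is a
divergence with respect to the volume `N √h d³x`, and `|∇R|² ≥ 0` because static gradients are
spatial. If the flux of `∇(R²)` through infinity vanishes, then `R` is constant on the connected
slice, and its decay gives `R = 0` (`SolvesFourthOrder.scalarCurv_eq_zero`).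

Next take the time-time component. Let `L = log N` and `σ = R_{ab} u^a u^b` for the static observers
`u`. The terms quadratic in the acceleration `∇L` cancel between `□R_{00}` and `R^{cd} R_{0c0d}`,
which leaves `□σ + 2 R^{cd} ∇_c∇_d L + ½ R^{ab} R_{ab} = 0`. Since `R = 0`, the contracted Bianchi
identity gives `∇^b R_{bc} = 0`, so the middle term is a divergence too: `∇^b (∂_b σ + 2 R_{bc} ∂^c
L) = -½ R^{ab} R_{ab}` (`divergence_current`). Staticity makes `R_{0i} = 0`, so `R^{ab} R_{ab}` is a
sum of squares (`ricciSq_nonneg`). Vanishing flux therefore gives `R_{ab} = 0`.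

The flux at infinity needs care. Asymptotic flatness controls two derivatives of the metric, hence
the curvature, but `∂σ` and `∂(R²)` contain third derivatives. The flux is therefore tested against
a cutoff `η(y / s)`, and the derivative of the potential is moved onto the cutoff (`tendsto_flux`):
a potential `O(s⁻²)` times `∂²η = O(s⁻²)`, over an annulus of volume `O(s³)`, tends to zero. The
field `2 R_{bc} ∂^c L` is `O(s⁻³)` and meets `∂η = O(s⁻¹)`, with the same outcome.

The divergence theorem on the slice is assembled from chart integrals by a partition of unity
(`chartInt_le_flux`). The transformation law of the curvature under changes of chart is read off
from Einstein's equations, because `T` is a tensor by definition.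

Conversely, `R_{ab} = 0` gives `T = 0` through Einstein's equations, and every term of `H_{ab}`
vanishes. -/

namespace Coord

/-! ### Calculus of component functions -/

variable {U : Set Pt} {f f₁ f₂ : Pt → ℝ} {p : Pt}

theorem differentiableAt_of_smooth (hU : IsOpen U) (hf : ContDiffOn ℝ ∞ f U) (hp : p ∈ U) :
    DifferentiableAt ℝ f p :=
  ((hf.contDiffAt (hU.mem_nhds hp)).differentiableAt (by simp))

theorem contDiffOn_pd (hU : IsOpen U) (hf : ContDiffOn ℝ ∞ f U) (a : Fin 4) :
    ContDiffOn ℝ ∞ (pd a f) U :=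
  (hf.fderiv_of_isOpen hU (m := ∞) (by simp)).clm_apply contDiffOn_const

theorem pd_congr (hU : IsOpen U) (h : ∀ q ∈ U, f₁ q = f₂ q) (hp : p ∈ U) (a : Fin 4) :
    pd a f₁ p = pd a f₂ p := by
  have : f₁ =ᶠ[nhds p] f₂ := Filter.eventuallyEq_of_mem (hU.mem_nhds hp) h
  simp only [pd, this.fderiv_eq]

theorem pd_const (a : Fin 4) (c : ℝ) (p : Pt) : pd a (fun _ => c) p = 0 := by simp [pd]

theorem pd_add (h₁ : DifferentiableAt ℝ f₁ p) (h₂ : DifferentiableAt ℝ f₂ p) (a : Fin 4) :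
    pd a (fun q => f₁ q + f₂ q) p = pd a f₁ p + pd a f₂ p := by
  simp [pd, fderiv_fun_add h₁ h₂]

theorem pd_sub (h₁ : DifferentiableAt ℝ f₁ p) (h₂ : DifferentiableAt ℝ f₂ p) (a : Fin 4) :
    pd a (fun q => f₁ q - f₂ q) p = pd a f₁ p - pd a f₂ p := by
  simp [pd, fderiv_fun_sub h₁ h₂]

theorem pd_neg (f : Pt → ℝ) (p : Pt) (a : Fin 4) : pd a (fun q => - f q) p = - pd a f p := by
  simp [pd]

theorem pd_mul (h₁ : DifferentiableAt ℝ f₁ p) (h₂ : DifferentiableAt ℝ f₂ p) (a : Fin 4) :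
    pd a (fun q => f₁ q * f₂ q) p = pd a f₁ p * f₂ p + f₁ p * pd a f₂ p := by
  simp [pd, fderiv_fun_mul h₁ h₂]; ring

theorem pd_sum {ι : Type*} (s : Finset ι) {F : ι → Pt → ℝ}
    (h : ∀ i ∈ s, DifferentiableAt ℝ (F i) p) (a : Fin 4) :
    pd a (fun q => ∑ i ∈ s, F i q) p = ∑ i ∈ s, pd a (F i) p := by
  simp [pd, fderiv_fun_sum h]

theorem pd_comm (hU : IsOpen U) (hf : ContDiffOn ℝ ∞ f U) (hp : p ∈ U) (a b : Fin 4) :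
    pd a (pd b f) p = pd b (pd a f) p := by
  have hf' := hf.contDiffAt (hU.mem_nhds hp)
  have hs : IsSymmSndFDerivAt ℝ f p := hf'.isSymmSndFDerivAt (by
    rw [minSmoothness_of_isRCLikeNormedField]
    exact WithTop.coe_le_coe.2 (le_top (a := (2 : ℕ∞))))
  have hd : DifferentiableAt ℝ (fderiv ℝ f) p :=
    ((hf.fderiv_of_isOpen hU (m := ∞) (by simp)).contDiffAt (hU.mem_nhds hp)).differentiableAt
      (by simp)
  have key : ∀ a b : Fin 4, pd a (pd b f) p
      = fderiv ℝ (fderiv ℝ f) p (Pi.single a 1) (Pi.single b 1) := by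
    intro a b
    have : pd b f = fun q => fderiv ℝ f q (Pi.single b 1) := rfl
    rw [pd, this, fderiv_clm_apply hd (differentiableAt_const _)]
    simp
  rw [key, key, hs.eq]

/-! ### Matrix-valued functions -/

/-- Entrywise smoothness of a matrix-valued function on a set. -/
def SmoothMatrix (U : Set Pt) (A : Pt → Matrix (Fin 4) (Fin 4) ℝ) : Prop :=
  ∀ a b, ContDiffOn ℝ ∞ (fun p => A p a b) U

/-- The entrywise partial derivative of a matrix-valued function. -/
noncomputable def pdM (c : Fin 4) (A : Pt → Matrix (Fin 4) (Fin 4) ℝ) (p : Pt) : Matrix (Fin 4) (Fin 4) ℝ :=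
  Matrix.of fun a b => pd c (fun q => A q a b) p

variable {A B : Pt → Matrix (Fin 4) (Fin 4) ℝ}

theorem SmoothMatrix.differentiableAt (hA : SmoothMatrix U A) (hU : IsOpen U) (hp : p ∈ U)
    (a b : Fin 4) : DifferentiableAt ℝ (fun q => A q a b) p :=
  differentiableAt_of_smooth hU (hA a b) hp

theorem SmoothMatrix.pdM (hA : SmoothMatrix U A) (hU : IsOpen U) (c : Fin 4) :
    SmoothMatrix U (pdM c A) := fun a b => contDiffOn_pd hU (hA a b) c

theorem SmoothMatrix.mul (hA : SmoothMatrix U A) (hB : SmoothMatrix U B) :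
    SmoothMatrix U (fun p => A p * B p) := fun a b => by
  simp only [Matrix.mul_apply]
  exact ContDiffOn.sum fun c _ => (hA a c).mul (hB c b)

theorem SmoothMatrix.add (hA : SmoothMatrix U A) (hB : SmoothMatrix U B) :
    SmoothMatrix U (fun p => A p + B p) := fun a b => (hA a b).add (hB a b)

theorem SmoothMatrix.sub (hA : SmoothMatrix U A) (hB : SmoothMatrix U B) :
    SmoothMatrix U (fun p => A p - B p) := fun a b => (hA a b).sub (hB a b)

theorem SmoothMatrix.transpose (hA : SmoothMatrix U A) :
    SmoothMatrix U (fun p => (A p).transpose) := fun a b => hA b a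

theorem SmoothMatrix.det (hA : SmoothMatrix U A) : ContDiffOn ℝ ∞ (fun p => (A p).det) U := by
  simp only [Matrix.det_apply]
  exact ContDiffOn.sum fun σ _ => (contDiffOn_prod fun i _ => hA _ _).const_smul _

theorem SmoothMatrix.inv (hA : SmoothMatrix U A) (hdet : ∀ p ∈ U, IsUnit (A p).det) :
    SmoothMatrix U (fun p => (A p)⁻¹) := fun a b => by
  have h1 : ContDiffOn ℝ ∞ (fun p => (A p).adjugate a b) U := by
    simp only [Matrix.adjugate_apply]
    refine SmoothMatrix.det (A := fun p => (A p).updateRow b (Pi.single a 1)) fun i j => ?_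
    by_cases h : i = b
    · subst h; simpa using contDiffOn_const
    · simpa [Matrix.updateRow_ne h] using hA i j
  simp only [Matrix.inv_def, Matrix.smul_apply, Ring.inverse_eq_inv', smul_eq_mul]
  exact (hA.det.inv fun p hp => (hdet p hp).ne_zero).mul h1

theorem pdM_mul (hU : IsOpen U) (hA : SmoothMatrix U A) (hB : SmoothMatrix U B) (hp : p ∈ U)
    (c : Fin 4) : pdM c (fun q => A q * B q) p = pdM c A p * B p + A p * pdM c B p := by
  ext a b
  simp only [pdM, Matrix.of_apply, Matrix.add_apply, Matrix.mul_apply]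
  rw [pd_sum _ fun i _ => (hA.differentiableAt hU hp a i).fun_mul (hB.differentiableAt hU hp i b),
    ← Finset.sum_add_distrib]
  exact Finset.sum_congr rfl fun i _ =>
    pd_mul (hA.differentiableAt hU hp a i) (hB.differentiableAt hU hp i b) c

theorem pdM_add (hU : IsOpen U) (hA : SmoothMatrix U A) (hB : SmoothMatrix U B) (hp : p ∈ U)
    (c : Fin 4) : pdM c (fun q => A q + B q) p = pdM c A p + pdM c B p := by
  ext a b
  exact pd_add (hA.differentiableAt hU hp a b) (hB.differentiableAt hU hp a b) c

theorem pdM_sub (hU : IsOpen U) (hA : SmoothMatrix U A) (hB : SmoothMatrix U B) (hp : p ∈ U)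
    (c : Fin 4) : pdM c (fun q => A q - B q) p = pdM c A p - pdM c B p := by
  ext a b
  exact pd_sub (hA.differentiableAt hU hp a b) (hB.differentiableAt hU hp a b) c

theorem pdM_transpose (A : Pt → Matrix (Fin 4) (Fin 4) ℝ) (p : Pt) (c : Fin 4) :
    pdM c (fun q => (A q).transpose) p = (pdM c A p).transpose := rfl

theorem pdM_congr (hU : IsOpen U) (h : ∀ q ∈ U, A q = B q) (hp : p ∈ U) (c : Fin 4) :
    pdM c A p = pdM c B p := by
  ext a b
  exact pd_congr hU (fun q hq => by rw [h q hq]) hp c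

theorem pdM_comm (hU : IsOpen U) (hA : SmoothMatrix U A) (hp : p ∈ U) (c d : Fin 4) :
    pdM c (pdM d A) p = pdM d (pdM c A) p := by
  ext a b
  exact pd_comm hU (hA a b) hp c d

/-! ### Metrics -/

/-- `g` is a smooth nondegenerate metric on the open set `U`. -/
structure IsMetricOn (g : Pt → Matrix (Fin 4) (Fin 4) ℝ) (U : Set Pt) : Prop where
  isOpen : IsOpen U
  smooth : SmoothMatrix U g
  symm : ∀ p ∈ U, (g p).transpose = g p
  isUnit_det : ∀ p ∈ U, IsUnit (g p).det

/-- The connection matrices `(Γ_c)^a_b`. -/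
noncomputable def conn (g : Pt → Matrix (Fin 4) (Fin 4) ℝ) (c : Fin 4) (p : Pt) : Matrix (Fin 4) (Fin 4) ℝ :=
  Matrix.of fun a b => christoffel g a b c p

/-- The curvature matrices `(F_{cd})^a_b = R^a_{bcd}`. -/
noncomputable def curv (g : Pt → Matrix (Fin 4) (Fin 4) ℝ) (c d : Fin 4) (p : Pt) : Matrix (Fin 4) (Fin 4) ℝ :=
  Matrix.of fun a b => riemann g a b c d p

variable {g : Pt → Matrix (Fin 4) (Fin 4) ℝ}

namespace IsMetricOn

variable (hg : IsMetricOn g U)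
include hg

theorem symm_apply (hp : p ∈ U) (a b : Fin 4) : g p a b = g p b a :=
  congrFun (congrFun (hg.symm p hp) b) a

theorem inv_transpose (hp : p ∈ U) : ((g p)⁻¹).transpose = (g p)⁻¹ := by
  rw [Matrix.transpose_nonsing_inv, hg.symm p hp]

theorem inv_symm_apply (hp : p ∈ U) (a b : Fin 4) : (g p)⁻¹ a b = (g p)⁻¹ b a :=
  congrFun (congrFun (hg.inv_transpose hp) b) a

theorem smooth_inv : SmoothMatrix U (fun p => (g p)⁻¹) := hg.smooth.inv hg.isUnit_det

theorem mul_inv (hp : p ∈ U) : g p * (g p)⁻¹ = 1 := Matrix.mul_nonsing_inv _ (hg.isUnit_det p hp)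

theorem inv_mul (hp : p ∈ U) : (g p)⁻¹ * g p = 1 := Matrix.nonsing_inv_mul _ (hg.isUnit_det p hp)

theorem pd_symm (hp : p ∈ U) (a b c : Fin 4) :
    pd c (fun q => g q a b) p = pd c (fun q => g q b a) p :=
  pd_congr hg.isOpen (fun _ hq => hg.symm_apply hq a b) hp c

theorem christoffel_symm (hp : p ∈ U) (a b c : Fin 4) :
    christoffel g a b c p = christoffel g a c b p := by
  unfold christoffel
  congr 1
  refine Finset.sum_congr rfl fun d _ => ?_
  rw [hg.pd_symm hp b c d]
  ring

theorem smooth_christoffel (a b c : Fin 4) : ContDiffOn ℝ ∞ (christoffel g a b c) U := by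
  unfold christoffel
  refine contDiffOn_const.mul (ContDiffOn.sum fun d _ => (hg.smooth_inv a d).mul ?_)
  exact ((contDiffOn_pd hg.isOpen (hg.smooth d c) b).add
    (contDiffOn_pd hg.isOpen (hg.smooth d b) c)).sub (contDiffOn_pd hg.isOpen (hg.smooth b c) d)

theorem smooth_conn (c : Fin 4) : SmoothMatrix U (conn g c) := fun a b => hg.smooth_christoffel a b c

/-- Metric compatibility, `∂_c g_{ab} = Γ^e_{ca} g_{eb} + Γ^e_{cb} g_{ae}`. -/
theorem pdM_metric (hp : p ∈ U) (c : Fin 4) :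
    pdM c g p = (conn g c p).transpose * g p + g p * conn g c p := by
  have key : ∀ a b, (g p * conn g c p) a b = (1 / 2) *
      (pd b (fun q => g q a c) p + pd c (fun q => g q a b) p - pd a (fun q => g q b c) p) := by
    intro a b
    have : (g p * conn g c p) a b = (1 / 2) * ((g p * (g p)⁻¹).mulVec fun d =>
        pd b (fun q => g q d c) p + pd c (fun q => g q d b) p - pd d (fun q => g q b c) p) a := by
      rw [← Matrix.mulVec_mulVec]
      simp only [Matrix.mul_apply, conn, Matrix.of_apply, christoffel, Matrix.mulVec, dotProduct]
      rw [Finset.mul_sum]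
      exact Finset.sum_congr rfl fun _ _ => by ring
    rw [this, hg.mul_inv hp, Matrix.one_mulVec]
  ext a b
  have h2 : ((conn g c p).transpose * g p) a b = (g p * conn g c p) b a := by
    conv_lhs => rw [← hg.symm p hp, ← Matrix.transpose_mul]
    rfl
  rw [Matrix.add_apply, h2, key, key, hg.pd_symm hp b a c, hg.pd_symm hp a c b, hg.pd_symm hp b c a,
    pdM, Matrix.of_apply]
  ring_nf

/-- Differentiate `g⁻¹ g = 1` and insert metric compatibility. -/
theorem pdM_inv (hp : p ∈ U) (c : Fin 4) :
    pdM c (fun q => (g q)⁻¹) p = -((g p)⁻¹ * (conn g c p).transpose) - conn g c p * (g p)⁻¹ := by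
  have h0 : pdM c (fun q => (g q)⁻¹ * g q) p = 0 := by
    rw [pdM_congr hg.isOpen (B := fun _ => 1) (fun q hq => hg.inv_mul hq) hp]
    ext a b
    exact pd_const c _ p
  rw [pdM_mul hg.isOpen hg.smooth_inv hg.smooth hp, hg.pdM_metric hp] at h0
  have h1 := congrArg (· * (g p)⁻¹) h0
  simp only [Matrix.add_mul, Matrix.mul_add, Matrix.zero_mul, Matrix.mul_assoc, hg.mul_inv hp,
    Matrix.mul_one] at h1
  rw [← Matrix.mul_assoc ((g p)⁻¹) (g p), hg.inv_mul hp, Matrix.one_mul] at h1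
  rw [eq_neg_of_add_eq_zero_left h1]
  abel

/-- The curvature as `dΓ + Γ ∧ Γ` for matrix-valued connection forms. Torsion-freeness is what lets
the differentiation index serve as the form index. In this form the Bianchi identities become
noncommutative algebra. -/
theorem curv_eq (hp : p ∈ U) (c d : Fin 4) :
    curv g c d p = pdM c (conn g d) p - pdM d (conn g c) p + conn g c p * conn g d p
      - conn g d p * conn g c p := by
  ext a b
  simp only [curv, riemann, conn, pdM, Matrix.of_apply, Matrix.sub_apply, Matrix.add_apply,
    Matrix.mul_apply]
  rw [add_sub_assoc, ← Finset.sum_sub_distrib]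
  refine congrArg₂ _ rfl (Finset.sum_congr rfl fun e _ => ?_)
  rw [hg.christoffel_symm hp a c e, hg.christoffel_symm hp a d e]

theorem smooth_riemann (a b c d : Fin 4) : ContDiffOn ℝ ∞ (riemann g a b c d) U := by
  unfold riemann
  have h := hg.smooth_christoffel
  exact ((contDiffOn_pd hg.isOpen (h _ _ _) c).sub (contDiffOn_pd hg.isOpen (h _ _ _) d)).add
    (ContDiffOn.sum fun e _ => ((h _ _ _).mul (h _ _ _)).sub ((h _ _ _).mul (h _ _ _)))

theorem smooth_curv (c d : Fin 4) : SmoothMatrix U (curv g c d) :=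
  fun a b => hg.smooth_riemann a b c d

theorem smooth_ricci (a b : Fin 4) : ContDiffOn ℝ ∞ (ricci g a b) U :=
  ContDiffOn.sum fun _ _ => hg.smooth_riemann _ _ _ _

theorem smooth_scalarCurv : ContDiffOn ℝ ∞ (scalarCurv g) U :=
  ContDiffOn.sum fun _ _ => ContDiffOn.sum fun _ _ =>
    (hg.smooth_inv _ _).mul (hg.smooth_ricci _ _)

omit hg in
theorem curv_swap (c d : Fin 4) (p : Pt) : curv g c d p = - curv g d c p := by
  ext a b
  simp only [curv, riemann, Matrix.of_apply, Matrix.neg_apply, Finset.sum_sub_distrib]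
  ring

/-- `R_{abcd} = - R_{bacd}`. -/
theorem curv_antisymm (hp : p ∈ U) (c d : Fin 4) :
    (curv g c d p).transpose * g p + g p * curv g c d p = 0 := by
  have h1 : ∀ c d, pdM c (pdM d g) p =
      ((pdM c (conn g d) p).transpose * g p +
        (conn g d p).transpose * ((conn g c p).transpose * g p + g p * conn g c p)) +
      (((conn g c p).transpose * g p + g p * conn g c p) * conn g d p
        + g p * pdM c (conn g d) p) := by
    intro c d
    have hc := hg.smooth_conn d
    rw [pdM_congr hg.isOpen (fun q hq => hg.pdM_metric hq d) hp,
      pdM_add hg.isOpen (hc.transpose.mul hg.smooth) (hg.smooth.mul hc) hp,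
      pdM_mul hg.isOpen hc.transpose hg.smooth hp, pdM_mul hg.isOpen hg.smooth hc hp,
      hg.pdM_metric hp c, pdM_transpose]
  -- Equality of the mixed partials of `g`, after both are expanded by metric compatibility, is the
  -- claimed antisymmetry.
  have h2 := pdM_comm hg.isOpen hg.smooth hp c d
  rw [h1, h1, ← sub_eq_zero] at h2
  rw [hg.curv_eq hp, ← h2]
  simp only [Matrix.transpose_sub, Matrix.transpose_add, Matrix.transpose_mul]
  noncomm_ring

/-- The second Bianchi identity. -/
theorem bianchi (hp : p ∈ U) (e c d : Fin 4) :
    (pdM e (curv g c d) p + conn g e p * curv g c d p - curv g c d p * conn g e p)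
    + (pdM c (curv g d e) p + conn g c p * curv g d e p - curv g d e p * conn g c p)
    + (pdM d (curv g e c) p + conn g d p * curv g e c p - curv g e c p * conn g d p) = 0 := by
  have hc := hg.smooth_conn
  have hU := hg.isOpen
  have h1 : ∀ e c d, pdM e (curv g c d) p = pdM e (pdM c (conn g d)) p - pdM e (pdM d (conn g c)) p
      + (pdM e (conn g c) p * conn g d p + conn g c p * pdM e (conn g d) p)
      - (pdM e (conn g d) p * conn g c p + conn g d p * pdM e (conn g c) p) := by
    intro e c d
    rw [pdM_congr hU (fun q hq => hg.curv_eq hq c d) hp,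
      pdM_sub hU ((((hc d).pdM hU c).sub ((hc c).pdM hU d)).add ((hc c).mul (hc d)))
        ((hc d).mul (hc c)) hp,
      pdM_add hU (((hc d).pdM hU c).sub ((hc c).pdM hU d)) ((hc c).mul (hc d)) hp,
      pdM_sub hU ((hc d).pdM hU c) ((hc c).pdM hU d) hp,
      pdM_mul hU (hc c) (hc d) hp, pdM_mul hU (hc d) (hc c) hp]
  -- The second derivatives of the connection cancel in pairs by symmetry of mixed partials; the
  -- remaining cubic and mixed terms cancel by the Jacobi identity and the Leibniz rule.
  rw [h1, h1, h1, hg.curv_eq hp, hg.curv_eq hp, hg.curv_eq hp,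
    pdM_comm hU (hc d) hp e c, pdM_comm hU (hc c) hp e d, pdM_comm hU (hc e) hp d c]
  noncomm_ring

end IsMetricOn

end Coord

/-! ### Divergences, traces and the contracted Bianchi identity -/

namespace Coord

theorem sum_rotate {ι₁ ι₂ ι₃ : Type*} [Fintype ι₁] [Fintype ι₂] [Fintype ι₃]
    (F : ι₁ → ι₂ → ι₃ → ℝ) : ∑ a, ∑ b, ∑ c, F a b c = ∑ c, ∑ a, ∑ b, F a b c := by
  rw [Finset.sum_comm (f := fun c a => ∑ b, F a b c)]
  exact Finset.sum_congr rfl fun a _ => Finset.sum_comm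

/-- The index bookkeeping of the double contraction, separated from calculus. Here `M c d a b`
stands for `R^{ab}_{cd}`, `dM` for its partial derivatives, and `X` for the derivative corrected
only in the upper indices: the corrections in the lower indices drop out of the cyclic sum by
torsion-freeness. Contracting upper against lower indices gives one term `∂_e R` and two equal terms
`-∇_a R^a_e`, up to the missing lower corrections. -/
theorem contracted_bianchi_algebra (Γ : Fin 4 → Fin 4 → Fin 4 → ℝ) (M : Fin 4 → Fin 4 → Fin 4 → Fin 4 → ℝ)
    (dM : Fin 4 → Fin 4 → Fin 4 → Fin 4 → Fin 4 → ℝ)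
    (hΓ : ∀ a b c, Γ a b c = Γ a c b)
    (hM1 : ∀ c d a b, M c d a b = - M d c a b) (hM2 : ∀ c d a b, M c d a b = - M c d b a)
    (hdM1 : ∀ e c d a b, dM e c d a b = - dM e d c a b)
    (hdM2 : ∀ e c d a b, dM e c d a b = - dM e c d b a)
    (X : Fin 4 → Fin 4 → Fin 4 → Fin 4 → Fin 4 → ℝ)
    (hX : ∀ e c d a b, X e c d a b = dM e c d a b + ∑ m, Γ a m e * M c d m b + ∑ m, M c d a m * Γ b m e)
    (cyc : ∀ e c d a b, X e c d a b + X c d e a b + X d e c a b = 0) (e : Fin 4) :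
    ∑ a, (∑ c, dM a c e c a + ∑ m, Γ a m a * ∑ c, M c e c m - ∑ m, Γ m a e * ∑ c, M c m c a)
      = (1 / 2) * ∑ c, ∑ d, dM e c d c d := by
  have T1 : ∑ c, ∑ d, X e c d c d = ∑ c, ∑ d, dM e c d c d
      + 2 * ∑ a, ∑ m, Γ m a e * ∑ c, M c m c a := by
    simp only [hX, Finset.sum_add_distrib]
    have h1 : ∑ c, ∑ d, ∑ m, Γ c m e * M c d m d = ∑ a, ∑ m, Γ m a e * ∑ c, M c m c a := by
      rw [Finset.sum_comm]
      simp only [Finset.mul_sum]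
      rw [Finset.sum_comm]
      rw [Finset.sum_comm (f := fun a m => ∑ c, Γ m a e * M c m c a)]
      refine Finset.sum_congr rfl fun c _ => ?_
      rw [Finset.sum_comm]
      refine Finset.sum_congr rfl fun m _ => Finset.sum_congr rfl fun d _ => ?_
      rw [hM1 c d, hM2 d c]; ring
    have h2 : ∑ c, ∑ d, ∑ m, M c d c m * Γ d m e = ∑ a, ∑ m, Γ m a e * ∑ c, M c m c a := by
      simp only [Finset.mul_sum]
      rw [Finset.sum_comm]
      rw [Finset.sum_comm (f := fun a m => ∑ c, Γ m a e * M c m c a)]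
      refine Finset.sum_congr rfl fun d _ => ?_
      rw [Finset.sum_comm]
      exact Finset.sum_congr rfl fun m _ => Finset.sum_congr rfl fun c _ => mul_comm _ _
    rw [h1, h2]; ring
  have T2 : ∑ c, ∑ d, X c d e c d = - ∑ a, (∑ c, dM a c e c a + ∑ m, Γ a m a * ∑ c, M c e c m) := by
    simp only [hX, Finset.sum_add_distrib]
    have h1 : ∑ c, ∑ d, dM c d e c d = - ∑ a, ∑ c, dM a c e c a := by
      simp only [← Finset.sum_neg_distrib]
      exact Finset.sum_congr rfl fun a _ => Finset.sum_congr rfl fun c _ => hdM2 _ _ _ _ _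
    have h2 : ∑ c, ∑ d, ∑ m, Γ c m c * M d e m d = - ∑ a, ∑ m, Γ a m a * ∑ c, M c e c m := by
      simp only [← Finset.sum_neg_distrib, Finset.mul_sum]
      refine Finset.sum_congr rfl fun a _ => ?_
      rw [Finset.sum_comm]
      refine Finset.sum_congr rfl fun m _ => Finset.sum_congr rfl fun c _ => ?_
      rw [hM2]; ring
    -- Antisymmetry of the curvature in `c`, `m` against symmetry of the connection in the same
    -- pair.
    have h3 : ∑ c, ∑ d, ∑ m, M d e c m * Γ d m c = 0 := by
      rw [Finset.sum_comm]
      refine Finset.sum_eq_zero fun d _ => ?_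
      have : ∑ c, ∑ m, M d e c m * Γ d m c = - ∑ c, ∑ m, M d e c m * Γ d m c := by
        conv_lhs => rw [Finset.sum_comm]
        simp only [← Finset.sum_neg_distrib]
        refine Finset.sum_congr rfl fun a _ => Finset.sum_congr rfl fun c _ => ?_
        rw [hM2, hΓ]; ring
      linarith
    rw [h1, h2, h3]; ring
  have T3 : ∑ c, ∑ d, X d e c c d = - ∑ a, (∑ c, dM a c e c a + ∑ m, Γ a m a * ∑ c, M c e c m) := by
    rw [← T2, Finset.sum_comm]
    refine Finset.sum_congr rfl fun a _ => Finset.sum_congr rfl fun c _ => ?_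
    simp only [hX]
    rw [hdM1, hdM2, neg_neg, add_right_comm]
    refine congrArg₂ _ (congrArg₂ _ rfl ?_) ?_ <;> refine Finset.sum_congr rfl fun m _ => ?_
    · rw [hM1, hM2]; ring
    · rw [hM1, hM2]; ring
  have h0 : ∑ c, ∑ d, (X e c d c d + X c d e c d + X d e c c d) = 0 := by simp only [cyc, Finset.sum_const_zero]
  simp only [Finset.sum_add_distrib] at h0
  rw [T1, T2, T3] at h0
  simp only [Finset.sum_sub_distrib, Finset.sum_add_distrib] at h0 ⊢
  linarith

variable {U : Set Pt} {p : Pt} {g : Pt → Matrix (Fin 4) (Fin 4) ℝ}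

/-- The covariant derivative `∇_a ξ_b` of a covector field. -/
noncomputable def covD1 (g : Pt → Matrix (Fin 4) (Fin 4) ℝ) (ξ : Fin 4 → Pt → ℝ) (a b : Fin 4)
    (p : Pt) : ℝ :=
  pd a (ξ b) p - ∑ m, christoffel g m a b p * ξ m p

/-- The vector field `g^{ab} ξ_b`. -/
noncomputable def raise (g : Pt → Matrix (Fin 4) (Fin 4) ℝ) (ξ : Fin 4 → Pt → ℝ) (a : Fin 4)
    (p : Pt) : ℝ :=
  ∑ b, (g p)⁻¹ a b * ξ b p

namespace IsMetricOn

variable (hg : IsMetricOn g U)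
include hg

theorem smooth_raise {ξ : Fin 4 → Pt → ℝ} (hξ : ∀ b, ContDiffOn ℝ ∞ (ξ b) U) (a : Fin 4) :
    ContDiffOn ℝ ∞ (raise g ξ a) U :=
  ContDiffOn.sum fun b _ => (hg.smooth_inv a b).mul (hξ b)

theorem pd_inv (hp : p ∈ U) (a b c : Fin 4) :
    pd c (fun q => (g q)⁻¹ a b) p = -(∑ m, (g p)⁻¹ a m * christoffel g b m c p)
      - ∑ m, christoffel g a m c p * (g p)⁻¹ m b := by
  have := congrFun (congrFun (hg.pdM_inv hp c) a) b
  simpa [pdM, conn, Matrix.mul_apply] using this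

/-- This is `∇_c ξ^a = g^{ab} ∇_c ξ_b`, with the connection term of the vector field moved to the
right. -/
theorem pd_raise (hp : p ∈ U) {ξ : Fin 4 → Pt → ℝ} (hξ : ∀ b, ContDiffOn ℝ ∞ (ξ b) U)
    (a c : Fin 4) :
    pd c (raise g ξ a) p = ∑ b, (g p)⁻¹ a b * covD1 g ξ c b p
      - ∑ m, christoffel g a m c p * raise g ξ m p := by
  have hd := fun b => differentiableAt_of_smooth hg.isOpen (hξ b) hp
  have hi := fun b => hg.smooth_inv.differentiableAt hg.isOpen hp a b
  have h1 : pd c (raise g ξ a) p = ∑ b, (pd c (fun q => (g q)⁻¹ a b) p * ξ b p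
      + (g p)⁻¹ a b * pd c (ξ b) p) := by
    rw [show raise g ξ a = fun q => ∑ b, (g q)⁻¹ a b * ξ b q from rfl,
      pd_sum _ fun b _ => (hi b).fun_mul (hd b)]
    exact Finset.sum_congr rfl fun b _ => pd_mul (hi b) (hd b) c
  have h2 : ∑ b, (∑ m, (g p)⁻¹ a m * christoffel g b m c p) * ξ b p
      = ∑ b, (g p)⁻¹ a b * ∑ m, christoffel g m c b p * ξ m p := by
    simp only [Finset.sum_mul, Finset.mul_sum]
    rw [Finset.sum_comm]
    refine Finset.sum_congr rfl fun b _ => Finset.sum_congr rfl fun m _ => ?_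
    rw [hg.christoffel_symm hp m c b]; ring
  have h3 : ∑ b, (∑ m, christoffel g a m c p * (g p)⁻¹ m b) * ξ b p
      = ∑ m, christoffel g a m c p * raise g ξ m p := by
    simp only [Finset.sum_mul, Finset.mul_sum, raise]
    rw [Finset.sum_comm]
    exact Finset.sum_congr rfl fun b _ => Finset.sum_congr rfl fun m _ => by ring
  rw [h1, ← h3]
  simp only [hg.pd_inv hp, covD1, mul_sub, sub_mul, neg_mul, Finset.sum_add_distrib,
    Finset.sum_sub_distrib, Finset.sum_neg_distrib]
  rw [h2]; ring

/-- `∂_a (w g^{ab} ξ_b) = w g^{ab} ∇_a ξ_b` for a density `w`. -/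
theorem divergence_raise (hp : p ∈ U) {ξ : Fin 4 → Pt → ℝ} (hξ : ∀ b, ContDiffOn ℝ ∞ (ξ b) U)
    {w : Pt → ℝ} (hw : ContDiffOn ℝ ∞ w U)
    (hdw : ∀ c, pd c w p = w p * ∑ a, christoffel g a c a p) :
    ∑ a, pd a (fun q => w q * raise g ξ a q) p
      = w p * ∑ a, ∑ b, (g p)⁻¹ a b * covD1 g ξ a b p := by
  have h1 : ∀ a, pd a (fun q => w q * raise g ξ a q) p
      = w p * ((∑ m, christoffel g m a m p) * raise g ξ a p
        + (∑ b, (g p)⁻¹ a b * covD1 g ξ a b p - ∑ m, christoffel g a m a p * raise g ξ m p)) := by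
    intro a
    rw [pd_mul (differentiableAt_of_smooth hg.isOpen hw hp)
      (differentiableAt_of_smooth hg.isOpen (hg.smooth_raise hξ a) hp), hdw, hg.pd_raise hp hξ]
    ring
  simp only [h1, ← Finset.mul_sum, Finset.sum_add_distrib, Finset.sum_sub_distrib]
  have h2 : ∑ a, (∑ m, christoffel g m a m p) * raise g ξ a p
      = ∑ a, ∑ m, christoffel g a m a p * raise g ξ m p := by
    simp only [Finset.sum_mul]
    rw [Finset.sum_comm]
  rw [h2]; ring

/-- The trace commutes with the covariant derivative. -/
theorem trace_covD (hp : p ∈ U) {T : Fin 4 → Fin 4 → Pt → ℝ}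
    (hT : ∀ a b, ContDiffOn ℝ ∞ (T a b) U) (c : Fin 4) :
    ∑ a, ∑ b, (g p)⁻¹ a b * covD g T c a b p
      = pd c (fun q => ∑ a, ∑ b, (g q)⁻¹ a b * T a b q) p := by
  have h1 : pd c (fun q => ∑ a, ∑ b, (g q)⁻¹ a b * T a b q) p
      = ∑ a, pd c (raise g (T a) a) p :=
    pd_sum (F := fun a => raise g (T a) a) _
      (fun a _ => differentiableAt_of_smooth hg.isOpen (hg.smooth_raise (hT a) a) hp) c
  have h2 : ∑ a, ∑ m, christoffel g a m c p * raise g (T a) m p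
      = ∑ a, ∑ b, (g p)⁻¹ a b * ∑ e, christoffel g e c a p * T e b p := by
    simp only [raise, Finset.mul_sum]
    rw [Finset.sum_comm]
    refine Finset.sum_congr rfl fun a _ => ?_
    rw [Finset.sum_comm]
    refine Finset.sum_congr rfl fun b _ => Finset.sum_congr rfl fun e _ => ?_
    rw [hg.christoffel_symm hp e c a]; ring
  simp only [h1, hg.pd_raise hp (hT _), Finset.sum_sub_distrib, h2, covD, covD1,
    Finset.sum_add_distrib, mul_sub, mul_add]
  ring

theorem smooth_covD {T : Fin 4 → Fin 4 → Pt → ℝ}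
    (hT : ∀ a b, ContDiffOn ℝ ∞ (T a b) U) (c a b : Fin 4) :
    ContDiffOn ℝ ∞ (covD g T c a b) U :=
  (contDiffOn_pd hg.isOpen (hT a b) c).sub (ContDiffOn.sum fun e _ =>
    ((hg.smooth_christoffel e c a).mul (hT e b)).add ((hg.smooth_christoffel e c b).mul (hT a e)))

/-- The trace commutes with the wave operator. -/
theorem trace_boxTensor (hp : p ∈ U) {T : Fin 4 → Fin 4 → Pt → ℝ}
    (hT : ∀ a b, ContDiffOn ℝ ∞ (T a b) U) :
    ∑ a, ∑ b, (g p)⁻¹ a b * boxTensor g T a b p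
      = boxScalar g (fun q => ∑ a, ∑ b, (g q)⁻¹ a b * T a b q) p := by
  -- With the derivative index `c` frozen, `∇_c T` is treated as a family of two-tensors. The second
  -- covariant derivative differs from the covariant derivative of this family only by the
  -- connection term for `c`, so `trace_covD` can be applied twice.
  have h1 : ∀ d c a b, covD2 g T d c a b p = covD g (covD g T c) d a b p
      - ∑ e, christoffel g e d c p * covD g T e a b p := by
    intro d c a b
    simp only [covD2, covD, Finset.sum_add_distrib]
    ring
  have h2 : ∀ d c, ∑ a, ∑ b, (g p)⁻¹ a b * covD2 g T d c a b p
      = hess g (fun q => ∑ a, ∑ b, (g q)⁻¹ a b * T a b q) d c p := by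
    intro d c
    simp only [h1, mul_sub, Finset.sum_sub_distrib, hess]
    rw [hg.trace_covD hp (hg.smooth_covD hT c),
      pd_congr hg.isOpen (fun q hq => hg.trace_covD hq hT c) hp]
    congr 1
    simp only [← hg.trace_covD hp hT, Finset.mul_sum]
    rw [sum_rotate]
    refine Finset.sum_congr rfl fun e _ => Finset.sum_congr rfl fun a _ =>
      Finset.sum_congr rfl fun b _ => by ring
  simp only [boxTensor, boxScalar, ← h2, Finset.mul_sum]
  rw [sum_rotate]
  refine Finset.sum_congr rfl fun d _ => ?_
  rw [sum_rotate]
  refine Finset.sum_congr rfl fun c _ => Finset.sum_congr rfl fun a _ =>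
    Finset.sum_congr rfl fun b _ => by ring

/-- `∇_a (g^{mb} ξ_b) = g^{mb} ∇_a ξ_b`, and the Leibniz rule for the divergence of `T_{bc} A^c`. -/
theorem divergence_contract (hp : p ∈ U) {T : Fin 4 → Fin 4 → Pt → ℝ}
    (hT : ∀ a b, ContDiffOn ℝ ∞ (T a b) U) {f : Pt → ℝ} (hf : ContDiffOn ℝ ∞ f U) :
    ∑ a, ∑ b, (g p)⁻¹ a b *
        covD1 g (fun b q => ∑ c, T b c q * raise g (fun d => pd d f) c q) a b p
      = ∑ c, (∑ a, ∑ b, (g p)⁻¹ a b * covD g T a b c p) * raise g (fun d => pd d f) c p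
        + ∑ a, ∑ d, (∑ b, ∑ m, (g p)⁻¹ a b * (g p)⁻¹ d m * T b m p) * hess g f a d p := by
  set A := raise g (fun d => pd d f) with hA
  have hdf : ∀ d, ContDiffOn ℝ ∞ (pd d f) U := contDiffOn_pd hg.isOpen hf
  have hAs : ∀ c, ContDiffOn ℝ ∞ (A c) U := hg.smooth_raise hdf
  have h1 : ∀ a b, covD1 g (fun b q => ∑ c, T b c q * A c q) a b p
      = ∑ c, covD g T a b c p * A c p
        + ∑ m, T b m p * ∑ d, (g p)⁻¹ m d * hess g f a d p := by
    intro a b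
    have e1 : pd a (fun q => ∑ c, T b c q * A c q) p
        = ∑ c, (pd a (T b c) p * A c p + T b c p * pd a (A c) p) := by
      rw [pd_sum _ fun c _ => (differentiableAt_of_smooth hg.isOpen (hT b c) hp).fun_mul
        (differentiableAt_of_smooth hg.isOpen (hAs c) hp)]
      exact Finset.sum_congr rfl fun c _ => pd_mul (differentiableAt_of_smooth hg.isOpen (hT b c) hp)
        (differentiableAt_of_smooth hg.isOpen (hAs c) hp) a
    have e2 : ∀ c, pd a (A c) p = ∑ d, (g p)⁻¹ c d * hess g f a d p
        - ∑ m, christoffel g c m a p * A m p := fun c => hg.pd_raise hp hdf c a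
    have e3 : ∑ c, (∑ e, christoffel g e a c p * T b e p) * A c p
        = ∑ c, T b c p * ∑ m, christoffel g c m a p * A m p := by
      simp only [Finset.sum_mul, Finset.mul_sum]
      rw [Finset.sum_comm]
      refine Finset.sum_congr rfl fun c _ => Finset.sum_congr rfl fun m _ => ?_
      rw [hg.christoffel_symm hp c a m]; ring
    have e4 : ∑ c, (∑ e, christoffel g e a b p * T e c p) * A c p
        = ∑ m, christoffel g m a b p * ∑ c, T m c p * A c p := by
      simp only [Finset.sum_mul, Finset.mul_sum]
      rw [Finset.sum_comm]
      exact Finset.sum_congr rfl fun c _ => Finset.sum_congr rfl fun m _ => by ring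
    rw [covD1, e1]
    simp only [e2, covD, mul_sub, sub_mul, add_mul, Finset.sum_add_distrib, Finset.sum_sub_distrib,
      e3, e4]
    ring
  simp only [h1, mul_add, Finset.sum_add_distrib]
  congr 1
  · simp only [Finset.sum_mul, Finset.mul_sum]
    rw [sum_rotate]
    exact Finset.sum_congr rfl fun c _ => Finset.sum_congr rfl fun a _ =>
      Finset.sum_congr rfl fun b _ => by ring
  · refine Finset.sum_congr rfl fun a _ => ?_
    simp only [Finset.sum_mul, Finset.mul_sum]
    rw [sum_rotate]
    refine Finset.sum_congr rfl fun d _ => Finset.sum_congr rfl fun b _ =>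
      Finset.sum_congr rfl fun m _ => ?_
    rw [hg.inv_symm_apply hp m d]; ring

/-- The contracted Bianchi identity `∇^b R_{be} = ½ ∂_e R`. -/
theorem contracted_bianchi (hp : p ∈ U) (e : Fin 4) :
    ∑ a, ∑ b, (g p)⁻¹ a b * covD g (ricci g) a b e p = (1 / 2) * pd e (scalarCurv g) p := by
  -- The entries of `curv g c d * g⁻¹` are `R^{ab}_{cd}`. Raising the second index makes the metric
  -- antisymmetry an ordinary matrix antisymmetry.
  have hM : ∀ c d, SmoothMatrix U (fun q => curv g c d q * (g q)⁻¹) :=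
    fun c d => (hg.smooth_curv c d).mul hg.smooth_inv
  have hMd := fun c d a b => (hM c d).differentiableAt hg.isOpen hp a b
  have hN : ∀ (q : Pt), q ∈ U → ∀ a e, ∑ c, (curv g c e q * (g q)⁻¹) c a
      = raise g (fun b => ricci g b e) a q := by
    intro q hq a e
    simp only [raise, ricci, Matrix.mul_apply, curv, Matrix.of_apply, Finset.mul_sum]
    rw [Finset.sum_comm]
    refine Finset.sum_congr rfl fun b _ => Finset.sum_congr rfl fun c _ => ?_
    rw [hg.inv_symm_apply hq, mul_comm]
  have hR : ∀ q ∈ U, scalarCurv g q = ∑ c, ∑ d, (curv g c d q * (g q)⁻¹) c d := by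
    intro q hq
    rw [Finset.sum_comm]
    simp only [hN q hq, raise, scalarCurv]
    rw [Finset.sum_comm]
    exact Finset.sum_congr rfl fun a _ => Finset.sum_congr rfl fun b _ => by
      rw [hg.inv_symm_apply hq]
  have anti : ∀ q ∈ U, ∀ c d a b,
      (curv g c d q * (g q)⁻¹) a b = - (curv g c d q * (g q)⁻¹) b a := by
    intro q hq c d a b
    have h := congrArg (fun X => (g q)⁻¹ * X * (g q)⁻¹) (hg.curv_antisymm hq c d)
    simp only [Matrix.mul_add, Matrix.add_mul, Matrix.mul_zero, Matrix.zero_mul] at h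
    rw [Matrix.mul_assoc, Matrix.mul_assoc, hg.mul_inv hq, Matrix.mul_one, ← Matrix.mul_assoc,
      hg.inv_mul hq, Matrix.one_mul] at h
    have h2 : (g q)⁻¹ * (curv g c d q).transpose = (curv g c d q * (g q)⁻¹).transpose := by
      rw [Matrix.transpose_mul, hg.inv_transpose hq]
    rw [h2] at h
    have := congrFun (congrFun h b) a
    simp only [Matrix.add_apply, Matrix.transpose_apply, Matrix.zero_apply] at this
    linarith
  have swap : ∀ q c d a b, (curv g c d q * (g q)⁻¹) a b = - (curv g d c q * (g q)⁻¹) a b := by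
    intro q c d a b
    rw [curv_swap, Matrix.neg_mul, Matrix.neg_apply]
  have key := contracted_bianchi_algebra (fun a b c => christoffel g a b c p)
    (fun c d a b => (curv g c d p * (g p)⁻¹) a b)
    (fun e c d a b => pdM e (fun q => curv g c d q * (g q)⁻¹) p a b)
    (fun a b c => hg.christoffel_symm hp a b c)
    (fun c d a b => swap p c d a b) (fun c d a b => anti p hp c d a b)
    (fun e c d a b => by
      simp only [pdM, Matrix.of_apply]
      rw [← pd_neg]; exact pd_congr hg.isOpen (fun q _ => swap q c d a b) hp e)
    (fun e c d a b => by
      simp only [pdM, Matrix.of_apply]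
      rw [← pd_neg]; exact pd_congr hg.isOpen (fun q hq => anti q hq c d a b) hp e)
    (fun e c d a b => ((pdM e (curv g c d) p + conn g e p * curv g c d p
      - curv g c d p * conn g e p) * (g p)⁻¹) a b)
    (fun e c d a b => by
      -- The derivative of `g⁻¹` contributes exactly the connection term for the second upper index.
      have : (pdM e (curv g c d) p + conn g e p * curv g c d p - curv g c d p * conn g e p) * (g p)⁻¹
          = pdM e (fun q => curv g c d q * (g q)⁻¹) p + conn g e p * (curv g c d p * (g p)⁻¹)
            + (curv g c d p * (g p)⁻¹) * (conn g e p).transpose := by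
        rw [pdM_mul hg.isOpen (hg.smooth_curv c d) hg.smooth_inv hp, hg.pdM_inv hp]
        noncomm_ring
      rw [this, Matrix.add_apply, Matrix.add_apply, Matrix.mul_apply (M := conn g e p),
        Matrix.mul_apply (N := (conn g e p).transpose)]
      rfl)
    (fun e c d a b => by
      rw [← Matrix.add_apply, ← Matrix.add_apply, ← Matrix.add_mul, ← Matrix.add_mul,
        hg.bianchi hp, Matrix.zero_mul, Matrix.zero_apply]) e
  have hdR : pd e (scalarCurv g) p
      = ∑ c, ∑ d, pdM e (fun q => curv g c d q * (g q)⁻¹) p c d := by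
    rw [pd_congr hg.isOpen hR hp, pd_sum _ fun c _ => DifferentiableAt.fun_sum fun d _ => hMd c d c d]
    exact Finset.sum_congr rfl fun c _ => pd_sum _ (fun d _ => hMd c d c d) e
  rw [hdR, ← key]
  refine Finset.sum_congr rfl fun a _ => ?_
  have hric : ∀ b, ContDiffOn ℝ ∞ (ricci g b e) U := fun b => hg.smooth_ricci b e
  have h1 : ∑ c, pdM a (fun q => curv g c e q * (g q)⁻¹) p c a
      = pd a (raise g (fun b => ricci g b e) a) p := by
    rw [← pd_congr hg.isOpen (fun q hq => hN q hq a e) hp, pd_sum _ fun c _ => hMd c e c a]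
    rfl
  simp only [h1, hN p hp, hg.pd_raise hp hric, covD, covD1, Finset.sum_add_distrib, mul_sub,
    mul_add, Finset.sum_sub_distrib]
  have h2 : ∑ b, (g p)⁻¹ a b * ∑ m, christoffel g m a e p * ricci g b m p
      = ∑ m, christoffel g m a e p * raise g (fun b => ricci g b m) a p := by
    simp only [raise, Finset.mul_sum]
    rw [Finset.sum_comm]
    exact Finset.sum_congr rfl fun b _ => Finset.sum_congr rfl fun m _ => by ring
  rw [h2]
  ring

end IsMetricOn
end Coord

/-! ### Trace of the field equations -/

namespace Coord

variable {U : Set Pt} {p : Pt} {g : Pt → Matrix (Fin 4) (Fin 4) ℝ}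

/-- The square norm `R^{ab} R_{ab}`. -/
noncomputable def ricciSq (g : Pt → Matrix (Fin 4) (Fin 4) ℝ) (p : Pt) : ℝ :=
  ∑ a, ∑ b, ricciUp g a b p * ricci g a b p

namespace IsMetricOn

variable (hg : IsMetricOn g U)
include hg

theorem trace_metric (hp : p ∈ U) : ∑ a, ∑ b, (g p)⁻¹ a b * g p a b = 4 := by
  have h : ∀ a, ∑ b, (g p)⁻¹ a b * g p a b = 1 := by
    intro a
    have := congrFun (congrFun (hg.inv_mul hp) a) a
    rw [Matrix.mul_apply, Matrix.one_apply_eq] at this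
    rw [← this]
    exact Finset.sum_congr rfl fun b _ => by rw [hg.symm_apply hp a b]
  simp [h]

theorem trace_einstein (hp : p ∈ U) :
    ∑ a, ∑ b, (g p)⁻¹ a b * einstein g a b p = - scalarCurv g p := by
  have h : ∀ a b, (g p)⁻¹ a b * einstein g a b p = (g p)⁻¹ a b * ricci g a b p
      - (1 / 2) * scalarCurv g p * ((g p)⁻¹ a b * g p a b) := fun a b => by
    rw [einstein]; ring
  simp only [h, Finset.sum_sub_distrib, ← Finset.mul_sum, hg.trace_metric hp]
  rw [scalarCurv]; ring

theorem trace_riemannLow (hp : p ∈ U) (c d : Fin 4) :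
    ∑ a, ∑ b, (g p)⁻¹ a b * riemannLow g a c b d p = ricci g c d p := by
  rw [Finset.sum_comm, ricci]
  refine Finset.sum_congr rfl fun b _ => ?_
  have h : ∀ e, ∑ a, (g p)⁻¹ a b * g p a e = (1 : Matrix (Fin 4) (Fin 4) ℝ) b e := by
    intro e
    rw [← hg.inv_mul hp, Matrix.mul_apply]
    exact Finset.sum_congr rfl fun a _ => by rw [hg.inv_symm_apply hp]
  have h2 : ∑ a, (g p)⁻¹ a b * riemannLow g a c b d p
      = ∑ e, (∑ a, (g p)⁻¹ a b * g p a e) * riemann g e c b d p := by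
    simp only [riemannLow, Finset.mul_sum, Finset.sum_mul]
    rw [Finset.sum_comm]
    exact Finset.sum_congr rfl fun _ _ => Finset.sum_congr rfl fun _ _ => by ring
  simp [h2, h, Matrix.one_apply]

/-- The trace of the tensor `H_{ab}` of fourth-order gravity. -/
theorem trace_fourthOrderH (hp : p ∈ U) (α β γ κ hbar : ℝ) :
    ∑ a, ∑ b, (g p)⁻¹ a b * fourthOrderH α β γ κ hbar g a b p
      = (2 * α - 6 * β) * boxScalar g (scalarCurv g) p
        + γ / (hbar * κ ^ 2) * scalarCurv g p := by
  have h1 : ∑ a, ∑ b, (g p)⁻¹ a b * ∑ c, ∑ d, ricciUp g c d p * riemannLow g a c b d p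
      = ricciSq g p := by
    simp only [Finset.mul_sum, ricciSq, ← hg.trace_riemannLow hp]
    rw [sum_rotate]
    refine Finset.sum_congr rfl fun c _ => ?_
    rw [sum_rotate]
    exact Finset.sum_congr rfl fun d _ => Finset.sum_congr rfl fun _ _ =>
      Finset.sum_congr rfl fun _ _ => by ring
  have h2 := hg.trace_boxTensor hp hg.smooth_ricci
  have h3 : ∑ a, ∑ b, (g p)⁻¹ a b * ricci g a b p = scalarCurv g p := rfl
  have h4 : ∑ a, ∑ b, (g p)⁻¹ a b * hess g (scalarCurv g) a b p
      = boxScalar g (scalarCurv g) p := rfl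
  have h : ∀ a b, (g p)⁻¹ a b * fourthOrderH α β γ κ hbar g a b p
      = - (α - 2 * β) * ((g p)⁻¹ a b * hess g (scalarCurv g) a b p)
        + α * ((g p)⁻¹ a b * boxTensor g (ricci g) a b p)
        + ((1 / 2) * (α - 4 * β) * boxScalar g (scalarCurv g) p
            - (1 / 2) * (α * ricciSq g p - β * scalarCurv g p ^ 2)) * ((g p)⁻¹ a b * g p a b)
        + 2 * α * ((g p)⁻¹ a b * ∑ c, ∑ d, ricciUp g c d p * riemannLow g a c b d p)
        - 2 * β * scalarCurv g p * ((g p)⁻¹ a b * ricci g a b p)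
        - γ / (hbar * κ ^ 2) * ((g p)⁻¹ a b * einstein g a b p) := fun a b => by
    rw [fourthOrderH, ricciSq]; ring
  simp only [h, Finset.sum_sub_distrib, Finset.sum_add_distrib, ← Finset.mul_sum,
    hg.trace_metric hp, h1, h2, h3, h4, hg.trace_einstein hp]
  rw [show (fun q => ∑ a, ∑ b, (g q)⁻¹ a b * ricci g a b q) = scalarCurv g from rfl]
  ring

/-- The quadratic Lagrangians are scale invariant in four dimensions, so their curvature-squared
terms are traceless and only `□R` survives in the trace. Its coefficient is `2 (α - 3β)`. -/
theorem boxScalar_scalarCurv_eq_zero (hp : p ∈ U) {α β γ κ hbar : ℝ} (hαβ : α ≠ 3 * β)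
    (hH : ∀ a b, fourthOrderH α β γ κ hbar g a b p = - (γ / (hbar * κ ^ 2)) * einstein g a b p) :
    boxScalar g (scalarCurv g) p = 0 := by
  have h := hg.trace_fourthOrderH hp α β γ κ hbar
  have h2 : ∑ a, ∑ b, (g p)⁻¹ a b * fourthOrderH α β γ κ hbar g a b p
      = - (γ / (hbar * κ ^ 2)) * ∑ a, ∑ b, (g p)⁻¹ a b * einstein g a b p := by
    simp only [hH, Finset.mul_sum]
    exact Finset.sum_congr rfl fun _ _ => Finset.sum_congr rfl fun _ _ => by ring
  rw [h2, hg.trace_einstein hp] at h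
  have h3 : (2 * α - 6 * β) * boxScalar g (scalarCurv g) p = 0 := by linarith
  refine (mul_eq_zero.mp h3).resolve_left fun h0 => hαβ (by linarith)

/-- For harmonic `f` this exhibits `2 |∇f|²` as the divergence of the gradient of `f²`, the signed
divergence used to show that the scalar curvature is constant. -/
theorem boxScalar_sq (hp : p ∈ U) {f : Pt → ℝ} (hf : ContDiffOn ℝ ∞ f U) :
    boxScalar g (fun q => f q * f q) p = 2 * f p * boxScalar g f p
      + 2 * ∑ a, ∑ b, (g p)⁻¹ a b * (pd a f p * pd b f p) := by
  have hd := fun q (hq : q ∈ U) => differentiableAt_of_smooth hg.isOpen hf hq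
  have h1 : ∀ q ∈ U, ∀ b, pd b (fun q => f q * f q) q = 2 * (f q * pd b f q) := by
    intro q hq b
    rw [pd_mul (hd q hq) (hd q hq)]; ring
  have h2 : ∀ a b, hess g (fun q => f q * f q) a b p
      = 2 * f p * hess g f a b p + 2 * (pd a f p * pd b f p) := by
    intro a b
    have hdb := differentiableAt_of_smooth hg.isOpen (contDiffOn_pd hg.isOpen hf b) hp
    have e1 : ∑ c, christoffel g c a b p * (2 * (f p * pd c f p))
        = 2 * f p * ∑ c, christoffel g c a b p * pd c f p := by
      rw [Finset.mul_sum]; exact Finset.sum_congr rfl fun _ _ => by ring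
    have e2 : pd a (fun q => 2 * (f q * pd b f q)) p
        = 2 * (pd a f p * pd b f p + f p * pd a (pd b f) p) := by
      rw [pd_mul (differentiableAt_const _) ((hd p hp).fun_mul hdb), pd_const,
        pd_mul (hd p hp) hdb]
      ring
    simp only [hess, h1 p hp]
    rw [pd_congr hg.isOpen (fun q hq => h1 q hq b) hp, e1, e2]
    ring
  simp only [boxScalar, h2, mul_add, Finset.sum_add_distrib]
  congr 1 <;> simp only [Finset.mul_sum] <;>
    exact Finset.sum_congr rfl fun _ _ => Finset.sum_congr rfl fun _ _ => by ring

end IsMetricOn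

/-! ### Static metrics -/

/-- `f` does not depend on the time coordinate. -/
def TimeIndep (f : Pt → ℝ) : Prop := ∀ (s : ℝ) (p : Pt), f (p + s • Pi.single 0 1) = f p

theorem TimeIndep.pd {f : Pt → ℝ} (hf : TimeIndep f) (a : Fin 4) : TimeIndep (pd a f) := by
  intro s p
  have h := fderiv_comp_add_right (𝕜 := ℝ) (f := f) (x := p) (s • Pi.single (0 : Fin 4) (1 : ℝ))
  rw [show (fun x => f (x + s • Pi.single (0 : Fin 4) (1 : ℝ))) = f from funext (hf s)] at h
  rw [Coord.pd, Coord.pd, ← h]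

/-- No smoothness is needed: at a point of non-differentiability `fderiv` has the default value
zero. -/
theorem TimeIndep.pd_zero {f : Pt → ℝ} (hf : TimeIndep f) (p : Pt) : Coord.pd 0 f p = 0 := by
  by_cases h : DifferentiableAt ℝ f p
  · have h1 : lineDeriv ℝ f p (Pi.single 0 1) = 0 := by
      simp [lineDeriv, hf _ p]
    rw [Coord.pd, ← h.lineDeriv_eq_fderiv, h1]
  · simp [Coord.pd, fderiv_zero_of_not_differentiableAt h]

theorem TimeIndep.mul {f₁ f₂ : Pt → ℝ} (h₁ : TimeIndep f₁) (h₂ : TimeIndep f₂) :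
    TimeIndep (fun p => f₁ p * f₂ p) := fun s p => by simp only [h₁ s p, h₂ s p]

/-- `g = - e^{2L} dt² + h` on `U`, with everything independent of the time. -/
structure IsStaticOn (g : Pt → Matrix (Fin 4) (Fin 4) ℝ) (L : Pt → ℝ) (U : Set Pt) : Prop
    extends IsMetricOn g U where
  timeIndep : ∀ a b, TimeIndep (fun p => g p a b)
  smooth_log : ContDiffOn ℝ ∞ L U
  timeIndep_log : TimeIndep L
  time_time : ∀ p ∈ U, g p 0 0 = - Real.exp (2 * L p)
  time_space : ∀ p ∈ U, ∀ i : Fin 3, g p 0 i.succ = 0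

namespace IsStaticOn

variable {L : Pt → ℝ} (hg : IsStaticOn g L U)
include hg

theorem timeIndep_inv (a b : Fin 4) : TimeIndep (fun p => (g p)⁻¹ a b) := by
  intro s p
  have : g (p + s • Pi.single 0 1) = g p := by ext i j; exact hg.timeIndep i j s p
  simp only [this]

theorem timeIndep_christoffel (a b c : Fin 4) : TimeIndep (christoffel g a b c) := by
  intro s p
  have h1 := fun a b c => (hg.timeIndep a b).pd c s p
  simp only [christoffel, h1, fun a b => hg.timeIndep_inv a b s p]

theorem timeIndep_riemann (a b c d : Fin 4) : TimeIndep (riemann g a b c d) := by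
  intro s p
  have h1 := fun a b c d => (hg.timeIndep_christoffel a b c).pd d s p
  simp only [riemann, h1, fun a b c => hg.timeIndep_christoffel a b c s p]

theorem timeIndep_ricci (a b : Fin 4) : TimeIndep (ricci g a b) := by
  intro s p
  simp only [ricci, fun a b c d => hg.timeIndep_riemann a b c d s p]

theorem timeIndep_scalarCurv : TimeIndep (scalarCurv g) := by
  intro s p
  simp only [scalarCurv, fun a b => hg.timeIndep_ricci a b s p, fun a b => hg.timeIndep_inv a b s p]

theorem inv_time (hp : p ∈ U) (b : Fin 4) :
    (g p)⁻¹ 0 b = - Real.exp (-(2 * L p)) * (1 : Matrix (Fin 4) (Fin 4) ℝ) 0 b := by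
  have h := congrFun (congrFun (hg.mul_inv hp) 0) b
  rw [Matrix.mul_apply, Fin.sum_univ_succ, hg.time_time p hp] at h
  simp only [hg.time_space p hp, zero_mul, Finset.sum_const_zero, add_zero] at h
  rw [← h, Real.exp_neg]
  field_simp

theorem inv_time_time (hp : p ∈ U) : (g p)⁻¹ 0 0 = - Real.exp (-(2 * L p)) := by
  simp [hg.inv_time hp]

theorem inv_time_space (hp : p ∈ U) (i : Fin 3) : (g p)⁻¹ 0 i.succ = 0 := by
  rw [hg.inv_time hp, Matrix.one_apply_ne (Fin.succ_ne_zero i).symm, mul_zero]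

theorem inv_space_time (hp : p ∈ U) (i : Fin 3) : (g p)⁻¹ i.succ 0 = 0 := by
  rw [hg.inv_symm_apply hp, hg.inv_time_space hp]

theorem pd_time_time (hp : p ∈ U) (c : Fin 4) :
    pd c (fun q => g q 0 0) p = - (2 * Real.exp (2 * L p) * pd c L p) := by
  have hd := differentiableAt_of_smooth hg.isOpen hg.smooth_log hp
  rw [pd_congr hg.isOpen hg.time_time hp, pd_neg]
  simp only [pd]
  rw [fderiv_exp (hd.const_mul 2), fderiv_const_mul hd]
  simp; ring

theorem pd_time_space (hp : p ∈ U) (i : Fin 3) (c : Fin 4) :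
    pd c (fun q => g q 0 i.succ) p = 0 := by
  rw [pd_congr hg.isOpen (fun q hq => hg.time_space q hq i) hp, pd_const]

theorem pd_space_time (hp : p ∈ U) (i : Fin 3) (c : Fin 4) :
    pd c (fun q => g q i.succ 0) p = 0 := by
  rw [hg.pd_symm hp, hg.pd_time_space hp]

theorem christoffel_time (hp : p ∈ U) (b c : Fin 4) : christoffel g 0 b c p
    = - (1 / 2) * Real.exp (-(2 * L p)) * (pd b (fun q => g q 0 c) p + pd c (fun q => g q 0 b) p) := by
  rw [christoffel, Fin.sum_univ_succ, hg.inv_time_time hp]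
  simp only [hg.inv_time_space hp, (hg.timeIndep _ _).pd_zero, zero_mul, Finset.sum_const_zero]
  ring

theorem christoffel_time_time_time (hp : p ∈ U) : christoffel g 0 0 0 p = 0 := by
  simp [hg.christoffel_time hp, (hg.timeIndep _ _).pd_zero]

/-- The gradient of `L` is the acceleration of the static observers. This identity also transfers
the decay of the connection to `L`. -/
theorem christoffel_time_time (hp : p ∈ U) (c : Fin 4) : christoffel g 0 0 c p = pd c L p := by
  refine Fin.cases ?_ (fun k => ?_) c
  · rw [hg.christoffel_time_time_time hp, hg.timeIndep_log.pd_zero]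
  · rw [hg.christoffel_time hp, hg.pd_time_space hp, hg.pd_time_time hp, Real.exp_neg]
    field_simp
    ring

theorem christoffel_time_time' (hp : p ∈ U) (c : Fin 4) : christoffel g 0 c 0 p = pd c L p := by
  rw [hg.christoffel_symm hp, hg.christoffel_time_time hp]

theorem christoffel_time_space_space (hp : p ∈ U) (k l : Fin 3) :
    christoffel g 0 k.succ l.succ p = 0 := by
  simp [hg.christoffel_time hp, hg.pd_time_space hp]

theorem raise_time (hp : p ∈ U) {f : Pt → ℝ} (hf : TimeIndep f) :
    raise g (fun d => pd d f) 0 p = 0 := by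
  rw [raise, Fin.sum_univ_succ, hf.pd_zero]
  simp [hg.inv_time_space hp]

theorem christoffel_time_lower (hp : p ∈ U) (a : Fin 4) :
    christoffel g a 0 0 p = Real.exp (2 * L p) * raise g (fun d => pd d L) a p := by
  refine Fin.cases ?_ (fun k => ?_) a
  · rw [hg.christoffel_time_time_time hp, hg.raise_time hp hg.timeIndep_log, mul_zero]
  · rw [christoffel, raise, Finset.mul_sum, Finset.mul_sum]
    refine Finset.sum_congr rfl fun d _ => ?_
    rw [(hg.timeIndep _ _).pd_zero, hg.pd_time_time hp]
    ring

theorem christoffel_space_time_space (hp : p ∈ U) (k l : Fin 3) :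
    christoffel g k.succ 0 l.succ p = 0 := by
  rw [christoffel, Fin.sum_univ_succ, hg.inv_space_time hp]
  simp [(hg.timeIndep _ _).pd_zero, hg.pd_space_time hp, hg.pd_time_space hp]

theorem christoffel_space_space_time (hp : p ∈ U) (k l : Fin 3) :
    christoffel g k.succ l.succ 0 p = 0 := by
  rw [hg.christoffel_symm hp, hg.christoffel_space_time_space hp]

/-- The tidal tensor of a static metric: `∇∇L + dL ⊗ dL` is `N⁻¹` times the spatial Hessian of the
lapse. It follows from `Γ^0_{0c} = ∂_c L` and the vanishing of `Γ^0_{ij}` and `Γ^k_{0l}`. -/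
theorem riemann_time_space_space (hp : p ∈ U) (c d : Fin 3) :
    riemann g 0 c.succ 0 d.succ p = - (hess g L c.succ d.succ p + pd c.succ L p * pd d.succ L p) := by
  rw [riemann, (hg.timeIndep_christoffel _ _ _).pd_zero,
    pd_congr hg.isOpen (fun q hq => hg.christoffel_time_time' hq c.succ) hp,
    pd_comm hg.isOpen hg.smooth_log hp, hess, Fin.sum_univ_succ (n := 3),
    Fin.sum_univ_succ (n := 3)]
  simp only [hg.christoffel_time_time hp, hg.christoffel_time_time' hp,
    hg.christoffel_time_space_space hp, hg.christoffel_space_space_time hp,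
    hg.timeIndep_log.pd_zero, mul_zero, sub_zero]
  rw [Finset.sum_congr rfl fun (i : Fin 3) _ => mul_comm (pd i.succ L p) _]
  ring

theorem riemannLow_time_space (hp : p ∈ U) (c d : Fin 3) :
    riemannLow g 0 c.succ 0 d.succ p
      = Real.exp (2 * L p) * (hess g L c.succ d.succ p + pd c.succ L p * pd d.succ L p) := by
  rw [riemannLow, Fin.sum_univ_succ, hg.time_time p hp, hg.riemann_time_space_space hp]
  simp only [hg.time_space p hp, zero_mul, Finset.sum_const_zero]
  ring

omit hg in
theorem riemannLow_time_time : riemannLow g 0 0 0 0 p = 0 := by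
  simp [riemannLow, riemann]

/-- Time reversal symmetry: Christoffel symbols with an odd number of time indices vanish, and each
term of this component contains one of them or a time derivative. -/
theorem ricci_time_space (hp : p ∈ U) (i : Fin 3) : ricci g 0 i.succ p = 0 := by
  rw [ricci, Fin.sum_univ_succ]
  have h0 : riemann g 0 0 0 i.succ p = 0 := by
    rw [riemann, (hg.timeIndep_christoffel _ _ _).pd_zero,
      pd_congr hg.isOpen (fun q hq => hg.christoffel_time_time_time hq) hp, pd_const,
      Fin.sum_univ_succ]
    simp only [hg.christoffel_time_time_time hp, hg.christoffel_time_space_space hp,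
      hg.christoffel_space_time_space hp]
    simp
  have h1 : ∀ k : Fin 3, riemann g k.succ 0 k.succ i.succ p = 0 := by
    intro k
    rw [riemann, pd_congr hg.isOpen (fun q hq => hg.christoffel_space_time_space hq k i) hp, pd_const,
      pd_congr hg.isOpen (fun q hq => hg.christoffel_space_time_space hq k k) hp, pd_const,
      Fin.sum_univ_succ]
    simp only [hg.christoffel_space_space_time hp, hg.christoffel_space_time_space hp]
    simp
  simp [h0, h1]

theorem ricci_space_time (hp : p ∈ U) (i : Fin 3) : ricci g i.succ 0 p = 0 := by
  rw [ricci, Fin.sum_univ_succ]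
  have h0 : riemann g 0 i.succ 0 0 p = 0 := by simp [riemann]
  have h1 : ∀ k : Fin 3, riemann g k.succ i.succ k.succ 0 p = 0 := by
    intro k
    rw [riemann, (hg.timeIndep_christoffel _ _ _).pd_zero,
      pd_congr hg.isOpen (fun q hq => hg.christoffel_space_space_time hq k i) hp, pd_const,
      Fin.sum_univ_succ]
    simp only [hg.christoffel_space_space_time hp, hg.christoffel_space_time_space hp,
      hg.christoffel_time_space_space hp]
    simp
  simp [h0, h1]

theorem ricciUp_time (hp : p ∈ U) (d : Fin 4) : ricciUp g 0 d p
    = - Real.exp (-(2 * L p)) * ∑ e, (g p)⁻¹ d e * ricci g 0 e p := by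
  rw [ricciUp, Fin.sum_univ_succ]
  simp only [hg.inv_time_time hp, hg.inv_time_space hp, zero_mul, Finset.sum_const_zero, add_zero,
    Finset.mul_sum]
  exact Finset.sum_congr rfl fun _ _ => by ring

theorem ricciUp_time_time (hp : p ∈ U) :
    ricciUp g 0 0 p = Real.exp (-(2 * L p)) * (Real.exp (-(2 * L p)) * ricci g 0 0 p) := by
  rw [hg.ricciUp_time hp, Fin.sum_univ_succ]
  simp only [hg.inv_time_time hp, hg.ricci_time_space hp, mul_zero, Finset.sum_const_zero]
  ring

theorem ricciUp_time_space (hp : p ∈ U) (i : Fin 3) : ricciUp g 0 i.succ p = 0 := by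
  rw [hg.ricciUp_time hp, Fin.sum_univ_succ]
  simp [hg.inv_space_time hp, hg.ricci_time_space hp]

theorem ricciUp_space_time (hp : p ∈ U) (i : Fin 3) : ricciUp g i.succ 0 p = 0 := by
  rw [ricciUp, Fin.sum_univ_succ, hg.inv_space_time hp]
  simp only [zero_mul, Finset.sum_const_zero, zero_add]
  refine Finset.sum_eq_zero fun c _ => ?_
  rw [Fin.sum_univ_succ]
  simp [hg.inv_time_space hp, hg.ricci_space_time hp]

end IsStaticOn

/-- The scalar `R_{ab} u^a u^b` for the static observers `u`. -/
noncomputable def ricciEnergy (g : Pt → Matrix (Fin 4) (Fin 4) ℝ) (L : Pt → ℝ) (p : Pt) : ℝ :=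
  Real.exp (-(2 * L p)) * ricci g 0 0 p

/-! ### The time-time component of the field equations -/

namespace IsStaticOn

variable {L : Pt → ℝ} (hg : IsStaticOn g L U)
include hg

theorem smooth_ricciEnergy : ContDiffOn ℝ ∞ (ricciEnergy g L) U :=
  ((contDiffOn_const.mul hg.smooth_log).neg.exp).mul (hg.smooth_ricci 0 0)

theorem timeIndep_ricciEnergy : TimeIndep (ricciEnergy g L) := by
  intro s p
  simp only [ricciEnergy, hg.timeIndep_ricci 0 0 s p, hg.timeIndep_log s p]

omit hg in
theorem ricci_time_time (p : Pt) : ricci g 0 0 p = Real.exp (2 * L p) * ricciEnergy g L p := by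
  rw [ricciEnergy, ← mul_assoc, ← Real.exp_add, add_neg_cancel, Real.exp_zero, one_mul]

theorem pd_exp_mul (hp : p ∈ U) {f : Pt → ℝ} (hf : DifferentiableAt ℝ f p) (c : Fin 4) :
    pd c (fun q => Real.exp (2 * L q) * f q) p
      = Real.exp (2 * L p) * (pd c f p + 2 * pd c L p * f p) := by
  have hd := differentiableAt_of_smooth hg.isOpen hg.smooth_log hp
  have h1 : pd c (fun q => Real.exp (2 * L q)) p = 2 * Real.exp (2 * L p) * pd c L p := by
    simp only [pd]
    rw [fderiv_exp (hd.const_mul 2), fderiv_const_mul hd]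
    simp; ring
  rw [pd_mul (hd.const_mul 2).exp hf, h1]
  ring

/-- With `R_{00} = e^{2L} σ` and `Γ^0_{c0} = ∂_c L`, the derivative of the factor `e^{2L}` cancels
against the two connection terms; the spatial connection terms meet `R_{i0} = 0`. -/
theorem covD_time_time (hp : p ∈ U) (c : Fin 4) :
    covD g (ricci g) c 0 0 p = Real.exp (2 * L p) * pd c (ricciEnergy g L) p := by
  have hd := differentiableAt_of_smooth hg.isOpen hg.smooth_ricciEnergy hp
  rw [covD, show ricci g 0 0 = fun q => Real.exp (2 * L q) * ricciEnergy g L q from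
    funext ricci_time_time, hg.pd_exp_mul hp hd, Fin.sum_univ_succ]
  simp only [hg.christoffel_time_time' hp, hg.ricci_space_time hp, hg.ricci_time_space hp]
  rw [ricci_time_time (L := L)]
  simp
  ring

theorem covD_time_time_lower (hp : p ∈ U) (j : Fin 4) :
    covD g (ricci g) 0 0 j p = - (Real.exp (2 * L p) *
      (∑ e, raise g (fun d => pd d L) e p * ricci g e j p + pd j L p * ricciEnergy g L p)) := by
  have h : ∑ e, christoffel g e 0 j p * ricci g 0 e p = pd j L p * ricci g 0 0 p := by
    rw [Fin.sum_univ_succ]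
    simp [hg.christoffel_time_time hp, hg.ricci_time_space hp]
  rw [covD, (hg.timeIndep_ricci 0 j).pd_zero, Finset.sum_add_distrib, h,
    ricci_time_time (L := L)]
  simp only [hg.christoffel_time_lower hp, mul_assoc, ← Finset.mul_sum]
  ring

theorem covD_time_lower_time (hp : p ∈ U) (j : Fin 4) :
    covD g (ricci g) 0 j 0 p = - (Real.exp (2 * L p) *
      (∑ e, raise g (fun d => pd d L) e p * ricci g j e p + pd j L p * ricciEnergy g L p)) := by
  have h : ∑ e, christoffel g e 0 j p * ricci g e 0 p = pd j L p * ricci g 0 0 p := by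
    rw [Fin.sum_univ_succ]
    simp [hg.christoffel_time_time hp, hg.ricci_space_time hp]
  rw [covD, (hg.timeIndep_ricci j 0).pd_zero, Finset.sum_add_distrib, h,
    ricci_time_time (L := L)]
  simp only [hg.christoffel_time_lower hp, mul_assoc, ← Finset.mul_sum]
  ring

/-- The cancellation of `covD_time_time` one order higher: the derivative of `e^{2L}` is absorbed by
the two connection terms acting on the time indices. -/
theorem covD2_space_space (hp : p ∈ U) (k l : Fin 3) :
    covD2 g (ricci g) k.succ l.succ 0 0 p
      = Real.exp (2 * L p) * hess g (ricciEnergy g L) k.succ l.succ p := by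
  have hd := differentiableAt_of_smooth hg.isOpen
    (contDiffOn_pd hg.isOpen hg.smooth_ricciEnergy l.succ) hp
  rw [covD2, pd_congr hg.isOpen (fun q hq => hg.covD_time_time hq l.succ) hp,
    hg.pd_exp_mul hp hd, Finset.sum_add_distrib, Finset.sum_add_distrib]
  have h1 : ∑ e, christoffel g e k.succ 0 p * covD g (ricci g) l.succ e 0 p
      = pd k.succ L p * (Real.exp (2 * L p) * pd l.succ (ricciEnergy g L) p) := by
    rw [Fin.sum_univ_succ, hg.covD_time_time hp]
    simp [hg.christoffel_time_time' hp, hg.christoffel_space_space_time hp]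
  have h2 : ∑ e, christoffel g e k.succ 0 p * covD g (ricci g) l.succ 0 e p
      = pd k.succ L p * (Real.exp (2 * L p) * pd l.succ (ricciEnergy g L) p) := by
    rw [Fin.sum_univ_succ, hg.covD_time_time hp]
    simp [hg.christoffel_time_time' hp, hg.christoffel_space_space_time hp]
  rw [h1, h2, hess]
  simp only [hg.covD_time_time hp, mul_left_comm _ (Real.exp (2 * L p)), ← Finset.mul_sum]
  ring

/-- Unlike the spatial case, transport in the time direction tilts the time indices into spatial
ones, since `Γ^a_{00} = e^{2L} ∂^a L`. This produces terms quadratic in the acceleration. -/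
theorem covD2_time_time (hp : p ∈ U) :
    covD2 g (ricci g) 0 0 0 0 p = Real.exp (2 * L p) * (hess g (ricciEnergy g L) 0 0 p
      + 2 * Real.exp (2 * L p) *
        (∑ a, ∑ b, raise g (fun d => pd d L) a p * raise g (fun d => pd d L) b p * ricci g a b p
        + ricciEnergy g L p * ∑ a, raise g (fun d => pd d L) a p * pd a L p)) := by
  set A := fun a => raise g (fun d => pd d L) a p with hA
  have h0 : pd 0 (covD g (ricci g) 0 0 0) p = 0 := by
    rw [pd_congr hg.isOpen (fun q hq => hg.covD_time_time hq 0) hp,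
      hg.pd_exp_mul hp (differentiableAt_of_smooth hg.isOpen
        (contDiffOn_pd hg.isOpen hg.smooth_ricciEnergy 0) hp), hg.timeIndep_log.pd_zero,
      (hg.timeIndep_ricciEnergy.pd 0).pd_zero]
    ring
  have h1 : ∑ e, christoffel g e 0 0 p * covD g (ricci g) 0 e 0 p
      = - (Real.exp (2 * L p) * Real.exp (2 * L p) *
        (∑ a, ∑ b, A a * A b * ricci g a b p + ricciEnergy g L p * ∑ a, A a * pd a L p)) := by
    simp only [hg.covD_time_lower_time hp, hg.christoffel_time_lower hp, mul_add, Finset.mul_sum,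
      ← Finset.sum_add_distrib, ← Finset.sum_neg_distrib]
    refine Finset.sum_congr rfl fun a _ => ?_
    rw [neg_add, mul_add, ← Finset.sum_neg_distrib, Finset.mul_sum, neg_add,
      ← Finset.sum_neg_distrib]
    exact congrArg₂ _ (Finset.sum_congr rfl fun b _ => by ring) (by ring)
  have h2 : ∑ e, christoffel g e 0 0 p * covD g (ricci g) 0 0 e p
      = - (Real.exp (2 * L p) * Real.exp (2 * L p) *
        (∑ a, ∑ b, A a * A b * ricci g a b p + ricciEnergy g L p * ∑ a, A a * pd a L p)) := by
    rw [Finset.sum_comm]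
    simp only [hg.covD_time_time_lower hp, hg.christoffel_time_lower hp, mul_add, Finset.mul_sum,
      ← Finset.sum_add_distrib, ← Finset.sum_neg_distrib]
    refine Finset.sum_congr rfl fun a _ => ?_
    rw [neg_add, mul_add, ← Finset.sum_neg_distrib, Finset.mul_sum, neg_add,
      ← Finset.sum_neg_distrib]
    exact congrArg₂ _ (Finset.sum_congr rfl fun b _ => by ring) (by ring)
  rw [covD2, h0, Finset.sum_add_distrib, Finset.sum_add_distrib, h1, h2, hess,
    (hg.timeIndep_ricciEnergy.pd 0).pd_zero]
  simp only [hg.covD_time_time hp, mul_left_comm _ (Real.exp (2 * L p)), ← Finset.mul_sum]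
  ring

/-- The factor `g^{00} = -e^{-2L}` gives the acceleration terms of `covD2_time_time` their minus
sign; they cancel later against `sum_ricciUp_riemannLow`. -/
theorem boxTensor_time_time (hp : p ∈ U) :
    boxTensor g (ricci g) 0 0 p = Real.exp (2 * L p) * (boxScalar g (ricciEnergy g L) p
      - 2 * (∑ a, ∑ b, raise g (fun d => pd d L) a p * raise g (fun d => pd d L) b p * ricci g a b p
        + ricciEnergy g L p * ∑ a, raise g (fun d => pd d L) a p * pd a L p)) := by
  have split : ∀ F : Fin 4 → Fin 4 → ℝ, ∑ d, ∑ c, (g p)⁻¹ d c * F d c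
      = (g p)⁻¹ 0 0 * F 0 0 + ∑ k : Fin 3, ∑ l : Fin 3, (g p)⁻¹ k.succ l.succ * F k.succ l.succ := by
    intro F
    simp only [Fin.sum_univ_succ (n := 3), hg.inv_time_space hp, hg.inv_space_time hp, zero_mul,
      Finset.sum_const_zero, zero_add, add_zero]
  rw [boxTensor, boxScalar, split, split]
  simp only [hg.covD2_space_space hp, hg.covD2_time_time hp, hg.inv_time_time hp,
    mul_left_comm _ (Real.exp (2 * L p)), ← Finset.mul_sum]
  have he : Real.exp (-(2 * L p)) * Real.exp (2 * L p) = 1 := by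
    rw [← Real.exp_add, neg_add_cancel, Real.exp_zero]
  linear_combination (-2 * Real.exp (2 * L p) *
    (∑ a, ∑ b, raise g (fun d => pd d L) a p * raise g (fun d => pd d L) b p * ricci g a b p
        + ricciEnergy g L p * ∑ a, raise g (fun d => pd d L) a p * pd a L p)) * he

/-- Contraction of the tidal tensor with the Ricci tensor. The form with all four values of `c` and
`d` makes the Hessian term covariant, ready to be written as a divergence. -/
theorem sum_ricciUp_riemannLow (hp : p ∈ U) :
    ∑ c, ∑ d, ricciUp g c d p * riemannLow g 0 c 0 d p
      = Real.exp (2 * L p) * (∑ c, ∑ d, ricciUp g c d p * hess g L c d p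
        + ∑ a, ∑ b, raise g (fun d => pd d L) a p * raise g (fun d => pd d L) b p * ricci g a b p
        + ricciEnergy g L p * ∑ a, raise g (fun d => pd d L) a p * pd a L p) := by
  have split : ∀ F : Fin 4 → Fin 4 → ℝ, ∑ c, ∑ d, ricciUp g c d p * F c d
      = ricciUp g 0 0 p * F 0 0
        + ∑ k : Fin 3, ∑ l : Fin 3, ricciUp g k.succ l.succ p * F k.succ l.succ := by
    intro F
    simp only [Fin.sum_univ_succ (n := 3), hg.ricciUp_time_space hp, hg.ricciUp_space_time hp,
      zero_mul, Finset.sum_const_zero, zero_add, add_zero]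
  have h1 : ∑ a, ∑ b, raise g (fun d => pd d L) a p * raise g (fun d => pd d L) b p * ricci g a b p
      = ∑ c, ∑ d, ricciUp g c d p * (pd c L p * pd d L p) := by
    simp only [raise, ricciUp, Finset.sum_mul, Finset.mul_sum]
    rw [sum_rotate]
    conv_rhs => rw [Finset.sum_comm]
    refine Finset.sum_congr rfl fun c _ => ?_
    rw [sum_rotate]
    refine Finset.sum_congr rfl fun d _ => Finset.sum_congr rfl fun a _ =>
      Finset.sum_congr rfl fun b _ => ?_
    rw [hg.inv_symm_apply hp d a, hg.inv_symm_apply hp c b]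
    ring
  -- Although `L` is static, `∇_0∇_0 L` is nonzero. The term `σ |∇L|²` on the right side compensates
  -- its contribution, since `R_{0000} = 0` contributes nothing on the left.
  have h2 : hess g L 0 0 p
      = - (Real.exp (2 * L p) * ∑ a, raise g (fun d => pd d L) a p * pd a L p) := by
    simp only [hess, (hg.timeIndep_log.pd 0).pd_zero, hg.christoffel_time_lower hp, mul_assoc,
      ← Finset.mul_sum]
    ring
  have he : Real.exp (-(2 * L p)) * Real.exp (2 * L p) = 1 := by
    rw [← Real.exp_add, neg_add_cancel, Real.exp_zero]
  rw [split, h1, split, split]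
  simp only [hg.riemannLow_time_space hp, riemannLow_time_time, hg.timeIndep_log.pd_zero,
    mul_left_comm _ (Real.exp (2 * L p)), ← Finset.mul_sum]
  rw [h2, hg.ricciUp_time_time hp, ← ricciEnergy]
  simp only [mul_add, Finset.sum_add_distrib]
  linear_combination (ricciEnergy g L p * Real.exp (2 * L p) *
    ∑ a, raise g (fun d => pd d L) a p * pd a L p) * he

/-- The time-time component of the equations of fourth-order gravity, for a static solution of
Einstein's equations with vanishing scalar curvature. -/
theorem boxScalar_ricciEnergy (hp : p ∈ U) {α β γ κ hbar : ℝ} (hα : α ≠ 0)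
    (hR : ∀ q ∈ U, scalarCurv g q = 0)
    (hH : fourthOrderH α β γ κ hbar g 0 0 p = - (γ / (hbar * κ ^ 2)) * einstein g 0 0 p) :
    boxScalar g (ricciEnergy g L) p + 2 * ∑ c, ∑ d, ricciUp g c d p * hess g L c d p
      + (1 / 2) * ricciSq g p = 0 := by
  have hpd : ∀ q ∈ U, ∀ c, pd c (scalarCurv g) q = 0 := fun q hq c => by
    rw [pd_congr hg.isOpen hR hq, pd_const]
  have hhess : ∀ a b, hess g (scalarCurv g) a b p = 0 := fun a b => by
    rw [hess, pd_congr hg.isOpen (fun q hq => hpd q hq b) hp, pd_const]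
    simp [hpd p hp]
  have hbox : boxScalar g (scalarCurv g) p = 0 := by simp [boxScalar, hhess]
  rw [fourthOrderH, hhess, hbox, hR p hp, hg.boxTensor_time_time hp,
    hg.sum_ricciUp_riemannLow hp, hg.time_time p hp] at hH
  -- The combination `R_{ab} ∂^a L ∂^b L + σ |∇L|²` enters `α □R_{00}` with the factor `-2α` and `2α
  -- R^{cd} R_{0c0d}` with `+2α`, so it disappears. The sign of `g_{00}` makes the coefficient of
  -- `R^{ab} R_{ab}` positive.
  have h : α * Real.exp (2 * L p) * (boxScalar g (ricciEnergy g L) p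
      + 2 * ∑ c, ∑ d, ricciUp g c d p * hess g L c d p + (1 / 2) * ricciSq g p) = 0 := by
    rw [ricciSq]
    linear_combination hH
  exact (mul_eq_zero.mp h).resolve_left (mul_ne_zero hα (Real.exp_pos _).ne')

/-- The divergence identity behind the theorem: for the covector field
`ξ_b = ∂_b σ + 2 R_{bc} ∂^c L`, with `σ = R_{ab} u^a u^b` and `L` the logarithm of the lapse, the
equations give `∇^b ξ_b = - ½ R^{ab} R_{ab}`. -/
theorem divergence_current (hp : p ∈ U) {α β γ κ hbar : ℝ} (hα : α ≠ 0)
    (hR : ∀ q ∈ U, scalarCurv g q = 0)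
    (hH : fourthOrderH α β γ κ hbar g 0 0 p = - (γ / (hbar * κ ^ 2)) * einstein g 0 0 p)
    {w : Pt → ℝ} (hw : ContDiffOn ℝ ∞ w U)
    (hdw : ∀ c, pd c w p = w p * ∑ a, christoffel g a c a p) :
    ∑ a, pd a (fun q => w q * raise g (fun b => pd b (ricciEnergy g L)) a q) p
      + ∑ a, pd a (fun q => w q * raise g
          (fun b q => 2 * ∑ c, ricci g b c q * raise g (fun d => pd d L) c q) a q) p
      = - (w p * ((1 / 2) * ricciSq g p)) := by
  have hs := hg.smooth_ricciEnergy
  have h1 := hg.divergence_raise hp (fun b => contDiffOn_pd hg.isOpen hs b) hw hdw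
  have hv : ∀ b, ContDiffOn ℝ ∞ (fun q => ∑ c, ricci g b c q * raise g (fun d => pd d L) c q) U :=
    fun b => ContDiffOn.sum fun c _ => (hg.smooth_ricci b c).mul
      (hg.smooth_raise (fun d => contDiffOn_pd hg.isOpen hg.smooth_log d) c)
  have h2 := hg.divergence_raise hp (fun b => contDiffOn_const (c := (2 : ℝ)).mul (hv b)) hw hdw
  have h3 : ∀ a b, covD1 g (fun b q => 2 * ∑ c, ricci g b c q * raise g (fun d => pd d L) c q) a b p
      = 2 * covD1 g (fun b q => ∑ c, ricci g b c q * raise g (fun d => pd d L) c q) a b p := by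
    intro a b
    rw [covD1, covD1, pd_mul (differentiableAt_const _) (differentiableAt_of_smooth hg.isOpen (hv b) hp),
      pd_const]
    simp only [mul_left_comm _ (2 : ℝ), ← Finset.mul_sum]
    ring
  have h4 := hg.divergence_contract hp hg.smooth_ricci hg.smooth_log
  -- The contracted Bianchi identity with `R = 0`: the Ricci tensor is divergence free, so `R^{cd}
  -- ∇_c∇_d L` is the divergence of `R_{bc} ∂^c L`.
  have h5 : ∀ c, ∑ a, ∑ b, (g p)⁻¹ a b * covD g (ricci g) a b c p = 0 := fun c => by
    rw [hg.contracted_bianchi hp, pd_congr hg.isOpen hR hp, pd_const, mul_zero]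
  have h6 := hg.boxScalar_ricciEnergy hp hα hR hH
  simp only [h5, zero_mul, Finset.sum_const_zero, zero_add] at h4
  rw [h1, h2]
  simp only [h3, mul_left_comm _ (2 : ℝ), ← Finset.mul_sum, h4]
  rw [show ∑ a, ∑ b, (g p)⁻¹ a b * covD1 g (fun b => pd b (ricciEnergy g L)) a b p
    = boxScalar g (ricciEnergy g L) p from rfl]
  simp only [ricciUp] at h6
  linear_combination w p * h6

end IsStaticOn
end Coord

/-! ### Smoothness of frames and metric components in charts -/

section Charts

variable {S : Type*} [TopologicalSpace S] [ChartedSpace E3 S] [IsManifold (𝓡 3) ∞ S]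
  {e e' : OpenPartialHomeomorph S E3}

omit [IsManifold (𝓡 3) ∞ S] in
theorem mdifferentiable_of_mem_maximalAtlas (he : e ∈ IsManifold.maximalAtlas (𝓡 3) ∞ S) :
    e.MDifferentiable (𝓡 3) (𝓡 3) :=
  ⟨fun _ hx => ((contMDiffOn_of_mem_maximalAtlas he).mdifferentiableOn (by simp)) _ hx,
    fun _ hx => ((contMDiffOn_symm_of_mem_maximalAtlas he).mdifferentiableOn (by simp)) _ hx⟩

omit [IsManifold (𝓡 3) ∞ S] in
/-- A smooth function on the manifold is smooth in each chart. -/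
theorem contDiffOn_comp_symm (he : e ∈ IsManifold.maximalAtlas (𝓡 3) ∞ S) {f : S → ℝ}
    (hf : ContMDiff (𝓡 3) 𝓘(ℝ, ℝ) ∞ f) : ContDiffOn ℝ ∞ (fun y => f (e.symm y)) e.target := by
  rw [← contMDiffOn_iff_contDiffOn]
  exact hf.comp_contMDiffOn (contMDiffOn_symm_of_mem_maximalAtlas he)

/-- A coordinate field is the tangent map of the inverse chart applied to a constant section of the
tangent bundle of the model space. -/
theorem contMDiffOn_spatialFrame (he : e ∈ IsManifold.maximalAtlas (𝓡 3) ∞ S) (i : Fin 3) :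
    ContMDiffOn (𝓡 3) ((𝓡 3).prod 𝓘(ℝ, E3)) ∞
      (fun y => (Bundle.TotalSpace.mk' E3 (e.symm y) (spatialFrame e y i) : TangentBundle (𝓡 3) S))
      e.target := by
  have h := (contMDiffOn_symm_of_mem_maximalAtlas he).contMDiffOn_tangentMapWithin (m := ∞)
    (by simp) e.open_target.uniqueMDiffOn
  have hs : ContMDiffOn (𝓡 3) ((𝓡 3).prod 𝓘(ℝ, E3)) ∞
      (fun y : E3 => (⟨y, EuclideanSpace.single i (1 : ℝ)⟩ : TangentBundle (𝓡 3) E3)) e.target := by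
    intro y _
    rw [Bundle.contMDiffWithinAt_totalSpace]
    refine ⟨contMDiffWithinAt_id, ?_⟩
    simpa using contMDiffWithinAt_const
  have h2 := h.comp hs (fun y hy => hy)
  refine h2.congr fun y hy => ?_
  simp only [Function.comp, tangentMapWithin, spatialFrame]
  rw [mfderivWithin_of_isOpen e.open_target hy]

end Charts

namespace StaticSpacetime

variable {S : Type*} [TopologicalSpace S] [ChartedSpace E3 S] [IsManifold (𝓡 3) ∞ S]
  {e e' : OpenPartialHomeomorph S E3} (M : StaticSpacetime S)

theorem contDiffOn_hComp (he : e ∈ IsManifold.maximalAtlas (𝓡 3) ∞ S) (i j : Fin 3) :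
    ContDiffOn ℝ ∞ (fun y => M.hComp e y i j) e.target := by
  rw [← contMDiffOn_iff_contDiffOn]
  have h1 := M.h.contMDiff.comp_contMDiffOn (contMDiffOn_symm_of_mem_maximalAtlas he)
  have h := ContMDiffOn.clm_bundle_apply₂ (F₁ := E3) (F₂ := E3) (F₃ := ℝ)
    (E₃ := Bundle.Trivial S ℝ) (b := e.symm)
    (v := fun y => spatialFrame e y i) (w := fun y => spatialFrame e y j) h1
    (contMDiffOn_spatialFrame he i) (contMDiffOn_spatialFrame he j)
  intro y hy
  have h3 := h y hy
  rw [Bundle.contMDiffWithinAt_totalSpace] at h3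
  have h4 := h3.2
  simp at h4
  exact h4

end StaticSpacetime

/-! ### Changes of chart -/

section Transition

variable {S : Type*} [TopologicalSpace S] [ChartedSpace E3 S]
  {e e' : OpenPartialHomeomorph S E3} {x : S}

/-- The derivative of the inverse of a chart, in the model space. -/
noncomputable def symmDeriv (e : OpenPartialHomeomorph S E3) (y : E3) : E3 →L[ℝ] E3 :=
  mfderiv (𝓡 3) (𝓡 3) e.symm y

/-- The derivative of a chart, in the model space. -/
noncomputable def chartDeriv (e : OpenPartialHomeomorph S E3) (x : S) : E3 →L[ℝ] E3 :=
  mfderiv (𝓡 3) (𝓡 3) e x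

/-- The differential of a function, in the model space. -/
noncomputable def diffAt (f : S → ℝ) (x : S) : E3 →L[ℝ] ℝ := mfderiv (𝓡 3) 𝓘(ℝ, ℝ) f x

theorem symmDeriv_comp_chartDeriv (he : e ∈ IsManifold.maximalAtlas (𝓡 3) ∞ S)
    (hx : x ∈ e.source) (v : E3) : symmDeriv e (e x) (chartDeriv e x v) = v :=
  congrArg (fun A : E3 →L[ℝ] E3 => A v)
    ((mdifferentiable_of_mem_maximalAtlas he).symm_comp_deriv hx)

theorem chartDeriv_comp_symmDeriv (he : e ∈ IsManifold.maximalAtlas (𝓡 3) ∞ S)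
    (hx : x ∈ e.source) (v : E3) : chartDeriv e x (symmDeriv e (e x) v) = v := by
  have h : chartDeriv e (e.symm (e x)) (symmDeriv e (e x) v) = v :=
    congrArg (fun A : E3 →L[ℝ] E3 => A v)
      ((mdifferentiable_of_mem_maximalAtlas he).comp_symm_deriv (e.map_source hx))
  rwa [e.left_inv hx] at h

theorem hasFDerivAt_transition (he : e ∈ IsManifold.maximalAtlas (𝓡 3) ∞ S)
    (he' : e' ∈ IsManifold.maximalAtlas (𝓡 3) ∞ S) (hx : x ∈ e.source) (hx' : x ∈ e'.source) :
    HasFDerivAt (fun y => e (e'.symm y)) ((chartDeriv e x).comp (symmDeriv e' (e' x))) (e' x) := by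
  have h1 : HasMFDerivAt (𝓡 3) (𝓡 3) e'.symm (e' x) (symmDeriv e' (e' x)) :=
    ((mdifferentiable_of_mem_maximalAtlas he').mdifferentiableAt_symm
      (e'.map_source hx')).hasMFDerivAt
  have h2 : HasMFDerivAt (𝓡 3) (𝓡 3) e (e'.symm (e' x)) (chartDeriv e x) := by
    rw [e'.left_inv hx']
    exact ((mdifferentiable_of_mem_maximalAtlas he).mdifferentiableAt hx).hasMFDerivAt
  exact (h2.comp (e' x) h1).hasFDerivAt

theorem fderiv_comp_symm (he : e ∈ IsManifold.maximalAtlas (𝓡 3) ∞ S) (hx : x ∈ e.source)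
    {f : S → ℝ} (hf : MDifferentiableAt (𝓡 3) 𝓘(ℝ, ℝ) f x) (v : E3) :
    fderiv ℝ (fun y => f (e.symm y)) (e x) v = diffAt f x (symmDeriv e (e x) v) := by
  have h1 : HasMFDerivAt (𝓡 3) (𝓡 3) e.symm (e x) (symmDeriv e (e x)) :=
    ((mdifferentiable_of_mem_maximalAtlas he).mdifferentiableAt_symm
      (e.map_source hx)).hasMFDerivAt
  have h2 : HasMFDerivAt (𝓡 3) 𝓘(ℝ, ℝ) f (e.symm (e x)) (diffAt f x) := by
    rw [e.left_inv hx]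
    exact hf.hasMFDerivAt
  have h3 : HasFDerivAt (fun y => f (e.symm y)) ((diffAt f x).comp (symmDeriv e (e x))) (e x) :=
    (h2.comp (e x) h1).hasFDerivAt
  rw [h3.fderiv]
  rfl

/-- The frame `∂_t, ∂_1, ∂_2, ∂_3` in the model space. -/
noncomputable def modelFrame (e : OpenPartialHomeomorph S E3) (y : E3) : Fin 4 → ℝ × E3 :=
  Fin.cons (1, 0) (fun i : Fin 3 => (0, symmDeriv e y (EuclideanSpace.single i 1)))

/-- The Jacobian matrix of the change of charts from `e'` to `e` at the point `x`. -/
noncomputable def jacobian (e e' : OpenPartialHomeomorph S E3) (x : S) : Matrix (Fin 3) (Fin 3) ℝ :=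
  Matrix.of fun j i => chartDeriv e x (symmDeriv e' (e' x) (EuclideanSpace.single i 1)) j

/-- The Jacobian matrix of the change of the coordinates `(t, e')` to `(t, e)`. -/
noncomputable def jacobian4 (e e' : OpenPartialHomeomorph S E3) (x : S) :
    Matrix (Fin 4) (Fin 4) ℝ :=
  Matrix.of (Fin.cons (Fin.cons 1 0) fun j => Fin.cons 0 (jacobian e e' x j))

theorem euclidean_eq_sum (v : E3) : v = ∑ j, v j • EuclideanSpace.single j (1 : ℝ) := by
  ext i
  simp [Finset.sum_apply, Pi.single_apply]

theorem symmDeriv_single_eq_sum (he : e ∈ IsManifold.maximalAtlas (𝓡 3) ∞ S)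
    (hx : x ∈ e.source) (i : Fin 3) :
    symmDeriv e' (e' x) (EuclideanSpace.single i 1)
      = ∑ j, jacobian e e' x j i • symmDeriv e (e x) (EuclideanSpace.single j 1) := by
  have h : symmDeriv e' (e' x) (EuclideanSpace.single i 1)
      = symmDeriv e (e x) (chartDeriv e x (symmDeriv e' (e' x) (EuclideanSpace.single i 1))) :=
    (symmDeriv_comp_chartDeriv he hx _).symm
  conv_lhs => rw [h, euclidean_eq_sum (chartDeriv e x _), map_sum]
  simp only [map_smul]
  rfl

theorem jacobian_mul_jacobian (he : e ∈ IsManifold.maximalAtlas (𝓡 3) ∞ S)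
    (he' : e' ∈ IsManifold.maximalAtlas (𝓡 3) ∞ S) (hx : x ∈ e.source) (hx' : x ∈ e'.source) :
    jacobian e e' x * jacobian e' e x = 1 := by
  ext k i
  have h := chartDeriv_comp_symmDeriv he hx (EuclideanSpace.single i 1)
  rw [symmDeriv_single_eq_sum he' hx' (e' := e) i, map_sum] at h
  have h2 := congrArg (fun v : E3 => v k) h
  simp only [map_smul] at h2
  rw [Matrix.mul_apply, Matrix.one_apply]
  simp [Finset.sum_apply] at h2
  rw [← h2]
  exact Finset.sum_congr rfl fun j _ => mul_comm _ _

theorem jacobian4_mul_jacobian4 (he : e ∈ IsManifold.maximalAtlas (𝓡 3) ∞ S)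
    (he' : e' ∈ IsManifold.maximalAtlas (𝓡 3) ∞ S) (hx : x ∈ e.source) (hx' : x ∈ e'.source) :
    jacobian4 e e' x * jacobian4 e' e x = 1 := by
  have h := jacobian_mul_jacobian he he' hx hx'
  ext a b
  rw [Matrix.mul_apply, Fin.sum_univ_succ]
  refine Fin.cases ?_ (fun i => ?_) a <;> refine Fin.cases ?_ (fun j => ?_) b
  · simp [jacobian4]
  · simp [jacobian4, (Fin.succ_ne_zero j).symm]
  · simp [jacobian4]
  · have := congrFun (congrFun h i) j
    rw [Matrix.mul_apply] at this
    simp [jacobian4, this, Matrix.one_apply]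

theorem isUnit_det_jacobian4 (he : e ∈ IsManifold.maximalAtlas (𝓡 3) ∞ S)
    (he' : e' ∈ IsManifold.maximalAtlas (𝓡 3) ∞ S) (hx : x ∈ e.source) (hx' : x ∈ e'.source) :
    IsUnit (jacobian4 e e' x).det :=
  (Matrix.isUnit_iff_isUnit_det _).mp
    ⟨⟨_, _, jacobian4_mul_jacobian4 he he' hx hx', jacobian4_mul_jacobian4 he' he hx' hx⟩, rfl⟩

theorem modelFrame_eq_sum (he : e ∈ IsManifold.maximalAtlas (𝓡 3) ∞ S)
    (hx : x ∈ e.source) (a : Fin 4) :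
    modelFrame e' (e' x) a = ∑ b, jacobian4 e e' x b a • modelFrame e (e x) b := by
  rw [Fin.sum_univ_succ]
  refine Fin.cases ?_ (fun i => ?_) a
  · simp [modelFrame, jacobian4]
  · simp [modelFrame, jacobian4, symmDeriv_single_eq_sum he hx (e' := e') i, Prod.ext_iff,
      Prod.fst_sum, Prod.snd_sum]

/-- The spacetime coordinates `(0, y)`. -/
def atTimeZero (y : E3) : Coord.Pt := Fin.cons 0 (fun i => y i)

theorem spatial_atTimeZero (y : E3) : spatial (atTimeZero y) = y := by
  ext i; simp [spatial, atTimeZero]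

theorem comp_eq_of_spatial (T : StaticTensor S) (e : OpenPartialHomeomorph S E3) {p q : Coord.Pt}
    (h : spatial p = spatial q) : T.comp e p = T.comp e q := by
  rw [StaticTensor.comp, StaticTensor.comp, h]

/-- A static tensor as a bilinear form on the model space. -/
def modelForm (T : StaticTensor S) (x : S) : LinearMap.BilinForm ℝ (ℝ × E3) := T x

theorem comp_apply (T : StaticTensor S) (e : OpenPartialHomeomorph S E3) (p : Coord.Pt)
    (a b : Fin 4) : T.comp e p a b = modelForm T (e.symm (spatial p))
      (modelFrame e (spatial p) a) (modelFrame e (spatial p) b) := by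
  have h : ∀ a, frame e (spatial p) a = modelFrame e (spatial p) a := by
    intro a
    refine Fin.cases rfl (fun i => rfl) a
  rw [StaticTensor.comp, Matrix.of_apply, h, h]
  rfl

theorem comp_transform (T : StaticTensor S) (he : e ∈ IsManifold.maximalAtlas (𝓡 3) ∞ S)
    (hx : x ∈ e.source) (hx' : x ∈ e'.source) :
    T.comp e' (atTimeZero (e' x)) = (jacobian4 e e' x).transpose * T.comp e (atTimeZero (e x))
      * jacobian4 e e' x := by
  ext a b
  simp only [Matrix.mul_apply, Matrix.transpose_apply, comp_apply, spatial_atTimeZero,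
    e.left_inv hx, e'.left_inv hx', modelFrame_eq_sum he hx (e' := e')]
  simp only [map_sum, LinearMap.sum_apply, map_smul, LinearMap.smul_apply, smul_eq_mul,
    Finset.sum_mul, Finset.mul_sum]
  exact Finset.sum_congr rfl fun _ _ => Finset.sum_congr rfl fun _ _ => by ring

/-- A static tensor vanishes at `x` when its components there vanish. -/
theorem eq_zero_of_comp_eq_zero (T : StaticTensor S) (he : e ∈ IsManifold.maximalAtlas (𝓡 3) ∞ S)
    (hx : x ∈ e.source) (h : T.comp e (atTimeZero (e x)) = 0) : T x = 0 := by
  have key : ∀ v : ℝ × E3, v = v.1 • modelFrame e (e x) 0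
      + ∑ i : Fin 3, (chartDeriv e x v.2) i • modelFrame e (e x) i.succ := by
    intro v
    refine Prod.ext (by simp [modelFrame, Prod.fst_sum]) ?_
    have := symmDeriv_comp_chartDeriv he hx v.2
    conv_lhs => rw [← this, euclidean_eq_sum (chartDeriv e x v.2), map_sum]
    simp [modelFrame, Prod.snd_sum]
  have h2 : ∀ a b, modelForm T x (modelFrame e (e x) a) (modelFrame e (e x) b) = 0 := by
    intro a b
    have := congrFun (congrFun h a) b
    rwa [comp_apply, spatial_atTimeZero, e.left_inv hx] at this
  have h3 : modelForm T x = 0 := by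
    refine LinearMap.ext fun v => LinearMap.ext fun w => ?_
    rw [key v, key w]
    simp [h2]
  exact h3

end Transition

/-! ### The volume density -/

namespace Coord

variable {U : Set Pt} {p : Pt} {g : Pt → Matrix (Fin 4) (Fin 4) ℝ}

/-- Jacobi's formula for the derivative of a determinant. -/
theorem pd_det (hU : IsOpen U) {A : Pt → Matrix (Fin 4) (Fin 4) ℝ} (hA : SmoothMatrix U A)
    (hp : p ∈ U) (c : Fin 4) :
    pd c (fun q => (A q).det) p = ∑ i, ∑ j, (A p).adjugate j i * pd c (fun q => A q i j) p := by
  -- The determinant as a continuous multilinear function of the rows, so that its derivative is the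
  -- sum over rows of determinants with one row differentiated.
  let f : ContinuousMultilinearMap ℝ (fun _ : Fin 4 => Fin 4 → ℝ) ℝ :=
    ⟨Matrix.detRowAlternating.toMultilinearMap, by
      exact Continuous.matrix_det (A := fun M : Matrix (Fin 4) (Fin 4) ℝ => M) continuous_id⟩
  have hd : ∀ i, HasFDerivAt (fun q => A q i)
      (ContinuousLinearMap.pi fun j => fderiv ℝ (fun q => A q i j) p) p := fun i =>
    hasFDerivAt_pi.2 fun j => (hA.differentiableAt hU hp i j).hasFDerivAt
  have h := HasFDerivAt.multilinear_comp f hd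
  have h2 : HasFDerivAt (fun q => (A q).det) _ p := h
  rw [pd, h2.fderiv]
  simp only [sum_apply, ContinuousLinearMap.comp_apply]
  refine Finset.sum_congr rfl fun i _ => ?_
  change ((A p).updateRow i fun j => pd c (fun q => A q i j) p).det = _
  -- Cramer's rule turns a determinant with a replaced row into a row of the adjugate paired with
  -- the new entries.
  rw [← Matrix.cramer_transpose_apply, Matrix.cramer_eq_adjugate_mulVec, ← Matrix.adjugate_transpose]
  rfl

/-- Of the three derivatives in the contracted symbol, two cancel by symmetry of the metric and its
inverse. -/
theorem IsMetricOn.sum_christoffel (hg : IsMetricOn g U) (hp : p ∈ U) (c : Fin 4) :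
    ∑ a, christoffel g a c a p
      = (1 / 2) * ∑ a, ∑ b, (g p)⁻¹ a b * pd c (fun q => g q a b) p := by
  have h : ∑ a, ∑ d, (g p)⁻¹ a d * pd a (fun q => g q d c) p
      = ∑ a, ∑ d, (g p)⁻¹ a d * pd d (fun q => g q c a) p := by
    rw [Finset.sum_comm]
    exact Finset.sum_congr rfl fun a _ => Finset.sum_congr rfl fun d _ => by
      rw [hg.inv_symm_apply hp, hg.pd_symm hp]
  have h2 : ∑ a, ∑ d, (g p)⁻¹ a d * pd c (fun q => g q d a) p
      = ∑ a, ∑ d, (g p)⁻¹ a d * pd c (fun q => g q a d) p :=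
    Finset.sum_congr rfl fun a _ => Finset.sum_congr rfl fun d _ => by rw [hg.pd_symm hp]
  simp only [christoffel, ← Finset.mul_sum, mul_add, mul_sub, Finset.sum_add_distrib,
    Finset.sum_sub_distrib]
  rw [h, h2]
  ring

theorem IsMetricOn.pd_det (hg : IsMetricOn g U) (hp : p ∈ U) (c : Fin 4) :
    pd c (fun q => (g q).det) p = 2 * (g p).det * ∑ a, christoffel g a c a p := by
  rw [Coord.pd_det hg.isOpen hg.smooth hp, hg.sum_christoffel hp]
  have hne := (hg.isUnit_det p hp).ne_zero
  have h : ∀ i j, (g p).adjugate j i = (g p).det * (g p)⁻¹ i j := by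
    intro i j
    rw [hg.inv_symm_apply hp i j, Matrix.inv_def, Matrix.smul_apply, Ring.inverse_eq_inv',
      smul_eq_mul]
    field_simp
  simp only [h, mul_assoc, ← Finset.mul_sum]
  ring

/-- A volume density `w` with `w² = - det g` satisfies `∂_c w = w Γ^a_{ca}`. -/
theorem IsMetricOn.pd_density (hg : IsMetricOn g U) (hp : p ∈ U) {w : Pt → ℝ}
    (hw : ContDiffOn ℝ ∞ w U) (hpos : 0 < w p) (hdet : ∀ q ∈ U, (g q).det = -(w q * w q))
    (c : Fin 4) : pd c w p = w p * ∑ a, christoffel g a c a p := by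
  have hd := differentiableAt_of_smooth hg.isOpen hw hp
  have h := hg.pd_det hp c
  rw [pd_congr hg.isOpen hdet hp, pd_neg, pd_mul hd hd, hdet p hp] at h
  have h2 : w p * (pd c w p - w p * ∑ a, christoffel g a c a p) = 0 := by linarith
  linarith [(mul_eq_zero.mp h2).resolve_left hpos.ne']

end Coord

/-- `spatial` as a continuous linear map. -/
noncomputable def spatialL : Coord.Pt →L[ℝ] E3 :=
  LinearMap.toContinuousLinearMap
    { toFun := spatial
      map_add' := fun p q => by ext i; simp [spatial]
      map_smul' := fun c p => by ext i; simp [spatial] }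

theorem spatialL_apply (p : Coord.Pt) : spatialL p = spatial p := rfl

theorem contDiff_spatial : ContDiff ℝ ∞ spatial := spatialL.contDiff

theorem spatial_single_succ (i : Fin 3) :
    spatial (Pi.single i.succ 1) = EuclideanSpace.single i (1 : ℝ) := by
  ext j; simp [spatial, Pi.single_apply]

theorem spatial_add_time (s : ℝ) (p : Coord.Pt) :
    spatial (p + s • Pi.single 0 1) = spatial p := by
  ext j; simp [spatial]

theorem timeIndep_comp_spatial (F : E3 → ℝ) : Coord.TimeIndep (fun p => F (spatial p)) :=
  fun s p => by simp only [spatial_add_time]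

/-- The part of the spacetime coordinates `(t, e)` in which they are defined. -/
def chartRegion {S : Type*} [TopologicalSpace S] (e : OpenPartialHomeomorph S E3) : Set Coord.Pt :=
  spatial ⁻¹' e.target

theorem contDiffOn_comp_spatial {S : Type*} [TopologicalSpace S] {e : OpenPartialHomeomorph S E3}
    {F : E3 → ℝ} (hF : ContDiffOn ℝ ∞ F e.target) :
    ContDiffOn ℝ ∞ (fun p => F (spatial p)) (chartRegion e) :=
  hF.comp contDiff_spatial.contDiffOn fun _ hp => hp

theorem isOpen_chartRegion {S : Type*} [TopologicalSpace S] (e : OpenPartialHomeomorph S E3) :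
    IsOpen (chartRegion e) := e.open_target.preimage contDiff_spatial.continuous

theorem pd_comp_spatial {F : E3 → ℝ} {p : Coord.Pt} (hF : DifferentiableAt ℝ F (spatial p))
    (i : Fin 3) : Coord.pd i.succ (fun q => F (spatial q)) p
      = fderiv ℝ F (spatial p) (EuclideanSpace.single i 1) := by
  have h : HasFDerivAt (fun q => F (spatial q)) ((fderiv ℝ F (spatial p)).comp spatialL) p :=
    hF.hasFDerivAt.comp p spatialL.hasFDerivAt
  rw [Coord.pd, h.fderiv, ContinuousLinearMap.comp_apply, spatialL_apply, spatial_single_succ]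

/-- The derivative of a time-independent function along the slice `t = 0`. -/
theorem fderiv_atTimeZero {f : Coord.Pt → ℝ} {y : E3} (hf : DifferentiableAt ℝ f (atTimeZero y))
    (i : Fin 3) : fderiv ℝ (fun z => f (atTimeZero z)) y (EuclideanSpace.single i 1)
      = Coord.pd i.succ f (atTimeZero y) := by
  let l : E3 →L[ℝ] Coord.Pt := LinearMap.toContinuousLinearMap
    { toFun := atTimeZero
      map_add' := fun p q => by
        ext i; refine Fin.cases ?_ (fun j => ?_) i <;> simp [atTimeZero]
      map_smul' := fun c p => by
        ext i; refine Fin.cases ?_ (fun j => ?_) i <;> simp [atTimeZero] }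
  have h : HasFDerivAt (fun z => f (atTimeZero z)) ((fderiv ℝ f (atTimeZero y)).comp l) y :=
    hf.hasFDerivAt.comp y l.hasFDerivAt
  rw [h.fderiv, Coord.pd, ContinuousLinearMap.comp_apply]
  congr 1
  ext j
  refine Fin.cases ?_ (fun k => ?_) j
  · simp [l, atTimeZero]
  · simp [l, atTimeZero, Pi.single_apply]

theorem contDiff_atTimeZero : ContDiff ℝ ∞ atTimeZero := by
  rw [contDiff_pi]
  intro a
  refine Fin.cases ?_ (fun j => ?_) a
  · simpa [atTimeZero] using contDiff_const
  · simp only [atTimeZero, Fin.cons_succ]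
    exact (EuclideanSpace.proj (𝕜 := ℝ) j : E3 →L[ℝ] ℝ).contDiff

/-! ### A static spacetime in a chart -/

namespace StaticSpacetime

variable {S : Type*} [TopologicalSpace S] [ChartedSpace E3 S] [IsManifold (𝓡 3) ∞ S]
  {e e' : OpenPartialHomeomorph S E3} (M : StaticSpacetime S)

/-- The spatial metric as a bilinear form on the model space. -/
def modelInner (x : S) : E3 →L[ℝ] E3 →L[ℝ] ℝ := M.h.inner x

theorem hComp_apply (e : OpenPartialHomeomorph S E3) (y : E3) (i j : Fin 3) :
    M.hComp e y i j = M.modelInner (e.symm y) (symmDeriv e y (EuclideanSpace.single i 1))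
      (symmDeriv e y (EuclideanSpace.single j 1)) := rfl

theorem g_time_time (e : OpenPartialHomeomorph S E3) (p : Coord.Pt) :
    M.g e p 0 0 = - M.N (e.symm (spatial p)) ^ 2 := by
  simp [g, StaticTensor.comp, metric, frame]

theorem g_time_space (e : OpenPartialHomeomorph S E3) (p : Coord.Pt) (i : Fin 3) :
    M.g e p 0 i.succ = 0 := by
  simp [g, StaticTensor.comp, metric, frame]

theorem g_space_time (e : OpenPartialHomeomorph S E3) (p : Coord.Pt) (i : Fin 3) :
    M.g e p i.succ 0 = 0 := by
  simp [g, StaticTensor.comp, metric, frame]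

theorem g_space_space (e : OpenPartialHomeomorph S E3) (p : Coord.Pt) (i j : Fin 3) :
    M.g e p i.succ j.succ = M.hComp e (spatial p) i j := by
  simp [g, StaticTensor.comp, metric, frame, hComp]

theorem hComp_symm (e : OpenPartialHomeomorph S E3) (y : E3) (i j : Fin 3) :
    M.hComp e y i j = M.hComp e y j i := M.h.symm _ _ _

theorem hComp_posDef (he : e ∈ IsManifold.maximalAtlas (𝓡 3) ∞ S) {y : E3} (hy : y ∈ e.target) :
    (M.hComp e y).PosDef := by
  refine Matrix.PosDef.of_dotProduct_mulVec_pos (Matrix.IsHermitian.ext fun i j => by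
    simpa using M.hComp_symm e y j i) fun v hv => ?_
  have hsum : star v ⬝ᵥ (M.hComp e y).mulVec v = M.modelInner (e.symm y)
      (symmDeriv e y (WithLp.toLp 2 v)) (symmDeriv e y (WithLp.toLp 2 v)) := by
    rw [euclidean_eq_sum (WithLp.toLp 2 v)]
    simp only [map_sum, map_smul, sum_apply, smul_apply,
      smul_eq_mul, dotProduct, Matrix.mulVec, Finset.mul_sum, hComp_apply]
    rw [Finset.sum_comm]
    refine Finset.sum_congr rfl fun i _ => Finset.sum_congr rfl fun j _ => ?_
    simp only [star_trivial, Pi.star_apply]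
    ring
  rw [hsum]
  refine M.h.pos _ _ fun h0 => hv ?_
  have hx := chartDeriv_comp_symmDeriv he (e.map_target hy) (WithLp.toLp 2 v)
  rw [e.right_inv hy] at hx
  have h1 : symmDeriv e y (WithLp.toLp 2 v) = 0 := h0
  rw [h1, map_zero] at hx
  have := congrArg WithLp.ofLp hx
  simpa using this.symm

theorem det_hComp_pos (he : e ∈ IsManifold.maximalAtlas (𝓡 3) ∞ S) {y : E3} (hy : y ∈ e.target) :
    0 < (M.hComp e y).det := (M.hComp_posDef he hy).det_pos

theorem det_g (e : OpenPartialHomeomorph S E3) (p : Coord.Pt) :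
    (M.g e p).det = - (M.N (e.symm (spatial p)) ^ 2 * (M.hComp e (spatial p)).det) := by
  rw [Matrix.det_succ_row_zero, Fin.sum_univ_succ]
  simp only [g_time_space, mul_zero, zero_mul, Finset.sum_const_zero, add_zero, g_time_time]
  have : (M.g e p).submatrix Fin.succ (Fin.succAbove 0) = M.hComp e (spatial p) := by
    ext i j
    simp [M.g_space_space]
  rw [this]
  simp

/-- The logarithm of the lapse. -/
noncomputable def logLapse (e : OpenPartialHomeomorph S E3) (p : Coord.Pt) : ℝ :=
  Real.log (M.N (e.symm (spatial p)))

/-- The bridge from the manifold to the coordinate computations: with `L = log N`, the component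
`-N²` takes the form `-e^{2L}`. -/
theorem isStaticOn (he : e ∈ IsManifold.maximalAtlas (𝓡 3) ∞ S) :
    Coord.IsStaticOn (M.g e) (M.logLapse e) (chartRegion e) where
  isOpen := isOpen_chartRegion e
  smooth := by
    have hN := contDiffOn_comp_spatial (contDiffOn_comp_symm he M.N_smooth)
    intro a b
    refine Fin.cases ?_ (fun i => ?_) a <;> refine Fin.cases ?_ (fun j => ?_) b
    · simp only [g_time_time]; exact (hN.pow 2).neg
    · simp only [g_time_space]; exact contDiffOn_const
    · simp only [g_space_time]; exact contDiffOn_const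
    · simp only [g_space_space]; exact contDiffOn_comp_spatial (M.contDiffOn_hComp he i j)
  symm := by
    intro p _
    ext a b
    rw [Matrix.transpose_apply]
    refine Fin.cases ?_ (fun i => ?_) a <;> refine Fin.cases ?_ (fun j => ?_) b
    · rfl
    · rw [g_time_space, g_space_time]
    · rw [g_time_space, g_space_time]
    · rw [g_space_space, g_space_space, hComp_symm]
  isUnit_det := by
    intro p hp
    rw [M.det_g]
    exact (neg_ne_zero.mpr (mul_pos (pow_pos (M.N_pos _) 2) (M.det_hComp_pos he hp)).ne').isUnit
  timeIndep := by
    intro a b s p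
    simp only [g, comp_eq_of_spatial M.metric e (spatial_add_time s p)]
  smooth_log := (contDiffOn_comp_spatial (contDiffOn_comp_symm he M.N_smooth)).log
    fun p _ => (M.N_pos _).ne'
  timeIndep_log := timeIndep_comp_spatial fun y => Real.log (M.N (e.symm y))
  time_time := by
    intro p _
    rw [g_time_time, logLapse, mul_comm, Real.exp_mul, Real.exp_log (M.N_pos _)]
    norm_cast
  time_space := fun p _ i => M.g_time_space e p i

/-- The spacetime volume density `N √(det h)` in a chart. -/
noncomputable def density (e : OpenPartialHomeomorph S E3) (y : E3) : ℝ :=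
  M.N (e.symm y) * Real.sqrt (M.hComp e y).det

theorem density_pos (he : e ∈ IsManifold.maximalAtlas (𝓡 3) ∞ S) {y : E3} (hy : y ∈ e.target) :
    0 < M.density e y := mul_pos (M.N_pos _) (Real.sqrt_pos.mpr (M.det_hComp_pos he hy))

theorem contDiffOn_density (he : e ∈ IsManifold.maximalAtlas (𝓡 3) ∞ S) :
    ContDiffOn ℝ ∞ (M.density e) e.target := by
  refine (contDiffOn_comp_symm he M.N_smooth).mul (ContDiffOn.sqrt ?_ fun y hy =>
    (M.det_hComp_pos he hy).ne')
  simp only [Matrix.det_apply]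
  exact ContDiffOn.sum fun σ _ =>
    (contDiffOn_prod fun i _ => M.contDiffOn_hComp he _ _).const_smul _

/-- Since `(N √h)² = -det g`, the slice volume weighted by the lapse is the spacetime density.
Spacetime divergences of static fields thus become divergences on the slice. -/
theorem pd_density (he : e ∈ IsManifold.maximalAtlas (𝓡 3) ∞ S) {p : Coord.Pt}
    (hp : p ∈ chartRegion e) (c : Fin 4) :
    Coord.pd c (fun q => M.density e (spatial q)) p
      = M.density e (spatial p) * ∑ a, Coord.christoffel (M.g e) a c a p := by
  refine (M.isStaticOn he).toIsMetricOn.pd_density hp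
    (contDiffOn_comp_spatial (M.contDiffOn_density he)) (M.density_pos he hp) (fun q hq => ?_) c
  rw [det_g, density, mul_mul_mul_comm, Real.mul_self_sqrt (M.det_hComp_pos he hq).le]
  ring

end StaticSpacetime

/-! ### Invariance of metric contractions under congruence -/

namespace Coord

variable {g : Pt → Matrix (Fin 4) (Fin 4) ℝ} {p : Pt}

/-- The components of the Ricci tensor as a matrix. -/
noncomputable def ricciMatrix (g : Pt → Matrix (Fin 4) (Fin 4) ℝ) (p : Pt) :
    Matrix (Fin 4) (Fin 4) ℝ := Matrix.of fun a b => ricci g a b p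

theorem sum_inv_mul (A B : Matrix (Fin 4) (Fin 4) ℝ) :
    ∑ a, ∑ b, A a b * B a b = (A * B.transpose).trace := by
  simp [Matrix.trace, Matrix.mul_apply]

theorem ricciSq_eq_trace (g : Pt → Matrix (Fin 4) (Fin 4) ℝ) (p : Pt) :
    ricciSq g p = ((g p)⁻¹ * ricciMatrix g p * ((g p)⁻¹).transpose
      * (ricciMatrix g p).transpose).trace := by
  rw [← sum_inv_mul, ricciSq]
  refine Finset.sum_congr rfl fun a _ => Finset.sum_congr rfl fun b _ => ?_
  simp only [ricciUp, Matrix.mul_apply, ricciMatrix, Matrix.of_apply, Matrix.transpose_apply,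
    Finset.sum_mul]
  rw [Finset.sum_comm]
  exact Finset.sum_congr rfl fun c _ => Finset.sum_congr rfl fun d _ => by ring

theorem raise_eq_mulVec (g : Pt → Matrix (Fin 4) (Fin 4) ℝ) (ξ : Fin 4 → Pt → ℝ) (p : Pt) :
    (fun a => raise g ξ a p) = (g p)⁻¹.mulVec fun b => ξ b p := rfl

theorem inv_congruence {A J : Matrix (Fin 4) (Fin 4) ℝ} :
    (J.transpose * A * J)⁻¹ = J⁻¹ * A⁻¹ * (J⁻¹).transpose := by
  rw [Matrix.mul_inv_rev, Matrix.mul_inv_rev, Matrix.transpose_nonsing_inv, Matrix.mul_assoc]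

/-- Under `A ↦ Jᵀ A J` the inverse picks up `J⁻¹` on both sides, so the Jacobians cancel in a full
contraction, up to a conjugation that the trace ignores. -/
theorem trace_congruence {A B J : Matrix (Fin 4) (Fin 4) ℝ} (hJ : IsUnit J.det) :
    ((J.transpose * A * J)⁻¹ * (J.transpose * B * J).transpose).trace
      = (A⁻¹ * B.transpose).trace := by
  have h : (J⁻¹).transpose * J.transpose = 1 := by
    rw [← Matrix.transpose_mul, Matrix.mul_nonsing_inv _ hJ, Matrix.transpose_one]
  have h2 : (J.transpose * A * J)⁻¹ * (J.transpose * B * J).transpose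
      = J⁻¹ * (A⁻¹ * B.transpose * J) := by
    rw [inv_congruence, Matrix.transpose_mul, Matrix.transpose_mul, Matrix.transpose_transpose]
    calc _ = J⁻¹ * A⁻¹ * ((J⁻¹).transpose * J.transpose) * (B.transpose * J) := by noncomm_ring
      _ = _ := by rw [h]; noncomm_ring
  rw [h2, Matrix.trace_mul_comm, Matrix.mul_assoc, Matrix.mul_nonsing_inv _ hJ, Matrix.mul_one]

theorem trace_congruence_sq {A B J : Matrix (Fin 4) (Fin 4) ℝ} (hJ : IsUnit J.det) :
    ((J.transpose * A * J)⁻¹ * (J.transpose * B * J) * ((J.transpose * A * J)⁻¹).transpose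
      * (J.transpose * B * J).transpose).trace = (A⁻¹ * B * A⁻¹.transpose * B.transpose).trace := by
  have h : (J⁻¹).transpose * J.transpose = 1 := by
    rw [← Matrix.transpose_mul, Matrix.mul_nonsing_inv _ hJ, Matrix.transpose_one]
  have h' : J * J⁻¹ = 1 := Matrix.mul_nonsing_inv _ hJ
  have h2 : (J.transpose * A * J)⁻¹ * (J.transpose * B * J) * ((J.transpose * A * J)⁻¹).transpose
      * (J.transpose * B * J).transpose = J⁻¹ * (A⁻¹ * B * A⁻¹.transpose * B.transpose * J) := by
    rw [inv_congruence]
    simp only [Matrix.transpose_mul, Matrix.transpose_transpose]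
    calc _ = J⁻¹ * A⁻¹ * ((J⁻¹).transpose * J.transpose) * B * (J * J⁻¹) * A⁻¹.transpose
          * ((J⁻¹).transpose * J.transpose) * (B.transpose * J) := by noncomm_ring
      _ = _ := by rw [h, h']; noncomm_ring
  rw [h2, Matrix.trace_mul_comm, Matrix.mul_assoc, h', Matrix.mul_one]

end Coord

/-! ### Scalar and covector fields given by their chart expressions -/

section Fields

variable {S : Type*} [TopologicalSpace S] [ChartedSpace E3 S]

/-- The value at points of `S` of a scalar given in coordinates. -/
noncomputable def scalarField (F : OpenPartialHomeomorph S E3 → Coord.Pt → ℝ) (x : S) : ℝ :=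
  F (chartAt E3 x) (atTimeZero (chartAt E3 x x))

/-- A smooth static scalar given by its expressions in all coordinate systems `(t, e)`. -/
structure IsScalarField (F : OpenPartialHomeomorph S E3 → Coord.Pt → ℝ) : Prop where
  smooth : ∀ e ∈ IsManifold.maximalAtlas (𝓡 3) ∞ S, ContDiffOn ℝ ∞ (F e) (chartRegion e)
  timeIndep : ∀ e ∈ IsManifold.maximalAtlas (𝓡 3) ∞ S, Coord.TimeIndep (F e)
  transform : ∀ e ∈ IsManifold.maximalAtlas (𝓡 3) ∞ S, ∀ e' ∈ IsManifold.maximalAtlas (𝓡 3) ∞ S,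
    ∀ x ∈ e.source, x ∈ e'.source → F e' (atTimeZero (e' x)) = F e (atTimeZero (e x))

/-- A smooth static covector field given by its components in all coordinate systems `(t, e)`. -/
structure IsCovectorField (ξ : OpenPartialHomeomorph S E3 → Fin 4 → Coord.Pt → ℝ) : Prop where
  smooth : ∀ e ∈ IsManifold.maximalAtlas (𝓡 3) ∞ S, ∀ a, ContDiffOn ℝ ∞ (ξ e a) (chartRegion e)
  timeIndep : ∀ e ∈ IsManifold.maximalAtlas (𝓡 3) ∞ S, ∀ a, Coord.TimeIndep (ξ e a)
  transform : ∀ e ∈ IsManifold.maximalAtlas (𝓡 3) ∞ S, ∀ e' ∈ IsManifold.maximalAtlas (𝓡 3) ∞ S,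
    ∀ x ∈ e.source, x ∈ e'.source → (fun a => ξ e' a (atTimeZero (e' x)))
      = (jacobian4 e e' x).transpose.mulVec fun a => ξ e a (atTimeZero (e x))

theorem timeIndep_atTimeZero {f : Coord.Pt → ℝ} (hf : Coord.TimeIndep f) (p : Coord.Pt) :
    f (atTimeZero (spatial p)) = f p := by
  have : p = atTimeZero (spatial p) + p 0 • Pi.single 0 1 := by
    ext a
    refine Fin.cases ?_ (fun j => ?_) a <;> simp [atTimeZero, spatial]
  conv_rhs => rw [this, hf]

omit [ChartedSpace E3 S] in
theorem atTimeZero_mem_chartRegion {e : OpenPartialHomeomorph S E3} {y : E3} (hy : y ∈ e.target) :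
    atTimeZero y ∈ chartRegion e := by
  rw [chartRegion, Set.mem_preimage, spatial_atTimeZero]; exact hy

omit [ChartedSpace E3 S] in
theorem contDiffOn_atTimeZero {e : OpenPartialHomeomorph S E3} {f : Coord.Pt → ℝ}
    (hf : ContDiffOn ℝ ∞ f (chartRegion e)) : ContDiffOn ℝ ∞ (fun y => f (atTimeZero y)) e.target :=
  hf.comp contDiff_atTimeZero.contDiffOn fun _ hy => atTimeZero_mem_chartRegion hy

variable [IsManifold (𝓡 3) ∞ S]

theorem contMDiff_of_contDiffOn {f : S → ℝ}
    (h : ∀ e ∈ IsManifold.maximalAtlas (𝓡 3) ∞ S, ContDiffOn ℝ ∞ (fun y => f (e.symm y)) e.target) :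
    ContMDiff (𝓡 3) 𝓘(ℝ, ℝ) ∞ f := by
  intro x
  have he := IsManifold.chart_mem_maximalAtlas (I := 𝓡 3) (n := ∞) x
  set e := chartAt E3 x
  have hx : x ∈ e.source := mem_chart_source E3 x
  have h1 := (contMDiffOn_iff_contDiffOn.2 (h e he)).comp (contMDiffOn_of_mem_maximalAtlas he)
    (fun y hy => e.map_source hy)
  refine (h1.congr fun y hy => ?_).contMDiffAt (e.open_source.mem_nhds hx)
  simp [e.left_inv hy]

namespace IsScalarField

variable {F : OpenPartialHomeomorph S E3 → Coord.Pt → ℝ} (hF : IsScalarField F)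
include hF

theorem apply_eq {e : OpenPartialHomeomorph S E3} (he : e ∈ IsManifold.maximalAtlas (𝓡 3) ∞ S)
    {x : S} (hx : x ∈ e.source) : scalarField F x = F e (atTimeZero (e x)) :=
  hF.transform e he _ (IsManifold.chart_mem_maximalAtlas x) x hx (mem_chart_source E3 x)

theorem apply_symm {e : OpenPartialHomeomorph S E3} (he : e ∈ IsManifold.maximalAtlas (𝓡 3) ∞ S)
    {p : Coord.Pt} (hp : p ∈ chartRegion e) : scalarField F (e.symm (spatial p)) = F e p := by
  rw [hF.apply_eq he (e.map_target hp), e.right_inv hp, timeIndep_atTimeZero (hF.timeIndep e he)]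

theorem contMDiff : ContMDiff (𝓡 3) 𝓘(ℝ, ℝ) ∞ (scalarField F) :=
  contMDiff_of_contDiffOn fun e he => (contDiffOn_atTimeZero (hF.smooth e he)).congr fun y hy => by
    rw [← hF.apply_symm he (atTimeZero_mem_chartRegion hy), spatial_atTimeZero]

end IsScalarField

omit [IsManifold (𝓡 3) ∞ S] in
/-- The differential of a smooth function. -/
theorem isCovectorField_pd {f : S → ℝ} (hf : ContMDiff (𝓡 3) 𝓘(ℝ, ℝ) ∞ f) :
    IsCovectorField (S := S) fun e a => Coord.pd a fun p => f (e.symm (spatial p)) where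
  smooth := fun e he a => Coord.contDiffOn_pd (isOpen_chartRegion e)
    (contDiffOn_comp_spatial (contDiffOn_comp_symm he hf)) a
  timeIndep := fun e _ a => (timeIndep_comp_spatial fun y => f (e.symm y)).pd a
  transform := by
    intro e he e' he' x hx hx'
    -- The components are the intrinsic differential, extended by zero in the time direction,
    -- evaluated on the frame. The transformation law is then that of the frame.
    have key : ∀ e ∈ IsManifold.maximalAtlas (𝓡 3) ∞ S, x ∈ e.source → ∀ a,
        Coord.pd a (fun p => f (e.symm (spatial p))) (atTimeZero (e x))
          = ((diffAt f x).comp (ContinuousLinearMap.snd ℝ ℝ E3)) (modelFrame e (e x) a) := by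
      intro e he hx a
      refine Fin.cases ?_ (fun i => ?_) a
      · rw [(timeIndep_comp_spatial fun y => f (e.symm y)).pd_zero]
        simp [modelFrame]
      · have hd : DifferentiableAt ℝ (fun y => f (e.symm y)) (spatial (atTimeZero (e x))) := by
          rw [spatial_atTimeZero]
          exact ((contDiffOn_comp_symm he hf).contDiffAt
            (e.open_target.mem_nhds (e.map_source hx))).differentiableAt (by simp)
        rw [pd_comp_spatial hd, spatial_atTimeZero,
          fderiv_comp_symm he hx (hf.mdifferentiable (by simp) x)]
        simp [modelFrame]
    ext a
    rw [key e' he' hx', modelFrame_eq_sum he hx, map_sum]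
    simp only [map_smul, Matrix.mulVec, dotProduct, Matrix.transpose_apply, key e he hx, smul_eq_mul]

omit [IsManifold (𝓡 3) ∞ S] in
theorem IsCovectorField.add {ξ η : OpenPartialHomeomorph S E3 → Fin 4 → Coord.Pt → ℝ}
    (hξ : IsCovectorField ξ) (hη : IsCovectorField η) :
    IsCovectorField fun e a p => ξ e a p + η e a p where
  smooth := fun e he a => (hξ.smooth e he a).add (hη.smooth e he a)
  timeIndep := fun e he a s p => by
    simp only [hξ.timeIndep e he a s p, hη.timeIndep e he a s p]
  transform := by
    intro e he e' he' x hx hx'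
    have h1 := hξ.transform e he e' he' x hx hx'
    have h2 := hη.transform e he e' he' x hx hx'
    have := congrArg₂ (· + ·) h1 h2
    simp only [← Matrix.mulVec_add] at this
    exact this

namespace StaticSpacetime

variable (M : StaticSpacetime S) {ξ : OpenPartialHomeomorph S E3 → Fin 4 → Coord.Pt → ℝ}
  {e e' : OpenPartialHomeomorph S E3} {x : S}

theorem g_transform (he : e ∈ IsManifold.maximalAtlas (𝓡 3) ∞ S)
    (hx : x ∈ e.source) (hx' : x ∈ e'.source) :
    M.g e' (atTimeZero (e' x)) = (jacobian4 e e' x).transpose * M.g e (atTimeZero (e x))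
      * jacobian4 e e' x := comp_transform M.metric he hx hx'

/-- The tangent vector with the components `g^{ab} ξ_b`, in the model space. -/
noncomputable def sharp (ξ : OpenPartialHomeomorph S E3 → Fin 4 → Coord.Pt → ℝ)
    (e : OpenPartialHomeomorph S E3) (y : E3) : E3 :=
  ∑ i : Fin 3, Coord.raise (M.g e) (ξ e) i.succ (atTimeZero y)
    • symmDeriv e y (EuclideanSpace.single i 1)

theorem raise_transform (hξ : IsCovectorField ξ) (he : e ∈ IsManifold.maximalAtlas (𝓡 3) ∞ S)
    (he' : e' ∈ IsManifold.maximalAtlas (𝓡 3) ∞ S) (hx : x ∈ e.source) (hx' : x ∈ e'.source) :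
    ((jacobian4 e e' x).mulVec fun a => Coord.raise (M.g e') (ξ e') a (atTimeZero (e' x)))
      = fun a => Coord.raise (M.g e) (ξ e) a (atTimeZero (e x)) := by
  have hJ := isUnit_det_jacobian4 he he' hx hx'
  have h : ((jacobian4 e e' x)⁻¹).transpose * (jacobian4 e e' x).transpose = 1 := by
    rw [← Matrix.transpose_mul, Matrix.mul_nonsing_inv _ hJ, Matrix.transpose_one]
  rw [Coord.raise_eq_mulVec, Coord.raise_eq_mulVec, hξ.transform e he e' he' x hx hx',
    M.g_transform he hx hx', Coord.inv_congruence, Matrix.mulVec_mulVec, Matrix.mulVec_mulVec,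
    ← Matrix.mul_assoc, ← Matrix.mul_assoc, Matrix.mul_nonsing_inv _ hJ, Matrix.one_mul,
    Matrix.mul_assoc, h, Matrix.mul_one]

theorem sharp_eq (hξ : IsCovectorField ξ) (he : e ∈ IsManifold.maximalAtlas (𝓡 3) ∞ S)
    (he' : e' ∈ IsManifold.maximalAtlas (𝓡 3) ∞ S) (hx : x ∈ e.source) (hx' : x ∈ e'.source) :
    M.sharp ξ e' (e' x) = M.sharp ξ e (e x) := by
  have key : ∀ e, M.sharp ξ e (e x) = (∑ a, Coord.raise (M.g e) (ξ e) a (atTimeZero (e x))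
      • modelFrame e (e x) a).2 := by
    intro e
    rw [Fin.sum_univ_succ, sharp]
    simp [modelFrame, Prod.snd_sum]
  rw [key, key]
  congr 1
  have h := fun b => congrFun (M.raise_transform hξ he he' hx hx') b
  simp only [modelFrame_eq_sum he hx (e' := e'), ← h, Matrix.mulVec, dotProduct, Finset.sum_smul,
    Finset.smul_sum, smul_smul]
  rw [Finset.sum_comm]
  exact Finset.sum_congr rfl fun _ _ => Finset.sum_congr rfl fun _ _ => by rw [mul_comm]

section Einstein

variable {T : StaticTensor S} {γ κ : ℝ} (hγ : 0 < γ) (hκ : 0 < κ) (hGR : M.SolvesEinstein γ κ T)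
include hγ hκ hGR

/-- Einstein's equations make the coordinate expression a constant multiple of `T`, which is a
genuine tensor, so the transformation law is inherited from `T` and no transformation of Christoffel
symbols is computed. -/
theorem einstein_transform (he : e ∈ IsManifold.maximalAtlas (𝓡 3) ∞ S)
    (he' : e' ∈ IsManifold.maximalAtlas (𝓡 3) ∞ S) (hx : x ∈ e.source) (hx' : x ∈ e'.source) :
    (Matrix.of fun a b => Coord.einstein (M.g e') a b (atTimeZero (e' x)))
      = (jacobian4 e e' x).transpose
        * (Matrix.of fun a b => Coord.einstein (M.g e) a b (atTimeZero (e x)))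
        * jacobian4 e e' x := by
  have key : ∀ e ∈ IsManifold.maximalAtlas (𝓡 3) ∞ S, x ∈ e.source →
      (Matrix.of fun a b => Coord.einstein (M.g e) a b (atTimeZero (e x)))
        = (κ ^ 2 / (2 * γ)) • T.comp e (atTimeZero (e x)) := by
    intro e he hx
    ext a b
    have h := hGR e he (atTimeZero (e x)) (atTimeZero_mem_chartRegion (e.map_source hx)) a b
    rw [Matrix.of_apply, Matrix.smul_apply, smul_eq_mul]
    field_simp at h ⊢
    linarith
  rw [key e he hx, key e' he' hx', comp_transform T he hx hx', Matrix.mul_smul, Matrix.smul_mul]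

/-- In four dimensions `R` is minus the trace of the Einstein tensor, and that trace is invariant.
-/
theorem isScalarField_scalarCurv : IsScalarField (S := S) fun e => Coord.scalarCurv (M.g e) where
  smooth := fun e he => (M.isStaticOn he).smooth_scalarCurv
  timeIndep := fun e he => (M.isStaticOn he).timeIndep_scalarCurv
  transform := by
    intro e he e' he' x hx hx'
    have key : ∀ e ∈ IsManifold.maximalAtlas (𝓡 3) ∞ S, x ∈ e.source →
        Coord.scalarCurv (M.g e) (atTimeZero (e x)) = - ((M.g e (atTimeZero (e x)))⁻¹
          * (Matrix.of fun a b => Coord.einstein (M.g e) a b (atTimeZero (e x))).transpose).trace := by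
      intro e he hx
      rw [← Coord.sum_inv_mul, ← neg_eq_iff_eq_neg]
      exact ((M.isStaticOn he).trace_einstein
        (atTimeZero_mem_chartRegion (e.map_source hx))).symm
    rw [key e he hx, key e' he' hx', M.einstein_transform hγ hκ hGR he he' hx hx',
      M.g_transform he hx hx', Coord.trace_congruence (isUnit_det_jacobian4 he he' hx hx')]

/-- The Ricci tensor is recovered as the Einstein tensor plus `½ R g`, both of which are already
known to transform. -/
theorem ricci_transform (he : e ∈ IsManifold.maximalAtlas (𝓡 3) ∞ S)
    (he' : e' ∈ IsManifold.maximalAtlas (𝓡 3) ∞ S) (hx : x ∈ e.source) (hx' : x ∈ e'.source) :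
    Coord.ricciMatrix (M.g e') (atTimeZero (e' x))
      = (jacobian4 e e' x).transpose * Coord.ricciMatrix (M.g e) (atTimeZero (e x))
        * jacobian4 e e' x := by
  have key : ∀ e, Coord.ricciMatrix (M.g e) (atTimeZero (e x))
      = (Matrix.of fun a b => Coord.einstein (M.g e) a b (atTimeZero (e x)))
        + ((1 / 2) * Coord.scalarCurv (M.g e) (atTimeZero (e x))) • M.g e (atTimeZero (e x)) := by
    intro e
    ext a b
    simp only [Coord.ricciMatrix, Coord.einstein, Matrix.of_apply, Matrix.add_apply,
      Matrix.smul_apply, smul_eq_mul]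
    ring
  rw [key, key e, M.einstein_transform hγ hκ hGR he he' hx hx', M.g_transform he hx hx',
    (M.isScalarField_scalarCurv hγ hκ hGR).transform e he e' he' x hx hx', Matrix.mul_add,
    Matrix.add_mul, Matrix.mul_smul, Matrix.smul_mul]

theorem isScalarField_ricciSq : IsScalarField (S := S) fun e => Coord.ricciSq (M.g e) where
  smooth := fun e he => by
    have h := M.isStaticOn he
    refine ContDiffOn.sum fun a _ => ContDiffOn.sum fun b _ => ContDiffOn.mul ?_ (h.smooth_ricci a b)
    exact ContDiffOn.sum fun c _ => ContDiffOn.sum fun d _ =>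
      ((h.smooth_inv a c).mul (h.smooth_inv b d)).mul (h.smooth_ricci c d)
  timeIndep := fun e he s p => by
    have h := M.isStaticOn he
    simp only [Coord.ricciSq, Coord.ricciUp, fun a b => h.timeIndep_ricci a b s p,
      fun a b => h.timeIndep_inv a b s p]
  transform := by
    intro e he e' he' x hx hx'
    rw [Coord.ricciSq_eq_trace, Coord.ricciSq_eq_trace, M.ricci_transform hγ hκ hGR he he' hx hx',
      M.g_transform he hx hx', Coord.trace_congruence_sq (isUnit_det_jacobian4 he he' hx hx')]

/-- Changes of static chart leave `∂_t` fixed, so `R_{00}` is invariant, and `e^{-2L} = N⁻²` is a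
function on the slice. -/
theorem isScalarField_ricciEnergy :
    IsScalarField (S := S) fun e => Coord.ricciEnergy (M.g e) (M.logLapse e) where
  smooth := fun e he => (M.isStaticOn he).smooth_ricciEnergy
  timeIndep := fun e he => (M.isStaticOn he).timeIndep_ricciEnergy
  transform := by
    intro e he e' he' x hx hx'
    have h := congrFun (congrFun (M.ricci_transform hγ hκ hGR he he' hx hx') 0) 0
    simp only [Matrix.mul_apply, Matrix.transpose_apply, Fin.sum_univ_succ (n := 3)] at h
    simp [jacobian4, Coord.ricciMatrix] at h
    simp only [Coord.ricciEnergy, logLapse, spatial_atTimeZero, e.left_inv hx, e'.left_inv hx', h]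

theorem isCovectorField_ricci_raise (hξ : IsCovectorField ξ) :
    IsCovectorField (S := S) fun e b p =>
      2 * ∑ c, Coord.ricci (M.g e) b c p * Coord.raise (M.g e) (ξ e) c p where
  smooth := fun e he b => by
    have h := M.isStaticOn he
    exact contDiffOn_const.mul (ContDiffOn.sum fun c _ => (h.smooth_ricci b c).mul
      (h.smooth_raise (hξ.smooth e he) c))
  timeIndep := fun e he b s p => by
    have h := M.isStaticOn he
    simp only [Coord.raise, fun a b => h.timeIndep_ricci a b s p,
      fun a b => h.timeIndep_inv a b s p, fun a => hξ.timeIndep e he a s p]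
  transform := by
    intro e he e' he' x hx hx'
    have key : ∀ e : OpenPartialHomeomorph S E3, (fun b => 2 * ∑ c, Coord.ricci (M.g e) b c (atTimeZero (e x))
        * Coord.raise (M.g e) (ξ e) c (atTimeZero (e x)))
        = (2 : ℝ) • (Coord.ricciMatrix (M.g e) (atTimeZero (e x))).mulVec
          fun a => Coord.raise (M.g e) (ξ e) a (atTimeZero (e x)) := fun e => rfl
    rw [key, key, M.ricci_transform hγ hκ hGR he he' hx hx', ← M.raise_transform hξ he he' hx hx',
      Matrix.mulVec_smul, Matrix.mulVec_mulVec, Matrix.mulVec_mulVec, Matrix.mul_assoc]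

end Einstein

end StaticSpacetime

end Fields

/-! ### Integration by parts in Euclidean space -/

section Euclidean

variable {Ω K : Set E3} {G : E3 → ℝ}

theorem integrableOn_of_eq_zero_off_compact (hΩ : IsOpen Ω) (hK : IsCompact K) (hKΩ : K ⊆ Ω)
    (hG : ContinuousOn G Ω) (h0 : ∀ y ∈ Ω \ K, G y = 0) : IntegrableOn G Ω :=
  ((hG.mono hKΩ).integrableOn_compact hK).of_forall_sdiff_eq_zero hΩ.measurableSet h0

/-- The integral of a partial derivative of a function with compact support vanishes. -/
theorem setIntegral_fderiv_eq_zero (hΩ : IsOpen Ω) (hK : IsCompact K) (hKΩ : K ⊆ Ω)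
    (hG : ContDiffOn ℝ ∞ G Ω) (h0 : ∀ y ∈ Ω \ K, G y = 0) (v : E3) :
    ∫ y in Ω, fderiv ℝ G y v = 0 := by
  -- Extension by zero is smooth on the whole space, because `G` already vanishes between the
  -- compact set `K` and the boundary of `Ω`.
  set H : E3 → ℝ := Ω.indicator G with hH
  have hin : ∀ y ∈ Ω, H =ᶠ[nhds y] G := fun y hy =>
    Filter.eventuallyEq_of_mem (hΩ.mem_nhds hy) fun z hz => Set.indicator_of_mem hz G
  have hz : ∀ y, y ∉ K → H y = 0 := fun y hy => by
    by_cases h : y ∈ Ω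
    · rw [hH, Set.indicator_of_mem h, h0 y ⟨h, hy⟩]
    · exact Set.indicator_of_notMem h G
  have hout : ∀ y ∉ K, H =ᶠ[nhds y] fun _ => 0 := fun y hy =>
    Filter.eventuallyEq_of_mem (hK.isClosed.isOpen_compl.mem_nhds hy) fun z hz' => hz z hz'
  have hsm : ContDiff ℝ ∞ H := contDiff_iff_contDiffAt.2 fun y => by
    by_cases h : y ∈ Ω
    · exact (hG.contDiffAt (hΩ.mem_nhds h)).congr_of_eventuallyEq (hin y h)
    · exact contDiffAt_const.congr_of_eventuallyEq (hout y fun h' => h (hKΩ h'))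
  have hsupp : HasCompactSupport H := HasCompactSupport.intro hK hz
  have hd : Continuous fun y => fderiv ℝ H y v :=
    (hsm.continuous_fderiv (by simp)).clm_apply continuous_const
  have hdsupp : HasCompactSupport fun y => fderiv ℝ H y v :=
    hsupp.fderiv_apply (𝕜 := ℝ) v
  have h1 : ∫ y in Ω, fderiv ℝ G y v = ∫ y in Ω, fderiv ℝ H y v :=
    setIntegral_congr_fun hΩ.measurableSet fun y hy => by
      simp only [(hin y hy).fderiv_eq]
  have h2 : ∫ y in Ω, fderiv ℝ H y v = ∫ y, fderiv ℝ H y v :=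
    setIntegral_eq_integral_of_forall_compl_eq_zero fun y hy => by
      rw [(hout y fun h' => hy (hKΩ h')).fderiv_eq]
      simp
  -- Integration by parts against the constant function one.
  have h3 := integral_mul_fderiv_eq_neg_fderiv_mul_of_integrable (μ := volume) (f := fun _ : E3 => (1 : ℝ))
    (g := H) (v := v) (by simp) (by simpa using hd.integrable_of_hasCompactSupport hdsupp)
    (by simpa using hsm.continuous.integrable_of_hasCompactSupport hsupp)
    (fun _ _ => differentiableAt_const _) (fun y _ => hsm.differentiable (by simp) y)
  rw [h1, h2]
  simpa using h3

end Euclidean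

theorem diffAt_add {S : Type*} [TopologicalSpace S] [ChartedSpace E3 S] {f g : S → ℝ} {x : S}
    (hf : MDifferentiableAt (𝓡 3) 𝓘(ℝ, ℝ) f x) (hg : MDifferentiableAt (𝓡 3) 𝓘(ℝ, ℝ) g x) :
    diffAt (fun z => f z + g z) x = diffAt f x + diffAt g x :=
  (hf.hasMFDerivAt.add hg.hasMFDerivAt).mfderiv

theorem diffAt_sum {S : Type*} [TopologicalSpace S] [ChartedSpace E3 S] {ι : Type*}
    (s : Finset ι) {f : ι → S → ℝ} {x : S} (hf : ∀ i, MDifferentiableAt (𝓡 3) 𝓘(ℝ, ℝ) (f i) x) :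
    diffAt (fun z => ∑ i ∈ s, f i z) x = ∑ i ∈ s, diffAt (f i) x := by
  classical
  suffices h : MDifferentiableAt (𝓡 3) 𝓘(ℝ, ℝ) (fun z => ∑ i ∈ s, f i z) x ∧
      diffAt (fun z => ∑ i ∈ s, f i z) x = ∑ i ∈ s, diffAt (f i) x from h.2
  induction s using Finset.induction_on with
  | empty =>
    simp only [Finset.sum_empty]
    exact ⟨mdifferentiableAt_const, mfderiv_const⟩
  | insert i s hi ih =>
    simp only [Finset.sum_insert hi]
    exact ⟨(hf i).add ih.1, by rw [diffAt_add (hf i) ih.1, ih.2]⟩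

/-! ### The divergence theorem on the slice -/

namespace StaticSpacetime

variable {S : Type*} [TopologicalSpace S] [ChartedSpace E3 S] [IsManifold (𝓡 3) ∞ S]
  (M : StaticSpacetime S) {e e' : OpenPartialHomeomorph S E3}

/-- The integral over a chart domain with respect to the volume `N √h d³x`. -/
noncomputable def chartInt (e : OpenPartialHomeomorph S E3) (F : S → ℝ) : ℝ :=
  ∫ y in e.target, F (e.symm y) * M.density e y

theorem chartInt_congr {F G : S → ℝ} (h : ∀ x ∈ e.source, F x = G x) :
    M.chartInt e F = M.chartInt e G :=
  setIntegral_congr_fun e.open_target.measurableSet fun y hy => by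
    simp only [h _ (e.map_target hy)]

omit [ChartedSpace E3 S] [IsManifold (𝓡 3) ∞ S] in
theorem isCompact_image_chart {K : Set S} (hK : IsCompact K) (hKe : K ⊆ e.source) :
    IsCompact (e '' K) ∧ e '' K ⊆ e.target :=
  ⟨hK.image_of_continuousOn (e.continuousOn.mono hKe), by
    rintro _ ⟨x, hx, rfl⟩; exact e.map_source (hKe hx)⟩

theorem integrableOn_chart (he : e ∈ IsManifold.maximalAtlas (𝓡 3) ∞ S) {F : S → ℝ}
    (hF : Continuous F) {K : Set S} (hK : IsCompact K) (hKe : K ⊆ e.source)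
    (h0 : ∀ x, x ∉ K → F x = 0) :
    IntegrableOn (fun y => F (e.symm y) * M.density e y) e.target := by
  obtain ⟨h1, h2⟩ := isCompact_image_chart hK hKe
  refine integrableOn_of_eq_zero_off_compact e.open_target h1 h2 ?_ fun y hy => ?_
  · exact (hF.comp_continuousOn e.continuousOn_symm).mul (M.contDiffOn_density he).continuousOn
  · rw [h0, zero_mul]
    exact fun h => hy.2 ⟨_, h, e.right_inv hy.1⟩

theorem hComp_transform (he : e ∈ IsManifold.maximalAtlas (𝓡 3) ∞ S) {x : S}
    (hx : x ∈ e.source) (hx' : x ∈ e'.source) :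
    M.hComp e' (e' x) = (jacobian e e' x).transpose * M.hComp e (e x) * jacobian e e' x := by
  ext i j
  simp only [Matrix.mul_apply, Matrix.transpose_apply, hComp_apply, e.left_inv hx,
    e'.left_inv hx', symmDeriv_single_eq_sum he hx (e' := e')]
  simp only [map_sum, sum_apply, map_smul, smul_apply, smul_eq_mul, Finset.sum_mul, Finset.mul_sum]
  exact Finset.sum_congr rfl fun _ _ => Finset.sum_congr rfl fun _ _ => by ring

omit [IsManifold (𝓡 3) ∞ S] in
theorem det_transition (e e' : OpenPartialHomeomorph S E3) (x : S) :
    ((chartDeriv e x).comp (symmDeriv e' (e' x))).det = (jacobian e e' x).det := by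
  rw [ContinuousLinearMap.det, ← LinearMap.det_toMatrix (EuclideanSpace.basisFun (Fin 3) ℝ).toBasis]
  congr 1

theorem density_transform (he : e ∈ IsManifold.maximalAtlas (𝓡 3) ∞ S) {x : S}
    (hx : x ∈ e.source) (hx' : x ∈ e'.source) :
    M.density e' (e' x) = |((chartDeriv e x).comp (symmDeriv e' (e' x))).det| * M.density e (e x) := by
  have h : (M.hComp e' (e' x)).det = (jacobian e e' x).det ^ 2 * (M.hComp e (e x)).det := by
    rw [M.hComp_transform he hx hx', Matrix.det_mul, Matrix.det_mul, Matrix.det_transpose]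
    ring
  rw [density, density, e.left_inv hx, e'.left_inv hx', h, Real.sqrt_mul (sq_nonneg _),
    Real.sqrt_sq_eq_abs, det_transition]
  ring

/-- The integral does not depend on the chart. -/
theorem chartInt_eq (he : e ∈ IsManifold.maximalAtlas (𝓡 3) ∞ S)
    (he' : e' ∈ IsManifold.maximalAtlas (𝓡 3) ∞ S) {F : S → ℝ}
    (h0 : ∀ x, F x ≠ 0 → x ∈ e.source ∧ x ∈ e'.source) : M.chartInt e F = M.chartInt e' F := by
  set O := e.source ∩ e'.source with hO
  have hO' : IsOpen O := e.open_source.inter e'.open_source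
  have hred : ∀ e : OpenPartialHomeomorph S E3, O ⊆ e.source →
      M.chartInt e F = ∫ y in e '' O, F (e.symm y) * M.density e y := by
    intro e hOe
    refine setIntegral_eq_of_subset_of_forall_sdiff_eq_zero e.open_target.measurableSet ?_ ?_
    · rintro _ ⟨x, hx, rfl⟩; exact e.map_source (hOe hx)
    · intro y hy
      by_contra hne
      have hF : F (e.symm y) ≠ 0 := fun h => hne (by rw [h, zero_mul])
      exact hy.2 ⟨_, h0 _ hF, e.right_inv hy.1⟩
  rw [hred e Set.inter_subset_left, hred e' Set.inter_subset_right]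
  have him : e '' O = (fun y => e (e'.symm y)) '' (e' '' O) := by
    rw [Set.image_image]
    exact Set.image_congr fun x hx => by rw [e'.left_inv hx.2]
  have hmeas : MeasurableSet (e' '' O) :=
    (e'.isOpen_image_of_subset_source hO' Set.inter_subset_right).measurableSet
  have hinj : Set.InjOn (fun y => e (e'.symm y)) (e' '' O) := by
    rintro _ ⟨x, hx, rfl⟩ _ ⟨z, hz, rfl⟩ h
    simp only [e'.left_inv hx.2, e'.left_inv hz.2] at h
    rw [e.injOn hx.1 hz.1 h]
  have hder : ∀ y ∈ e' '' O, HasFDerivWithinAt (fun y => e (e'.symm y))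
      ((chartDeriv e (e'.symm y)).comp (symmDeriv e' y)) (e' '' O) y := by
    rintro _ ⟨x, hx, rfl⟩
    rw [e'.left_inv hx.2]
    exact (hasFDerivAt_transition he he' hx.1 hx.2).hasFDerivWithinAt
  -- The Jacobian factor of the change of variables is exactly the one by which `density_transform`
  -- relates the two densities.
  rw [him, integral_image_eq_integral_abs_det_fderiv_smul volume hmeas hder hinj]
  refine setIntegral_congr_fun hmeas ?_
  rintro _ ⟨x, hx, rfl⟩
  simp only [e'.left_inv hx.2, e.left_inv hx.1, smul_eq_mul,
    M.density_transform he hx.1 hx.2]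
  ring

/-- The vector field `X`, with components `V e` in the chart `e`, has the divergence `f` with
respect to the volume `N √h d³x`. -/
structure HasDivergence (V : OpenPartialHomeomorph S E3 → E3 → Fin 3 → ℝ) (X : S → E3)
    (f : S → ℝ) : Prop where
  smooth : ∀ e ∈ IsManifold.maximalAtlas (𝓡 3) ∞ S, ∀ i,
    ContDiffOn ℝ ∞ (fun y => V e y i) e.target
  vector_eq : ∀ e ∈ IsManifold.maximalAtlas (𝓡 3) ∞ S, ∀ x ∈ e.source,
    X x = ∑ i, V e (e x) i • symmDeriv e (e x) (EuclideanSpace.single i 1)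
  div : ∀ e ∈ IsManifold.maximalAtlas (𝓡 3) ∞ S, ∀ y ∈ e.target,
    ∑ i, fderiv ℝ (fun z => M.density e z * V e z i) y (EuclideanSpace.single i 1)
      = M.density e y * f (e.symm y)
  contMDiff : ContMDiff (𝓡 3) 𝓘(ℝ, ℝ) ∞ f

namespace HasDivergence

variable {M} {V : OpenPartialHomeomorph S E3 → E3 → Fin 3 → ℝ} {X : S → E3} {f : S → ℝ}
  (hV : M.HasDivergence V X f)
include hV

theorem diffAt_apply (he : e ∈ IsManifold.maximalAtlas (𝓡 3) ∞ S) {φ : S → ℝ}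
    (hφ : ContMDiff (𝓡 3) 𝓘(ℝ, ℝ) ∞ φ) {x : S} (hx : x ∈ e.source) :
    diffAt φ x (X x) = ∑ i, V e (e x) i
      * fderiv ℝ (fun y => φ (e.symm y)) (e x) (EuclideanSpace.single i 1) := by
  simp only [fderiv_comp_symm he hx (hφ.mdifferentiable (by simp) x), hV.vector_eq e he x hx,
    map_sum, map_smul, smul_eq_mul]

theorem contMDiff_diffAt {φ : S → ℝ} (hφ : ContMDiff (𝓡 3) 𝓘(ℝ, ℝ) ∞ φ) :
    ContMDiff (𝓡 3) 𝓘(ℝ, ℝ) ∞ (fun x => diffAt φ x (X x)) := by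
  refine contMDiff_of_contDiffOn fun e he => ?_
  have h : ContDiffOn ℝ ∞ (fun y => ∑ i, V e y i
      * fderiv ℝ (fun y => φ (e.symm y)) y (EuclideanSpace.single i 1)) e.target :=
    ContDiffOn.sum fun i _ => (hV.smooth e he i).mul
      (((contDiffOn_comp_symm he hφ).fderiv_of_isOpen e.open_target (m := ∞) (by simp)).clm_apply
        contDiffOn_const)
  refine h.congr fun y hy => ?_
  rw [hV.diffAt_apply he hφ (e.map_target hy), e.right_inv hy]

/-- The divergence theorem in a single chart: the coordinate divergence of the compactly supported
field `φ V`, weighted by the density, has zero integral, and the Leibniz rule splits it into the two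
sides. -/
theorem chartInt_mul (he : e ∈ IsManifold.maximalAtlas (𝓡 3) ∞ S) {φ : S → ℝ}
    (hφ : ContMDiff (𝓡 3) 𝓘(ℝ, ℝ) ∞ φ) (hc : HasCompactSupport φ) (hs : tsupport φ ⊆ e.source) :
    M.chartInt e (fun x => φ x * f x) = - M.chartInt e (fun x => diffAt φ x (X x)) := by
  obtain ⟨hK, hKe⟩ := isCompact_image_chart hc.isCompact hs
  have hφe := contDiffOn_comp_symm he hφ
  have hd := M.contDiffOn_density he
  have hzero : ∀ x, x ∉ tsupport φ → φ x = 0 := fun x hx => image_eq_zero_of_notMem_tsupport hx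
  have hG : ∀ i, ContDiffOn ℝ ∞ (fun y => (M.density e y * V e y i) * φ (e.symm y)) e.target :=
    fun i => (hd.mul (hV.smooth e he i)).mul hφe
  have hG0 : ∀ i, ∀ y ∈ e.target \ e '' tsupport φ,
      (M.density e y * V e y i) * φ (e.symm y) = 0 := fun i y hy => by
    rw [hzero, mul_zero]
    exact fun h => hy.2 ⟨_, h, e.right_inv hy.1⟩
  have hdiff : ∀ {F : E3 → ℝ}, ContDiffOn ℝ ∞ F e.target → ∀ y ∈ e.target,
      DifferentiableAt ℝ F y := fun hF y hy =>
    (hF.contDiffAt (e.open_target.mem_nhds hy)).differentiableAt (by simp)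
  have key : ∀ y ∈ e.target,
      ∑ i, fderiv ℝ (fun y => (M.density e y * V e y i) * φ (e.symm y)) y
        (EuclideanSpace.single i 1)
      = φ (e.symm y) * f (e.symm y) * M.density e y
        + diffAt φ (e.symm y) (X (e.symm y)) * M.density e y := by
    intro y hy
    have h1 := hV.diffAt_apply he hφ (e.map_target hy)
    have h2 := hV.div e he y hy
    rw [e.right_inv hy] at h1
    rw [h1, show φ (e.symm y) * f (e.symm y) * M.density e y
      = M.density e y * f (e.symm y) * φ (e.symm y) by ring, ← h2,
      Finset.sum_mul, Finset.sum_mul, ← Finset.sum_add_distrib]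
    refine Finset.sum_congr rfl fun i _ => ?_
    rw [fderiv_fun_mul (hdiff (hd.mul (hV.smooth e he i)) y hy) (hdiff hφe y hy)]
    simp only [add_apply, smul_apply, smul_eq_mul]
    ring
  have hsum : ∫ y in e.target, ∑ i, fderiv ℝ
      (fun y => (M.density e y * V e y i) * φ (e.symm y)) y (EuclideanSpace.single i 1) = 0 := by
    rw [integral_finsetSum]
    · exact Finset.sum_eq_zero fun i _ =>
        setIntegral_fderiv_eq_zero e.open_target hK hKe (hG i) (hG0 i) _
    · intro i _
      refine integrableOn_of_eq_zero_off_compact e.open_target hK hKe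
        (((hG i).fderiv_of_isOpen e.open_target (m := ∞) (by simp)).clm_apply
          contDiffOn_const).continuousOn fun y hy => ?_
      have : (fun y => (M.density e y * V e y i) * φ (e.symm y)) =ᶠ[nhds y] fun _ => 0 :=
        Filter.eventuallyEq_of_mem ((e.open_target.inter hK.isClosed.isOpen_compl).mem_nhds hy)
          fun z hz => hG0 i z hz
      rw [this.fderiv_eq]
      simp
  rw [setIntegral_congr_fun e.open_target.measurableSet key, integral_add] at hsum
  · exact eq_neg_of_add_eq_zero_left hsum
  · exact M.integrableOn_chart he (F := fun x => φ x * f x)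
      (hφ.continuous.mul hV.contMDiff.continuous) hc.isCompact hs fun x hx => by
        simp [hzero x hx]
  · refine M.integrableOn_chart he (F := fun x => diffAt φ x (X x))
      (hV.contMDiff_diffAt hφ).continuous hc.isCompact hs fun x hx => ?_
    have : φ =ᶠ[nhds x] fun _ => 0 := notMem_tsupport_iff_eventuallyEq.mp hx
    rw [diffAt, this.mfderiv_eq, mfderiv_const]
    rfl

/-- The main estimate: the part of the divergence near a point is controlled by the flux of the
vector field through the region where a cutoff `χ` varies. -/
theorem chartInt_le_flux [T2Space S] [SigmaCompactSpace S] {c : ℝ} {h : S → ℝ}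
    (hf : ∀ x, f x = c * h x) (hh : ∀ x, 0 ≤ h x) (hhc : Continuous h)
    {χ : S → ℝ} (hχ : ContMDiff (𝓡 3) 𝓘(ℝ, ℝ) ∞ χ)
    (hχc : HasCompactSupport χ)
    {Φ : OpenPartialHomeomorph S E3} (hΦ : Φ ∈ IsManifold.maximalAtlas (𝓡 3) ∞ S)
    {K : Set S} (hK : IsCompact K) (hKΦ : K ⊆ Φ.source) (hχK : ∀ x, x ∉ K → diffAt χ x = 0)
    (he : e ∈ IsManifold.maximalAtlas (𝓡 3) ∞ S) {θ : S → ℝ} (hθ : Continuous θ)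
    (hθc : HasCompactSupport θ) (hθe : tsupport θ ⊆ e.source)
    (hθχ : ∀ x, θ x ≤ χ x) (hθ0 : ∀ x, 0 ≤ θ x) :
    |c| * M.chartInt e (fun x => θ x * h x) ≤ |M.chartInt Φ (fun x => diffAt χ x (X x))| := by
  classical
  -- Compactness of the support of `χ` reduces to finitely many charts, so that the partition of
  -- unity is indexed by a finite type and all sums are finite.
  obtain ⟨s, hs⟩ := hχc.isCompact.elim_finite_subcover (fun x : S => (chartAt E3 x).source)
    (fun x => (chartAt E3 x).open_source) fun x _ => Set.mem_iUnion.2 ⟨x, mem_chart_source E3 x⟩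
  obtain ⟨ψ, hψ⟩ := SmoothPartitionOfUnity.exists_isSubordinate (𝓡 3) (isClosed_tsupport χ)
    (fun i : s => (chartAt E3 (i : S)).source) (fun i => (chartAt E3 (i : S)).open_source)
    (fun x hx => by
      obtain ⟨i, hi, hxi⟩ := Set.mem_iUnion₂.1 (hs hx)
      exact Set.mem_iUnion.2 ⟨⟨i, hi⟩, hxi⟩)
  let E : s → OpenPartialHomeomorph S E3 := fun i => chartAt E3 (i : S)
  have hE : ∀ i, E i ∈ IsManifold.maximalAtlas (𝓡 3) ∞ S := fun i =>
    IsManifold.chart_mem_maximalAtlas (i : S)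
  have hψs : ∀ i, tsupport (ψ i) ⊆ (E i).source := hψ
  have hψ1 : ∀ x ∈ tsupport χ, ∑ i, ψ i x = 1 := fun x hx => by
    rw [← ψ.sum_eq_one hx, finsum_eq_sum_of_fintype]
  have hψsm : ∀ i, ContMDiff (𝓡 3) 𝓘(ℝ, ℝ) ∞ (ψ i) := fun i => (ψ i).contMDiff
  have hχz : ∀ x, x ∉ tsupport χ → χ x = 0 := fun x hx => image_eq_zero_of_notMem_tsupport hx
  have hmem : ∀ i x, ψ i x ≠ 0 → x ∈ (E i).source := fun i x hx =>
    hψs i (subset_tsupport _ hx)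
  have hdmem : ∀ (φ : S → ℝ) x, diffAt φ x ≠ 0 → x ∈ tsupport φ := fun φ x hx => by
    by_contra hx'
    have : φ =ᶠ[nhds x] fun _ => 0 := notMem_tsupport_iff_eventuallyEq.mp hx'
    exact hx (by rw [diffAt, this.mfderiv_eq, mfderiv_const]; rfl)
  -- integrals of functions supported in a chart
  have hint : ∀ i (F : S → ℝ), Continuous F → (∀ x, x ∉ tsupport χ ∩ tsupport (ψ i) → F x = 0) →
      IntegrableOn (fun y => F ((E i).symm y) * M.density (E i) y) (E i).target := fun i F hF h0 =>
    M.integrableOn_chart (hE i) hF (hχc.isCompact.inter_right (isClosed_tsupport _))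
      (fun x hx => hψs i hx.2) h0
  -- An integral supported in one chart is redistributed over the charts of the partition: each `ψ i
  -- * F` lives in both charts, so its integral may be moved, and the `ψ i` sum to one wherever `F`
  -- is nonzero.
  have hglue : ∀ e ∈ IsManifold.maximalAtlas (𝓡 3) ∞ S, ∀ (F : S → ℝ), Continuous F →
      ∀ K : Set S, IsCompact K → K ⊆ e.source → (∀ x, x ∉ K → F x = 0) →
      (∀ x, F x ≠ 0 → x ∈ tsupport χ) →
      ∑ i, M.chartInt (E i) (fun x => ψ i x * F x) = M.chartInt e F := by
    intro e he F hF K hK hKe hFK hFχ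
    have h1 : ∀ i, M.chartInt (E i) (fun x => ψ i x * F x) = M.chartInt e (fun x => ψ i x * F x) :=
      fun i => M.chartInt_eq (hE i) he fun x hx => ⟨hmem i x (left_ne_zero_of_mul hx),
        hKe (by by_contra hx'; exact right_ne_zero_of_mul hx (hFK x hx'))⟩
    simp only [h1]
    rw [chartInt, ← show _ = ∑ i, M.chartInt e (fun x => ψ i x * F x) from
      integral_finsetSum (μ := volume.restrict e.target) Finset.univ
        (f := fun i y => (ψ i (e.symm y) * F (e.symm y)) * M.density e y) fun i _ =>
        M.integrableOn_chart he (F := fun x => ψ i x * F x) ((hψsm i).continuous.mul hF) hK hKe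
          fun x hx => by rw [hFK x hx, mul_zero]]
    refine setIntegral_congr_fun e.open_target.measurableSet fun y _ => ?_
    simp only [← Finset.sum_mul]
    by_cases hy : F (e.symm y) = 0
    · simp [hy]
    · rw [hψ1 _ (hFχ _ hy), one_mul]
  have hθz : ∀ x, x ∉ tsupport θ → θ x = 0 := fun x hx => image_eq_zero_of_notMem_tsupport hx
  -- the divergence theorem
  have hdχ := (hV.contMDiff_diffAt hχ).continuous
  have hdψ : ∀ i, Continuous fun x => diffAt (ψ i) x (X x) := fun i =>
    (hV.contMDiff_diffAt (hψsm i)).continuous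
  -- Where `χ` is nonzero the `ψ i` sum to one on a neighbourhood, so their differentials sum to
  -- zero.
  have hsum0 : ∀ x, χ x * ∑ i, diffAt (ψ i) x (X x) = 0 := by
    intro x
    by_cases hx : χ x = 0
    · rw [hx, zero_mul]
    · have hev : (fun z => ∑ i, ψ i z) =ᶠ[nhds x] fun _ => 1 :=
        Filter.eventuallyEq_of_mem ((isOpen_ne_fun hχ.continuous continuous_const).mem_nhds hx)
          fun z hz => hψ1 z (subset_tsupport _ hz)
      have h1 : diffAt (fun z => ∑ i, ψ i z) x = ∑ i, diffAt (ψ i) x :=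
        diffAt_sum Finset.univ fun i => (hψsm i).mdifferentiable (by simp) x
      have h2 : diffAt (fun z => ∑ i, ψ i z) x = 0 := by
        rw [diffAt, hev.mfderiv_eq, mfderiv_const]; rfl
      rw [← sum_apply, ← h1, h2]
      simp
  have hstokes : ∑ i, M.chartInt (E i) (fun x => ψ i x * (χ x * f x))
      = - ∑ i, M.chartInt (E i) (fun x => ψ i x * diffAt χ x (X x)) := by
    have h1 : ∀ i, M.chartInt (E i) (fun x => ψ i x * (χ x * f x))
        = - M.chartInt (E i) (fun x => ψ i x * diffAt χ x (X x))
          - M.chartInt (E i) (fun x => χ x * diffAt (ψ i) x (X x)) := by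
      intro i
      have hcs : HasCompactSupport fun x => ψ i x * χ x := hχc.mul_left
      have hts : tsupport (fun x => ψ i x * χ x) ⊆ (E i).source :=
        (tsupport_mul_subset_left).trans (hψs i)
      have h2 := hV.chartInt_mul (hE i) ((hψsm i).mul hχ) hcs hts
      have h3 : ∀ x, diffAt (fun x => ψ i x * χ x) x (X x)
          = ψ i x * diffAt χ x (X x) + χ x * diffAt (ψ i) x (X x) := fun x => by
        have := (((hψsm i).mdifferentiable (by simp) x).hasMFDerivAt.mul
          (hχ.mdifferentiable (by simp) x).hasMFDerivAt).mfderiv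
        exact congrArg (fun A : E3 →L[ℝ] ℝ => A (X x)) this
      have h4 : M.chartInt (E i) (fun x => diffAt (fun x => ψ i x * χ x) x (X x))
          = M.chartInt (E i) (fun x => ψ i x * diffAt χ x (X x))
            + M.chartInt (E i) (fun x => χ x * diffAt (ψ i) x (X x)) := by
        simp only [h3, chartInt, add_mul]
        refine integral_add (hint i (fun x => ψ i x * diffAt χ x (X x))
          ((hψsm i).continuous.mul hdχ) fun x hx => ?_)
          (hint i (fun x => χ x * diffAt (ψ i) x (X x)) (hχ.continuous.mul (hdψ i)) fun x hx => ?_)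
        · by_contra hne
          refine hx ⟨hdmem χ x fun h0 => ?_, subset_tsupport _ (left_ne_zero_of_mul hne)⟩
          exact right_ne_zero_of_mul hne (by rw [h0]; rfl)
        · by_contra hne
          refine hx ⟨subset_tsupport _ (left_ne_zero_of_mul hne), hdmem (ψ i) x fun h0 => ?_⟩
          exact right_ne_zero_of_mul hne (by rw [h0]; rfl)
      have h5 : M.chartInt (E i) (fun x => ψ i x * (χ x * f x))
          = M.chartInt (E i) (fun x => (ψ i * χ) x * f x) :=
        M.chartInt_congr fun x _ => (mul_assoc _ _ _).symm
      rw [h5, h2]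
      change - M.chartInt (E i) (fun x => diffAt (fun x => ψ i x * χ x) x (X x)) = _
      rw [h4]
      ring
    -- These terms live in different charts. Redistributing each over the partition and exchanging
    -- the sums brings them into a common chart, where `hsum0` applies.
    have h2 : ∑ i, M.chartInt (E i) (fun x => χ x * diffAt (ψ i) x (X x)) = 0 := by
      have h3 : ∀ i, M.chartInt (E i) (fun x => χ x * diffAt (ψ i) x (X x))
          = ∑ j, M.chartInt (E j) (fun x => ψ j x * (χ x * diffAt (ψ i) x (X x))) := fun i =>
        (hglue _ (hE i) (fun x => χ x * diffAt (ψ i) x (X x)) (hχ.continuous.mul (hdψ i))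
          (tsupport χ ∩ tsupport (ψ i)) (hχc.isCompact.inter_right (isClosed_tsupport _))
          (fun x hx => hψs i hx.2)
          (fun x hx => by
            by_contra hne
            refine hx ⟨subset_tsupport _ (left_ne_zero_of_mul hne), hdmem (ψ i) x fun h0 => ?_⟩
            exact right_ne_zero_of_mul hne (by rw [h0]; rfl))
          fun x hx => subset_tsupport _ (left_ne_zero_of_mul hx)).symm
      simp only [h3]
      rw [Finset.sum_comm]
      refine Finset.sum_eq_zero fun j _ => ?_
      rw [← show _ = ∑ i, M.chartInt (E j) (fun x => ψ j x * (χ x * diffAt (ψ i) x (X x))) from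
        integral_finsetSum (μ := volume.restrict (E j).target) Finset.univ
        (f := fun i y => (ψ j ((E j).symm y) * (χ ((E j).symm y)
          * diffAt (ψ i) ((E j).symm y) (X ((E j).symm y)))) * M.density (E j) y) fun i _ =>
        hint j (fun x => ψ j x * (χ x * diffAt (ψ i) x (X x)))
          ((hψsm j).continuous.mul (hχ.continuous.mul (hdψ i))) fun x hx => by
            by_contra hne
            exact hx ⟨subset_tsupport _ (left_ne_zero_of_mul (right_ne_zero_of_mul hne)),
              subset_tsupport _ (left_ne_zero_of_mul hne)⟩]
      simp only [← Finset.sum_mul, ← Finset.mul_sum, hsum0, mul_zero, zero_mul, integral_zero]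
    simp only [h1, Finset.sum_sub_distrib, Finset.sum_neg_distrib, h2, sub_zero]
  -- The differential of `χ` is supported in the single chart `Φ`, so the right side collapses to
  -- one integral there.
  rw [hglue Φ hΦ (fun x => diffAt χ x (X x)) hdχ K hK hKΦ (fun x hx => by rw [hχK x hx]; rfl)
    fun x hx => hdmem χ x fun h0 => hx (by rw [h0]; rfl)] at hstokes
  have hpull : ∑ i, M.chartInt (E i) (fun x => ψ i x * (χ x * f x))
      = c * ∑ i, M.chartInt (E i) (fun x => ψ i x * (χ x * h x)) := by
    rw [Finset.mul_sum]
    refine Finset.sum_congr rfl fun i _ => ?_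
    rw [chartInt, chartInt, ← integral_const_mul]
    refine setIntegral_congr_fun (E i).open_target.measurableSet fun y _ => ?_
    simp only [hf]; ring
  rw [hpull] at hstokes
  have hθint := hglue e he (fun x => θ x * h x) (hθ.mul hhc) (tsupport θ) hθc.isCompact hθe
    (fun x hx => by rw [hθz x hx, zero_mul]) fun x hx => subset_tsupport _ fun h0 =>
      left_ne_zero_of_mul hx (le_antisymm ((hθχ x).trans h0.le) (hθ0 x))
  -- The only use of the sign of `h`: a bump function below `χ` bounds the global integral from
  -- below by a local one.
  have hmono : M.chartInt e (fun x => θ x * h x)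
      ≤ ∑ i, M.chartInt (E i) (fun x => ψ i x * (χ x * h x)) := by
    rw [← hθint]
    refine Finset.sum_le_sum fun i _ => ?_
    refine setIntegral_mono_on (hint i (fun x => ψ i x * (θ x * h x))
      ((hψsm i).continuous.mul (hθ.mul hhc)) fun x hx => ?_)
      (hint i (fun x => ψ i x * (χ x * h x))
      ((hψsm i).continuous.mul (hχ.continuous.mul hhc)) fun x hx => ?_)
      (E i).open_target.measurableSet fun y hy => ?_
    · by_contra hne
      refine hx ⟨subset_tsupport _ fun h0 => ?_, subset_tsupport _ (left_ne_zero_of_mul hne)⟩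
      exact left_ne_zero_of_mul (right_ne_zero_of_mul hne)
        (le_antisymm ((hθχ x).trans h0.le) (hθ0 x))
    · by_contra hne
      exact hx ⟨subset_tsupport _ (left_ne_zero_of_mul (right_ne_zero_of_mul hne)),
        subset_tsupport _ (left_ne_zero_of_mul hne)⟩
    · exact mul_le_mul_of_nonneg_right (mul_le_mul_of_nonneg_left
        (mul_le_mul_of_nonneg_right (hθχ _) (hh _)) (ψ.nonneg i _)) (M.density_pos (hE i) hy).le
  calc |c| * M.chartInt e (fun x => θ x * h x)
      ≤ |c| * ∑ i, M.chartInt (E i) (fun x => ψ i x * (χ x * h x)) :=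
        mul_le_mul_of_nonneg_left hmono (abs_nonneg c)
    _ ≤ |c| * |∑ i, M.chartInt (E i) (fun x => ψ i x * (χ x * h x))| :=
        mul_le_mul_of_nonneg_left (le_abs_self _) (abs_nonneg c)
    _ = _ := by rw [← abs_mul, hstokes, abs_neg]

end HasDivergence

end StaticSpacetime

/-! ### Cutoffs and decay at infinity -/

section Cutoff

/-- A smooth function that is one on the unit ball and zero outside the ball of radius two. -/
noncomputable def unitBump : ContDiffBump (0 : E3) := ⟨1, 2, one_pos, one_lt_two⟩

/-- The cutoff `η(y / R)`. -/
noncomputable def scaledBump (R : ℝ) (y : E3) : ℝ := unitBump (R⁻¹ • y)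

theorem contDiff_scaledBump (R : ℝ) : ContDiff ℝ ∞ (scaledBump R) :=
  unitBump.contDiff.comp (contDiff_const_smul _)

theorem scaledBump_eq_one {R : ℝ} (hR : 0 < R) {y : E3} (hy : ‖y‖ ≤ R) : scaledBump R y = 1 := by
  refine unitBump.one_of_mem_closedBall ?_
  rw [mem_closedBall_zero_iff, norm_smul, norm_inv, Real.norm_of_nonneg hR.le]
  exact (inv_mul_le_one₀ hR).2 hy

theorem scaledBump_eq_zero {R : ℝ} (hR : 0 < R) {y : E3} (hy : 2 * R ≤ ‖y‖) :
    scaledBump R y = 0 := by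
  refine unitBump.zero_of_le_dist ?_
  rw [dist_zero_right, norm_smul, norm_inv, Real.norm_of_nonneg hR.le]
  change 2 ≤ _
  rw [inv_mul_eq_div, le_div_iff₀ hR]
  exact hy

theorem scaledBump_nonneg (R : ℝ) (y : E3) : 0 ≤ scaledBump R y := unitBump.nonneg

theorem fderiv_comp_inv_smul (f : E3 → ℝ) (R : ℝ) (y v : E3) :
    fderiv ℝ (fun z => f (R⁻¹ • z)) y v = R⁻¹ * fderiv ℝ f (R⁻¹ • y) v := by
  rw [fderiv_comp_smul]
  rfl

/-- The partial derivatives of the cutoff. -/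
noncomputable def dBump (R : ℝ) (i : Fin 3) (y : E3) : ℝ :=
  fderiv ℝ (scaledBump R) y (EuclideanSpace.single i 1)

/-- The second partial derivatives of the cutoff. -/
noncomputable def ddBump (R : ℝ) (i j : Fin 3) (y : E3) : ℝ :=
  fderiv ℝ (dBump R j) y (EuclideanSpace.single i 1)

theorem contDiff_fderiv_apply {f : E3 → ℝ} (hf : ContDiff ℝ ∞ f) (v : E3) :
    ContDiff ℝ ∞ fun y => fderiv ℝ f y v :=
  (hf.fderiv_right (m := ∞) (by simp)).clm_apply contDiff_const

theorem contDiff_dBump (R : ℝ) (i : Fin 3) : ContDiff ℝ ∞ (dBump R i) :=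
  contDiff_fderiv_apply (contDiff_scaledBump R) _

theorem contDiff_ddBump (R : ℝ) (i j : Fin 3) : ContDiff ℝ ∞ (ddBump R i j) :=
  contDiff_fderiv_apply (contDiff_dBump R j) _

theorem dBump_eq (R : ℝ) (i : Fin 3) (y : E3) :
    dBump R i y = R⁻¹ * fderiv ℝ unitBump (R⁻¹ • y) (EuclideanSpace.single i 1) :=
  fderiv_comp_inv_smul unitBump R y _

theorem ddBump_eq (R : ℝ) (i j : Fin 3) (y : E3) :
    ddBump R i j y = R⁻¹ * (R⁻¹ * fderiv ℝ (fun z => fderiv ℝ unitBump z (EuclideanSpace.single j 1))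
      (R⁻¹ • y) (EuclideanSpace.single i 1)) := by
  rw [ddBump, show dBump R j = fun z => R⁻¹ * (fun z => fderiv ℝ unitBump z
    (EuclideanSpace.single j 1)) (R⁻¹ • z) from funext (dBump_eq R j), fderiv_const_mul]
  · exact congrArg (R⁻¹ * ·) (fderiv_comp_inv_smul
      (fun z => fderiv ℝ unitBump z (EuclideanSpace.single j 1)) R y _)
  · exact ((contDiff_fderiv_apply unitBump.contDiff _).comp (contDiff_const_smul _)).differentiable
      (by simp) y

/-- Scaling: each derivative of `η(y / R)` costs a factor `R⁻¹`. The constant is the sum of the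
bounds for all first and second partial derivatives of the fixed bump. -/
theorem exists_bound_bump : ∃ B : ℝ, ∀ R > 0, ∀ y, (∀ i, |dBump R i y| ≤ B * R⁻¹) ∧
    ∀ i j, |ddBump R i j y| ≤ B * (R⁻¹ * R⁻¹) := by
  have hη : ContDiff ℝ ∞ unitBump := unitBump.contDiff
  have h1 : ∀ i : Fin 3, ∃ C, ∀ y, ‖fderiv ℝ unitBump y (EuclideanSpace.single i 1)‖ ≤ C := fun i =>
    (contDiff_fderiv_apply hη _).continuous.bounded_above_of_compact_support
      (unitBump.hasCompactSupport.fderiv_apply (𝕜 := ℝ) _)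
  have h2 : ∀ i j : Fin 3, ∃ C, ∀ y, ‖fderiv ℝ (fun z => fderiv ℝ unitBump z
      (EuclideanSpace.single j 1)) y (EuclideanSpace.single i 1)‖ ≤ C := fun i j =>
    (contDiff_fderiv_apply (contDiff_fderiv_apply hη _) _).continuous.bounded_above_of_compact_support
      ((unitBump.hasCompactSupport.fderiv_apply (𝕜 := ℝ) _).fderiv_apply (𝕜 := ℝ) _)
  choose C1 hC1 using h1
  choose C2 hC2 using h2
  have p1 : ∀ i, 0 ≤ C1 i := fun i => (norm_nonneg _).trans (hC1 i 0)
  have p2 : ∀ i j, 0 ≤ C2 i j := fun i j => (norm_nonneg _).trans (hC2 i j 0)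
  have q1 : ∀ i, C1 i ≤ ∑ i, C1 i + ∑ i, ∑ j, C2 i j := fun i =>
    (Finset.single_le_sum (fun i _ => p1 i) (Finset.mem_univ i)).trans
      (le_add_of_nonneg_right (Finset.sum_nonneg fun i _ => Finset.sum_nonneg fun j _ => p2 i j))
  have q2 : ∀ i j, C2 i j ≤ ∑ i, C1 i + ∑ i, ∑ j, C2 i j := fun i j =>
    ((Finset.single_le_sum (fun j _ => p2 i j) (Finset.mem_univ j)).trans
      (Finset.single_le_sum (f := fun i => ∑ j, C2 i j)
        (fun i _ => Finset.sum_nonneg fun j _ => p2 i j) (Finset.mem_univ i))).trans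
      (le_add_of_nonneg_left (Finset.sum_nonneg fun i _ => p1 i))
  refine ⟨∑ i, C1 i + ∑ i, ∑ j, C2 i j, fun R hR y => ⟨fun i => ?_, fun i j => ?_⟩⟩
  · rw [dBump_eq, abs_mul, abs_of_pos (inv_pos.2 hR), mul_comm]
    exact mul_le_mul_of_nonneg_right ((hC1 i _).trans (q1 i)) (inv_pos.2 hR).le
  · rw [ddBump_eq, ← mul_assoc, abs_mul, abs_of_pos (mul_pos (inv_pos.2 hR) (inv_pos.2 hR)), mul_comm]
    exact mul_le_mul_of_nonneg_right ((hC2 i j _).trans (q2 i j))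
      (mul_pos (inv_pos.2 hR) (inv_pos.2 hR)).le

theorem dBump_eq_zero {R : ℝ} (hR : 0 < R) {y : E3} (hy : ‖y‖ < R ∨ 2 * R < ‖y‖) (i : Fin 3) :
    dBump R i y = 0 := by
  have h : ∃ c : ℝ, scaledBump R =ᶠ[nhds y] fun _ => c := by
    rcases hy with hy | hy
    · exact ⟨1, Filter.eventuallyEq_of_mem ((isOpen_lt continuous_norm continuous_const).mem_nhds hy)
        fun z hz => scaledBump_eq_one hR (le_of_lt hz)⟩
    · exact ⟨0, Filter.eventuallyEq_of_mem ((isOpen_lt continuous_const continuous_norm).mem_nhds hy)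
        fun z hz => scaledBump_eq_zero hR (le_of_lt hz)⟩
  obtain ⟨c, hc⟩ := h
  rw [dBump, hc.fderiv_eq]
  simp

theorem ddBump_eq_zero {R : ℝ} (hR : 0 < R) {y : E3} (hy : ‖y‖ < R ∨ 2 * R < ‖y‖) (i j : Fin 3) :
    ddBump R i j y = 0 := by
  have h : dBump R j =ᶠ[nhds y] fun _ => 0 :=
    Filter.eventuallyEq_of_mem (((isOpen_lt continuous_norm continuous_const).union
      (isOpen_lt continuous_const continuous_norm)).mem_nhds hy) fun z hz => dBump_eq_zero hR hz j
  rw [ddBump, h.fderiv_eq]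
  simp

/-- The annulus in which the cutoff varies. -/
def annulus (R : ℝ) : Set E3 := {y | R ≤ ‖y‖ ∧ ‖y‖ ≤ 2 * R}

theorem isCompact_annulus (R : ℝ) : IsCompact (annulus R) := by
  refine (isCompact_closedBall (0 : E3) (2 * R)).of_isClosed_subset
    ((isClosed_le continuous_const continuous_norm).inter
      (isClosed_le continuous_norm continuous_const)) fun y hy => ?_
  rw [mem_closedBall_zero_iff]
  exact hy.2

theorem of_notMem_annulus {R : ℝ} {y : E3} (hy : y ∉ annulus R) : ‖y‖ < R ∨ 2 * R < ‖y‖ := by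
  by_contra! h
  exact hy h

/-- `f = O(‖y‖⁻ᵏ)` at infinity. -/
def Decays (k : ℕ) (f : E3 → ℝ) : Prop :=
  f =O[Bornology.cobounded E3] fun y => (‖y‖⁻¹) ^ k

theorem eventually_large (R : ℝ) : ∀ᶠ y in Bornology.cobounded E3, R < ‖y‖ :=
  tendsto_norm_cobounded_atTop.eventually_gt_atTop R

namespace Decays

variable {k l : ℕ} {f g : E3 → ℝ}

theorem mono (hf : Decays k f) (h : l ≤ k) : Decays l f := by
  refine hf.trans (Asymptotics.IsBigO.of_bound 1 ?_)
  filter_upwards [eventually_large 1] with y hy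
  rw [one_mul, norm_pow, norm_pow, norm_inv, norm_norm]
  exact pow_le_pow_of_le_one (by positivity) (inv_le_one_of_one_le₀ hy.le) h

theorem add (hf : Decays k f) (hg : Decays k g) : Decays k fun y => f y + g y :=
  Asymptotics.IsBigO.add hf hg

theorem sub (hf : Decays k f) (hg : Decays k g) : Decays k fun y => f y - g y :=
  Asymptotics.IsBigO.sub hf hg

theorem neg (hf : Decays k f) : Decays k fun y => - f y := hf.neg_left

theorem mul (hf : Decays k f) (hg : Decays l g) : Decays (k + l) fun y => f y * g y := by
  have h : (fun y : E3 => (‖y‖⁻¹) ^ (k + l)) = fun y => (‖y‖⁻¹) ^ k * (‖y‖⁻¹) ^ l :=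
    funext fun y => pow_add _ _ _
  rw [Decays, h]
  exact Asymptotics.IsBigO.mul hf hg

theorem const_mul (hf : Decays k f) (c : ℝ) : Decays k fun y => c * f y := hf.const_mul_left c

theorem sum {ι : Type*} [Fintype ι] {f : ι → E3 → ℝ} (hf : ∀ i, Decays k (f i)) :
    Decays k fun y => ∑ i, f i y :=
  Asymptotics.IsBigO.fun_sum fun i _ => hf i

theorem exists_bound (hf : Decays k f) :
    ∃ C ≥ 0, ∃ R₀ > 0, ∀ R ≥ R₀, ∀ y, R ≤ ‖y‖ → |f y| ≤ C * (R⁻¹) ^ k := by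
  obtain ⟨C, hC0, hC⟩ := hf.exists_nonneg
  obtain ⟨R₀, -, hR₀⟩ := (Filter.HasBasis.eventually_iff
    (Metric.hasBasis_cobounded_compl_closedBall (0 : E3))).1 hC.bound
  refine ⟨C, hC0, max R₀ 0 + 1, by positivity, fun R hR y hy => ?_⟩
  have hR0 : 0 < R := lt_of_lt_of_le (by positivity) hR
  have h := hR₀ (x := y) (by
    rw [Set.mem_compl_iff, mem_closedBall_zero_iff, not_le]
    linarith [le_max_left R₀ 0])
  rw [Real.norm_eq_abs, norm_pow, norm_inv, norm_norm] at h
  refine h.trans (mul_le_mul_of_nonneg_left ?_ hC0)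
  gcongr

theorem of_tendsto {a : ℝ} (hf : Filter.Tendsto f (Bornology.cobounded E3) (nhds a)) :
    Decays 0 f := by
  simpa [Decays] using hf.isBigO_one ℝ

theorem tendsto_zero (hf : Decays (k + 1) f) :
    Filter.Tendsto f (Bornology.cobounded E3) (nhds 0) := by
  refine Asymptotics.IsBigO.trans_tendsto (hf.mono (l := 1) (by omega)) ?_
  simp only [pow_one]
  exact tendsto_inv_atTop_zero.comp (tendsto_norm_cobounded_atTop (E := E3))

end Decays

/-- The flux through the region where the cutoff varies tends to zero. -/
theorem tendsto_integral_bump {Ω : Set E3} (hΩ : MeasurableSet Ω) {A : Fin 3 → E3 → ℝ}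
    {B : Fin 3 → Fin 3 → E3 → ℝ} (hA : ∀ i, Decays 3 (A i)) (hB : ∀ i j, Decays 2 (B i j)) :
    Filter.Tendsto (fun R => ∫ y in Ω, (∑ i, A i y * dBump R i y
      + ∑ i, ∑ j, B i j y * ddBump R i j y)) Filter.atTop (nhds 0) := by
  obtain ⟨D, hD⟩ := exists_bound_bump
  choose CA hCA RA hRA hA' using fun i => (hA i).exists_bound
  choose CB hCB RB hRB hB' using fun i j => (hB i j).exists_bound
  set C := (∑ i, CA i + ∑ i, ∑ j, CB i j) * D with hC
  have hbound : ∀ᶠ R : ℝ in Filter.atTop, ∀ y, ‖∑ i, A i y * dBump R i y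
      + ∑ i, ∑ j, B i j y * ddBump R i j y‖ ≤ C * (R⁻¹) ^ 4 ∧ (y ∉ Metric.closedBall 0 (2 * R) →
        ∑ i, A i y * dBump R i y + ∑ i, ∑ j, B i j y * ddBump R i j y = 0) := by
    have e1 : ∀ᶠ R in Filter.atTop, ∀ i, RA i ≤ R := Filter.eventually_all.2 fun i =>
      Filter.eventually_ge_atTop (RA i)
    have e2 : ∀ᶠ R in Filter.atTop, ∀ i j, RB i j ≤ R := Filter.eventually_all.2 fun i =>
      Filter.eventually_all.2 fun j => Filter.eventually_ge_atTop (RB i j)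
    filter_upwards [e1, e2, Filter.eventually_gt_atTop 0] with R h1 h2 hR y
    have hzero : y ∉ annulus R → ∑ i, A i y * dBump R i y
        + ∑ i, ∑ j, B i j y * ddBump R i j y = 0 := fun hy => by
      simp [dBump_eq_zero hR (of_notMem_annulus hy), ddBump_eq_zero hR (of_notMem_annulus hy)]
    have hR' : 0 < R⁻¹ := inv_pos.2 hR
    have hD0 : 0 ≤ D := by
      have := (abs_nonneg _).trans ((hD R hR 0).1 0)
      exact nonneg_of_mul_nonneg_left this hR'
    refine ⟨?_, fun hy => hzero fun h => hy ?_⟩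
    · by_cases hy : y ∈ annulus R
      · refine (norm_add_le _ _).trans ?_
        have s1 : ‖∑ i, A i y * dBump R i y‖ ≤ ∑ i, CA i * (D * (R⁻¹) ^ 4) := by
          refine norm_sum_le_of_le _ fun i _ => ?_
          rw [norm_mul, Real.norm_eq_abs, Real.norm_eq_abs]
          calc _ ≤ (CA i * (R⁻¹) ^ 3) * (D * R⁻¹) :=
                mul_le_mul (hA' i R (h1 i) y hy.1) ((hD R hR y).1 i) (abs_nonneg _)
                  (mul_nonneg (hCA i) (by positivity))
            _ = _ := by ring
        have s2 : ‖∑ i, ∑ j, B i j y * ddBump R i j y‖ ≤ ∑ i, ∑ j, CB i j * (D * (R⁻¹) ^ 4) := by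
          refine norm_sum_le_of_le _ fun i _ => norm_sum_le_of_le _ fun j _ => ?_
          rw [norm_mul, Real.norm_eq_abs, Real.norm_eq_abs]
          calc _ ≤ (CB i j * (R⁻¹) ^ 2) * (D * (R⁻¹ * R⁻¹)) :=
                mul_le_mul (hB' i j R (h2 i j) y hy.1) ((hD R hR y).2 i j) (abs_nonneg _)
                  (mul_nonneg (hCB i j) (by positivity))
            _ = _ := by ring
        refine (add_le_add s1 s2).trans (le_of_eq ?_)
        simp only [← Finset.sum_mul, hC]
        ring
      · rw [hzero hy, norm_zero, hC]
        have := Finset.sum_nonneg fun i (_ : i ∈ Finset.univ) => hCA i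
        have := Finset.sum_nonneg fun i (_ : i ∈ Finset.univ) =>
          Finset.sum_nonneg fun j (_ : j ∈ Finset.univ) => hCB i j
        positivity
    · rw [mem_closedBall_zero_iff]; exact h.2
  -- The integrand is at most `C R⁻⁴` and lives in the ball of radius `2R`, of volume `8 R³` times
  -- that of the unit ball.
  refine squeeze_zero_norm' (a := fun R => C * (8 * volume.real (Metric.ball (0 : E3) 1)) * R⁻¹) ?_ ?_
  · filter_upwards [hbound, Filter.eventually_gt_atTop 0] with R h hR
    rw [setIntegral_eq_of_subset_of_forall_sdiff_eq_zero hΩ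
      (Set.inter_subset_left (t := Metric.closedBall 0 (2 * R))) fun y hy =>
        (h y).2 fun h' => hy.2 ⟨hy.1, h'⟩]
    have hfin : volume (Metric.closedBall (0 : E3) (2 * R)) < ⊤ := measure_closedBall_lt_top
    have hC0 : 0 ≤ C * (R⁻¹) ^ 4 := (norm_nonneg _).trans (h 0).1
    refine (norm_setIntegral_le_of_norm_le_const
      ((measure_mono Set.inter_subset_right).trans_lt hfin) fun y _ => (h y).1).trans ?_
    calc _ ≤ C * (R⁻¹) ^ 4 * volume.real (Metric.closedBall (0 : E3) (2 * R)) :=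
          mul_le_mul_of_nonneg_left (measureReal_mono Set.inter_subset_right hfin.ne) hC0
      _ = _ := by
          rw [measureReal_def, Measure.addHaar_closedBall _ _ (by positivity), ENNReal.toReal_mul,
            ENNReal.toReal_ofReal (by positivity), finrank_euclideanSpace, Fintype.card_fin,
            measureReal_def]
          field_simp
          ring
  · simpa using tendsto_inv_atTop_zero.const_mul (C * (8 * volume.real (Metric.ball (0 : E3) 1)))

end Cutoff

/-! ### Cutoffs on the slice and signed divergences -/

section

variable {S : Type*} [TopologicalSpace S] [ChartedSpace E3 S] [IsManifold (𝓡 3) ∞ S]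
  {ξ : OpenPartialHomeomorph S E3 → Fin 4 → Coord.Pt → ℝ} {e Φ : OpenPartialHomeomorph S E3}

theorem IsCovectorField.timeIndep_raise (M : StaticSpacetime S) (hξ : IsCovectorField ξ)
    (he : e ∈ IsManifold.maximalAtlas (𝓡 3) ∞ S) (a : Fin 4) :
    Coord.TimeIndep (Coord.raise (M.g e) (ξ e) a) := fun s p => by
  simp only [Coord.raise, fun a b => (M.isStaticOn he).timeIndep_inv a b s p,
    fun a => hξ.timeIndep e he a s p]

theorem IsCovectorField.smooth_raise (M : StaticSpacetime S) (hξ : IsCovectorField ξ)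
    (he : e ∈ IsManifold.maximalAtlas (𝓡 3) ∞ S) (a : Fin 4) :
    ContDiffOn ℝ ∞ (Coord.raise (M.g e) (ξ e) a) (chartRegion e) :=
  (M.isStaticOn he).smooth_raise (hξ.smooth e he) a

/-- A smooth static covector field defines a vector field on the slice, whose divergence is computed
in coordinates. -/
theorem StaticSpacetime.hasDivergence_sharp (M : StaticSpacetime S) (hξ : IsCovectorField ξ)
    {f : S → ℝ} (hf : ContMDiff (𝓡 3) 𝓘(ℝ, ℝ) ∞ f)
    (hdiv : ∀ e ∈ IsManifold.maximalAtlas (𝓡 3) ∞ S, ∀ p ∈ chartRegion e,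
      ∑ a, Coord.pd a (fun q => M.density e (spatial q) * Coord.raise (M.g e) (ξ e) a q) p
        = M.density e (spatial p) * f (e.symm (spatial p))) :
    M.HasDivergence (fun e y i => Coord.raise (M.g e) (ξ e) i.succ (atTimeZero y))
      (fun x => M.sharp ξ (chartAt E3 x) (chartAt E3 x x)) f where
  smooth := fun e he i => contDiffOn_atTimeZero (hξ.smooth_raise M he i.succ)
  vector_eq := fun e he x hx => M.sharp_eq hξ he (IsManifold.chart_mem_maximalAtlas x) hx
    (mem_chart_source E3 x)
  div := by
    intro e he y hy
    have h := hdiv e he (atTimeZero y) (atTimeZero_mem_chartRegion hy)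
    -- The time derivative drops out of the four-dimensional divergence, which leaves the divergence
    -- on the slice with weight `N √h`.
    rw [Fin.sum_univ_succ, Coord.TimeIndep.pd_zero, zero_add, spatial_atTimeZero] at h
    · rw [← h]
      refine Finset.sum_congr rfl fun i _ => ?_
      rw [← fderiv_atTimeZero (Coord.differentiableAt_of_smooth (isOpen_chartRegion e)
        ((contDiffOn_comp_spatial (M.contDiffOn_density he)).mul (hξ.smooth_raise M he i.succ))
        (atTimeZero_mem_chartRegion hy))]
      simp only [spatial_atTimeZero]
    · exact (timeIndep_comp_spatial (M.density e)).mul (hξ.timeIndep_raise M he 0)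
  contMDiff := hf

open Classical in
/-- The cutoff on the slice that equals one off the end and `η(y / R)` in the end. -/
noncomputable def endCutoff (Φ : OpenPartialHomeomorph S E3) (R : ℝ) (x : S) : ℝ :=
  if x ∈ Φ.source then scaledBump R (Φ x) else 1

omit [ChartedSpace E3 S] [IsManifold (𝓡 3) ∞ S] in
theorem endCutoff_nonneg (R : ℝ) (x : S) : 0 ≤ endCutoff Φ R x := by
  unfold endCutoff
  split_ifs
  · exact scaledBump_nonneg _ _
  · exact zero_le_one

/-- An asymptotically flat end: a chart whose domain has a compact complement near infinity. -/
structure IsEnd (Φ : OpenPartialHomeomorph S E3) (r : ℝ) : Prop where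
  mem_atlas : Φ ∈ IsManifold.maximalAtlas (𝓡 3) ∞ S
  pos : 0 < r
  subset_target : {y : E3 | r ≤ ‖y‖} ⊆ Φ.target
  isCompact_compl : IsCompact (Φ.symm '' {y : E3 | r < ‖y‖})ᶜ
  isClosed : IsClosed (Φ.symm '' {y : E3 | r ≤ ‖y‖})

namespace IsEnd

variable {r R : ℝ} (hΦ : IsEnd Φ r)
include hΦ

omit [IsManifold (𝓡 3) ∞ S] in
theorem mem_endRegion {x : S} {a : ℝ} (ha : r ≤ a) :
    x ∈ Φ.symm '' {y : E3 | a ≤ ‖y‖} ↔ x ∈ Φ.source ∧ a ≤ ‖Φ x‖ := by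
  constructor
  · rintro ⟨y, hy, rfl⟩
    have hy' : y ∈ Φ.target := hΦ.subset_target (ha.trans hy)
    exact ⟨Φ.map_target hy', by rw [Φ.right_inv hy']; exact hy⟩
  · rintro ⟨hx, h⟩
    exact ⟨Φ x, h, Φ.left_inv hx⟩

omit [IsManifold (𝓡 3) ∞ S] in
theorem annulus_subset (hR : r ≤ R) : annulus R ⊆ Φ.target := fun _ hy =>
  hΦ.subset_target (hR.trans hy.1)

omit [IsManifold (𝓡 3) ∞ S] in
theorem isCompact_annulus_image (hR : r ≤ R) : IsCompact (Φ.symm '' annulus R) :=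
  (isCompact_annulus R).image_of_continuousOn (Φ.continuousOn_symm.mono (hΦ.annulus_subset hR))

omit [IsManifold (𝓡 3) ∞ S] in
theorem annulus_image_subset (hR : r ≤ R) : Φ.symm '' annulus R ⊆ Φ.source := by
  rintro _ ⟨y, hy, rfl⟩
  exact Φ.map_target (hΦ.annulus_subset hR hy)

omit [IsManifold (𝓡 3) ∞ S] in
theorem endCutoff_eq_one (hR : r ≤ R) {x : S} (hx : x ∉ Φ.symm '' {y : E3 | R ≤ ‖y‖}) :
    endCutoff Φ R x = 1 := by
  rw [hΦ.mem_endRegion hR] at hx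
  unfold endCutoff
  split_ifs with h
  · exact scaledBump_eq_one (hΦ.pos.trans_le hR) (not_le.1 fun h' => hx ⟨h, h'⟩).le
  · rfl

omit [IsManifold (𝓡 3) ∞ S] in
-- Two open sets cover the slice: the chart domain, where the cutoff is a smooth function of the
-- coordinates, and the complement of the closed end, where it is identically one. Closedness of the
-- end excludes a jump at the edge of the chart domain.
theorem contMDiff_endCutoff (hR : r < R) : ContMDiff (𝓡 3) 𝓘(ℝ, ℝ) ∞ (endCutoff Φ R) := by
  intro x
  by_cases hx : x ∈ Φ.source
  · have h : ContMDiffAt (𝓡 3) 𝓘(ℝ, ℝ) ∞ (fun z => scaledBump R (Φ z)) x :=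
      (contDiff_scaledBump R).contMDiff.contMDiffAt.comp x
        (contMDiffAt_of_mem_maximalAtlas hΦ.mem_atlas hx)
    refine h.congr_of_eventuallyEq (Filter.eventuallyEq_of_mem (Φ.open_source.mem_nhds hx) ?_)
    intro z hz
    exact if_pos hz
  · have hmem : x ∈ (Φ.symm '' {y : E3 | r ≤ ‖y‖})ᶜ := fun h =>
      hx ((hΦ.mem_endRegion le_rfl).1 h).1
    refine (contMDiffAt_const (c := (1 : ℝ))).congr_of_eventuallyEq
      (Filter.eventuallyEq_of_mem (hΦ.isClosed.isOpen_compl.mem_nhds hmem) fun z hz => ?_)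
    exact hΦ.endCutoff_eq_one hR.le fun h => hz ((hΦ.mem_endRegion le_rfl).2
      (((hΦ.mem_endRegion hR.le).1 h).imp_right hR.le.trans))

omit [IsManifold (𝓡 3) ∞ S] in
-- The support lies in the compact core together with the image of the compact shell `r ≤ ‖y‖ ≤ 2R`.
theorem hasCompactSupport_endCutoff [T2Space S] (hR : r < R) :
    HasCompactSupport (endCutoff Φ R) := by
  have hK : IsCompact (Φ.symm '' {y : E3 | r ≤ ‖y‖ ∧ ‖y‖ ≤ 2 * R}) := by
    refine IsCompact.image_of_continuousOn ?_ (Φ.continuousOn_symm.mono fun y hy =>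
      hΦ.subset_target hy.1)
    refine (isCompact_closedBall (0 : E3) (2 * R)).of_isClosed_subset
      ((isClosed_le continuous_const continuous_norm).inter
        (isClosed_le continuous_norm continuous_const)) fun y hy => ?_
    rw [mem_closedBall_zero_iff]
    exact hy.2
  refine HasCompactSupport.intro (hΦ.isCompact_compl.union hK) fun x hx => ?_
  rw [Set.mem_union, not_or, Set.notMem_compl_iff] at hx
  obtain ⟨⟨y, hy, rfl⟩, h2⟩ := hx
  have hy' : y ∈ Φ.target := hΦ.subset_target (le_of_lt (Set.mem_ofPred.1 hy))
  rw [endCutoff, if_pos (Φ.map_target hy'), Φ.right_inv hy']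
  exact scaledBump_eq_zero (hΦ.pos.trans hR) (not_le.1 fun h => h2 ⟨y, ⟨le_of_lt hy, h⟩, rfl⟩).le

omit [IsManifold (𝓡 3) ∞ S] in
theorem diffAt_endCutoff_eq_zero [T2Space S] (hR : r < R) {x : S} (hx : x ∉ Φ.symm '' annulus R) :
    diffAt (endCutoff Φ R) x = 0 := by
  by_cases hs : x ∈ Φ.source
  · have hy : Φ x ∉ annulus R := fun h => hx ⟨_, h, Φ.left_inv hs⟩
    have hd : HasMFDerivAt (𝓡 3) 𝓘(ℝ, ℝ) (endCutoff Φ R) x (diffAt (endCutoff Φ R) x) :=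
      ((hΦ.contMDiff_endCutoff hR).mdifferentiable (by simp) x).hasMFDerivAt
    have hev : ∃ c : ℝ, endCutoff Φ R =ᶠ[nhds x] fun _ => c := by
      have hc := Φ.continuousAt hs
      rcases of_notMem_annulus hy with h | h
      · refine ⟨1, ?_⟩
        filter_upwards [Φ.open_source.mem_nhds hs,
          hc.norm.eventually (gt_mem_nhds h)] with z hz hz'
        rw [endCutoff, if_pos hz, scaledBump_eq_one (hΦ.pos.trans hR) (le_of_lt hz')]
      · refine ⟨0, ?_⟩
        filter_upwards [Φ.open_source.mem_nhds hs,
          hc.norm.eventually (lt_mem_nhds h)] with z hz hz'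
        rw [endCutoff, if_pos hz, scaledBump_eq_zero (hΦ.pos.trans hR) (le_of_lt hz')]
    obtain ⟨c, hc⟩ := hev
    rw [diffAt, hc.mfderiv_eq, mfderiv_const]
    rfl
  · have hmem : x ∈ (Φ.symm '' {y : E3 | r ≤ ‖y‖})ᶜ := fun h =>
      hs ((hΦ.mem_endRegion le_rfl).1 h).1
    have hev : endCutoff Φ R =ᶠ[nhds x] fun _ => 1 :=
      Filter.eventuallyEq_of_mem (hΦ.isClosed.isOpen_compl.mem_nhds hmem) fun z hz =>
        hΦ.endCutoff_eq_one hR.le fun h => hz ((hΦ.mem_endRegion le_rfl).2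
          (((hΦ.mem_endRegion hR.le).1 h).imp_right hR.le.trans))
    rw [diffAt, hev.mfderiv_eq, mfderiv_const]
    rfl

omit [IsManifold (𝓡 3) ∞ S] in
/-- The cutoffs eventually equal one on any compact set. -/
theorem eventually_endCutoff_eq_one {K : Set S} (hK : IsCompact K) :
    ∀ᶠ R in Filter.atTop, ∀ x ∈ K, endCutoff Φ R x = 1 := by
  have hK' : IsCompact (K ∩ Φ.symm '' {y : E3 | r ≤ ‖y‖}) := hK.inter_right hΦ.isClosed
  obtain ⟨B, hB⟩ := (hK'.image_of_continuousOn (f := fun x => ‖Φ x‖) (continuous_norm.comp_continuousOn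
    (Φ.continuousOn.mono fun x hx => ((hΦ.mem_endRegion le_rfl).1 hx.2).1))).bddAbove
  filter_upwards [Filter.eventually_gt_atTop (max B r)] with R hR x hx
  have hrR : r ≤ R := (le_max_right _ _).trans hR.le
  refine hΦ.endCutoff_eq_one hrR fun h => ?_
  have h1 := (hΦ.mem_endRegion hrR).1 h
  have h2 : ‖Φ x‖ ≤ B := hB ⟨x, ⟨hx, (hΦ.mem_endRegion le_rfl).2 ⟨h1.1, hrR.trans h1.2⟩⟩, rfl⟩
  linarith [h1.2, le_max_left B r]

end IsEnd

/-- If the flux of a vector field at infinity vanishes and its divergence has a sign, then the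
divergence vanishes. -/
theorem StaticSpacetime.HasDivergence.eq_zero [T2Space S] [SigmaCompactSpace S]
    {M : StaticSpacetime S} {V : OpenPartialHomeomorph S E3 → E3 → Fin 3 → ℝ} {X : S → E3}
    {f : S → ℝ} (hV : M.HasDivergence V X f) {r : ℝ} (hΦ : IsEnd Φ r) {c : ℝ} (hc : c ≠ 0)
    {h : S → ℝ} (hf : ∀ x, f x = c * h x) (hh : ∀ x, 0 ≤ h x) (hhc : Continuous h)
    (hflux : Filter.Tendsto (fun R => ∫ y in Φ.target, (∑ i, V Φ y i * dBump R i y)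
      * M.density Φ y) Filter.atTop (nhds 0)) (x : S) : h x = 0 := by
  by_contra hne
  have hpos : 0 < h x := lt_of_le_of_ne (hh x) (Ne.symm hne)
  set e := chartAt E3 x
  have he : e ∈ IsManifold.maximalAtlas (𝓡 3) ∞ S := IsManifold.chart_mem_maximalAtlas x
  have hxe : x ∈ e.source := mem_chart_source E3 x
  -- A bump at `x` inside one chart. Every cutoff of large radius is one on its support and hence
  -- dominates it.
  obtain ⟨θ, -, hθ⟩ := ((SmoothBumpFunction.nhds_basis_tsupport (I := 𝓡 3) x).mem_iff).1
    (e.open_source.mem_nhds hxe)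
  have hθc : HasCompactSupport θ := θ.hasCompactSupport
  have hθcont : Continuous θ := θ.continuous
  -- the integral near `x` vanishes
  have hle : |c| * M.chartInt e (fun x => θ x * h x) ≤ 0 := by
    refine ge_of_tendsto (by simpa using hflux.abs) ?_
    filter_upwards [hΦ.eventually_endCutoff_eq_one hθc.isCompact,
      Filter.eventually_gt_atTop r] with R hR hrR
    refine (hV.chartInt_le_flux hf hh hhc (hΦ.contMDiff_endCutoff hrR)
      (hΦ.hasCompactSupport_endCutoff hrR) hΦ.mem_atlas (hΦ.isCompact_annulus_image hrR.le)
      (hΦ.annulus_image_subset hrR.le) (fun x hx => hΦ.diffAt_endCutoff_eq_zero hrR hx) he hθcont hθc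
      hθ (fun z => ?_) fun z => θ.nonneg).trans (le_of_eq ?_)
    · by_cases hz : z ∈ tsupport θ
      · rw [hR z hz]; exact θ.le_one
      · rw [image_eq_zero_of_notMem_tsupport hz]
        exact endCutoff_nonneg R z
    · congr 1
      refine setIntegral_congr_fun Φ.open_target.measurableSet fun y hy => ?_
      have h1 := hV.diffAt_apply hΦ.mem_atlas (hΦ.contMDiff_endCutoff hrR) (Φ.map_target hy)
      have h2 : (fun y => endCutoff Φ R (Φ.symm y)) =ᶠ[nhds y] scaledBump R :=
        Filter.eventuallyEq_of_mem (Φ.open_target.mem_nhds hy) fun z hz => by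
          simp only [endCutoff, if_pos (Φ.map_target hz), Φ.right_inv hz]
      rw [Φ.right_inv hy, h2.fderiv_eq] at h1
      simp only [h1, dBump]
  have hint0 : M.chartInt e (fun x => θ x * h x) ≤ 0 :=
    nonpos_of_mul_nonpos_right hle (abs_pos.2 hc)
  have hcont : ContinuousOn (fun y => (θ (e.symm y) * h (e.symm y)) * M.density e y) e.target :=
    ((hθcont.mul hhc).comp_continuousOn e.continuousOn_symm).mul (M.contDiffOn_density he).continuousOn
  have hint := M.integrableOn_chart he (F := fun x => θ x * h x) (hθcont.mul hhc) hθc.isCompact hθ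
    fun x hx => by rw [image_eq_zero_of_notMem_tsupport hx, zero_mul]
  -- The integrand is continuous, nonnegative and positive at `x`, so its integral is positive,
  -- contrary to the bound by vanishing flux.
  refine hint0.not_gt ?_
  rw [chartInt, setIntegral_pos_iff_support_of_nonneg_ae]
  · have hopen : IsOpen (e.target ∩ (fun y => (θ (e.symm y) * h (e.symm y)) * M.density e y) ⁻¹' {0}ᶜ) :=
      hcont.isOpen_inter_preimage e.open_target isOpen_compl_singleton
    rw [Set.inter_comm]
    refine hopen.measure_pos volume ⟨e x, e.map_source hxe, ?_⟩
    simp only [Set.mem_preimage, e.left_inv hxe, Set.mem_compl_iff, Set.mem_singleton_iff]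
    exact (mul_pos (mul_pos (by rw [θ.eq_one]; exact one_pos) hpos)
      (M.density_pos he (e.map_source hxe))).ne'
  · filter_upwards [ae_restrict_mem e.open_target.measurableSet] with y hy
    exact mul_nonneg (mul_nonneg θ.nonneg (hh _)) (M.density_pos he hy).le
  · exact hint

end

theorem Decays.congr {k : ℕ} {f g : E3 → ℝ} (hf : Decays k f)
    (h : f =ᶠ[Bornology.cobounded E3] g) : Decays k g :=
  hf.congr' h Filter.EventuallyEq.rfl

/-! ### Decay of the curvature -/

namespace Coord

/-- The decay of a metric and its first two derivatives on the slice `t = 0`. -/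
structure MetricDecays (g : Pt → Matrix (Fin 4) (Fin 4) ℝ) : Prop where
  inv : ∀ a b, Decays 0 fun y => (g (atTimeZero y))⁻¹ a b
  pd : ∀ a b c, Decays 2 fun y => pd c (fun q => g q a b) (atTimeZero y)
  pd_pd : ∀ a b c d, Decays 2 fun y => Coord.pd d (Coord.pd c fun q => g q a b) (atTimeZero y)

namespace MetricDecays

variable {g : Pt → Matrix (Fin 4) (Fin 4) ℝ} {U : Set Pt} (h : MetricDecays g)
  (hg : IsMetricOn g U) (hU : ∀ᶠ y in Bornology.cobounded E3, atTimeZero y ∈ U)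
include h

theorem christoffel (a b c : Fin 4) : Decays 2 fun y => christoffel g a b c (atTimeZero y) :=
  (Decays.sum fun d => ((h.inv a d).mul
    (((h.pd d c b).add (h.pd d b c)).sub (h.pd b c d))).mono (by omega)).const_mul _

include hg hU

theorem pd_inv (a b c : Fin 4) :
    Decays 2 fun y => Coord.pd c (fun q => (g q)⁻¹ a b) (atTimeZero y) := by
  have h1 : Decays 2 fun y => -(∑ m, (g (atTimeZero y))⁻¹ a m * Coord.christoffel g b m c (atTimeZero y))
      - ∑ m, Coord.christoffel g a m c (atTimeZero y) * (g (atTimeZero y))⁻¹ m b :=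
    (Decays.sum fun m => ((h.inv a m).mul (h.christoffel b m c)).mono (by omega)).neg.sub
      (Decays.sum fun m => ((h.christoffel a m c).mul (h.inv m b)).mono (by omega))
  refine h1.congr ?_
  filter_upwards [hU] with y hy
  exact (hg.pd_inv hy a b c).symm

/-- By the product rule each term is either a product of two first derivatives of metric quantities
or a bounded factor times a second derivative. -/
theorem pd_christoffel (a b c d : Fin 4) :
    Decays 2 fun y => Coord.pd d (Coord.christoffel g a b c) (atTimeZero y) := by
  have h1 : Decays 2 fun y => (1 / 2) * ∑ e, (Coord.pd d (fun q => (g q)⁻¹ a e) (atTimeZero y)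
      * (Coord.pd b (fun q => g q e c) (atTimeZero y) + Coord.pd c (fun q => g q e b) (atTimeZero y)
        - Coord.pd e (fun q => g q b c) (atTimeZero y))
      + (g (atTimeZero y))⁻¹ a e * (Coord.pd d (Coord.pd b fun q => g q e c) (atTimeZero y)
        + Coord.pd d (Coord.pd c fun q => g q e b) (atTimeZero y)
        - Coord.pd d (Coord.pd e fun q => g q b c) (atTimeZero y))) :=
    (Decays.sum fun e => (((h.pd_inv hg hU a e d).mul
      (((h.pd e c b).add (h.pd e b c)).sub (h.pd b c e))).mono (by omega)).add
      (((h.inv a e).mul (((h.pd_pd e c b d).add (h.pd_pd e b c d)).sub (h.pd_pd b c e d))).mono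
        (by omega))).const_mul _
  refine h1.congr ?_
  filter_upwards [hU] with y hy
  have hi := fun e => hg.smooth_inv.differentiableAt hg.isOpen hy a e
  have hd := fun m b c => differentiableAt_of_smooth hg.isOpen
    (contDiffOn_pd hg.isOpen (hg.smooth m b) c) hy
  have hK := fun e => ((hd e c b).fun_add (hd e b c)).fun_sub (hd b c e)
  symm
  rw [show Coord.christoffel g a b c = fun p => (1 / 2) * ∑ e, (g p)⁻¹ a e *
    (Coord.pd b (fun q => g q e c) p + Coord.pd c (fun q => g q e b) p
      - Coord.pd e (fun q => g q b c) p) from rfl,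
    pd_mul (differentiableAt_const _) (DifferentiableAt.fun_sum fun e _ => (hi e).fun_mul (hK e)),
    pd_const, zero_mul, zero_add, pd_sum _ fun e _ => (hi e).fun_mul (hK e)]
  congr 1
  refine Finset.sum_congr rfl fun e _ => ?_
  rw [pd_mul (hi e) (hK e), pd_sub ((hd e c b).fun_add (hd e b c)) (hd b c e),
    pd_add (hd e c b) (hd e b c)]

/-- The curvature contains at most two derivatives of the metric, which is all that asymptotic
flatness controls; no decay of its own derivatives is available. -/
theorem ricci (a b : Fin 4) : Decays 2 fun y => ricci g a b (atTimeZero y) :=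
  Decays.sum fun c => ((h.pd_christoffel hg hU c a b c).sub
    (h.pd_christoffel hg hU c a c b)).add (Decays.sum fun e =>
      (((h.christoffel c c e).mul (h.christoffel e a b)).sub
        ((h.christoffel c b e).mul (h.christoffel e a c))).mono (by omega))

theorem scalarCurv : Decays 2 fun y => scalarCurv g (atTimeZero y) :=
  Decays.sum fun a => Decays.sum fun b => ((h.inv a b).mul (h.ricci hg hU a b)).mono (by omega)

omit hg in
theorem ricciEnergy {L : Pt → ℝ} (hg : IsStaticOn g L U) :
    Decays 2 fun y => ricciEnergy g L (atTimeZero y) := by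
  have h1 : Decays 2 fun y => -((g (atTimeZero y))⁻¹ 0 0 * Coord.ricci g 0 0 (atTimeZero y)) :=
    ((h.inv 0 0).mul (h.ricci hg.toIsMetricOn hU 0 0)).neg.mono (by omega)
  refine h1.congr ?_
  filter_upwards [hU] with y hy
  rw [hg.inv_time_time hy, Coord.ricciEnergy]
  ring

omit hg in
theorem pd_log {L : Pt → ℝ} (hg : IsStaticOn g L U) (c : Fin 4) :
    Decays 2 fun y => Coord.pd c L (atTimeZero y) := by
  refine (h.christoffel 0 0 c).congr ?_
  filter_upwards [hU] with y hy
  exact hg.christoffel_time_time hy c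

omit hg hU in
theorem raise {ξ : Fin 4 → Pt → ℝ} {k : ℕ} (hξ : ∀ b, Decays k fun y => ξ b (atTimeZero y))
    (a : Fin 4) : Decays k fun y => raise g ξ a (atTimeZero y) :=
  Decays.sum fun b => ((h.inv a b).mul (hξ b)).mono (by omega)

end MetricDecays

end Coord

/-- Functions on an end whose first derivatives decay. -/
theorem decays_of_iteratedFDeriv {G : E3 → ℝ} {r C : ℝ}
    (hG : ∀ k ≤ 2, ∀ y : E3, r < ‖y‖ → ‖iteratedFDeriv ℝ k G y‖ ≤ C / ‖y‖ ^ (k + 1))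
    (hsm : ContDiffOn ℝ ∞ G {y | r < ‖y‖}) :
    Decays 1 G ∧ (∀ i, Decays 2 fun y => fderiv ℝ G y (EuclideanSpace.single i 1)) ∧
    ∀ i j, Decays 2 fun y => fderiv ℝ (fun z => fderiv ℝ G z (EuclideanSpace.single j 1)) y
      (EuclideanSpace.single i 1) := by
  have hO : IsOpen {y : E3 | r < ‖y‖} := isOpen_lt continuous_const continuous_norm
  have h1 : ∀ k ≤ 2, ∀ f : E3 → ℝ, (∀ y, r < ‖y‖ → ‖f y‖ ≤ ‖iteratedFDeriv ℝ k G y‖) →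
      Decays (k + 1) f := by
    intro k hk f hf
    refine Asymptotics.IsBigO.of_bound C ?_
    filter_upwards [eventually_large r] with y hy
    refine ((hf y hy).trans (hG k hk y hy)).trans (le_of_eq ?_)
    rw [norm_pow, norm_inv, norm_norm, inv_pow, div_eq_mul_inv]
  have hs : ∀ i : Fin 3, ‖(EuclideanSpace.single i (1 : ℝ) : E3)‖ = 1 := fun i => by simp
  refine ⟨h1 0 (by norm_num) _ fun y _ => by rw [norm_iteratedFDeriv_zero],
    fun i => h1 1 (by norm_num) _ fun y _ => ?_,
    -- The hypothesis gives exponent three for second derivatives; exponent two is enough for the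
    -- flux estimate.
    fun i j => (h1 2 le_rfl _ fun y hy => ?_).mono (by omega)⟩
  · rw [norm_iteratedFDeriv_one]
    simpa [hs] using (fderiv ℝ G y).le_opNorm (EuclideanSpace.single i 1)
  · have hd : DifferentiableAt ℝ (fderiv ℝ G) y :=
      ((hsm.fderiv_of_isOpen hO (m := ∞) (by simp)).contDiffAt (hO.mem_nhds hy)).differentiableAt
        (by simp)
    have h2 : fderiv ℝ (fun z => fderiv ℝ G z (EuclideanSpace.single j 1)) y
        (EuclideanSpace.single i 1) = iteratedFDeriv ℝ 2 G y
          ![EuclideanSpace.single i 1, EuclideanSpace.single j 1] := by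
      rw [iteratedFDeriv_two_apply, fderiv_clm_apply hd (differentiableAt_const _)]
      simp
    rw [h2]
    refine (ContinuousMultilinearMap.le_opNorm _ _).trans (le_of_eq ?_)
    rw [Fin.prod_univ_two]
    simp

/-! ### The asymptotically flat end -/

section

variable {S : Type*} [TopologicalSpace S] [ChartedSpace E3 S] [IsManifold (𝓡 3) ∞ S]
  {Φ : OpenPartialHomeomorph S E3} {r : ℝ} {f : Coord.Pt → ℝ}

omit [IsManifold (𝓡 3) ∞ S] in
theorem IsEnd.eventually_mem_target (hΦ : IsEnd Φ r) :
    ∀ᶠ y in Bornology.cobounded E3, y ∈ Φ.target := by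
  filter_upwards [eventually_large r] with y hy
  exact hΦ.subset_target (Set.mem_ofPred.2 hy.le)

omit [IsManifold (𝓡 3) ∞ S] in
theorem IsEnd.eventually_mem_chartRegion (hΦ : IsEnd Φ r) :
    ∀ᶠ y in Bornology.cobounded E3, atTimeZero y ∈ chartRegion Φ := by
  filter_upwards [hΦ.eventually_mem_target] with y hy
  exact atTimeZero_mem_chartRegion hy

theorem Decays.zero (k : ℕ) : Decays k fun _ => 0 := Asymptotics.isBigO_zero _ _

omit [IsManifold (𝓡 3) ∞ S] in
theorem IsEnd.decays_pd (hΦ : IsEnd Φ r) (hf : ContDiffOn ℝ ∞ f (chartRegion Φ))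
    (ht : Coord.TimeIndep f) {k : ℕ} (h : ∀ i, Decays k fun y =>
      fderiv ℝ (fun z => f (atTimeZero z)) y (EuclideanSpace.single i 1)) (c : Fin 4) :
    Decays k fun y => Coord.pd c f (atTimeZero y) := by
  refine Fin.cases ?_ (fun i => ?_) c
  · simpa only [ht.pd_zero] using Decays.zero k
  · refine (h i).congr ?_
    filter_upwards [hΦ.eventually_mem_chartRegion] with y hy
    exact fderiv_atTimeZero (Coord.differentiableAt_of_smooth (isOpen_chartRegion Φ) hf hy) i

/-- The Minkowski metric. -/
noncomputable def minkowski : Matrix (Fin 4) (Fin 4) ℝ := Matrix.diagonal (Fin.cons (-1) fun _ => 1)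

namespace StaticSpacetime

variable (M : StaticSpacetime S)

theorem AsymptoticallyFlat.exists_end {M : StaticSpacetime S} (h : M.AsymptoticallyFlat) :
    ∃ (Φ : OpenPartialHomeomorph S E3) (r : ℝ), IsEnd Φ r ∧ (∀ a b,
      Decays 1 (fun y => M.g Φ (atTimeZero y) a b - minkowski a b) ∧
      (∀ c, Decays 2 fun y => Coord.pd c (fun q => M.g Φ q a b) (atTimeZero y)) ∧
      ∀ c d, Decays 2 fun y => Coord.pd d (Coord.pd c fun q => M.g Φ q a b) (atTimeZero y)) := by
  obtain ⟨Φ, hmem, r, hr, C, hsub, hK, hcl, hdec⟩ := h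
  have hΦ : IsEnd Φ r := ⟨hmem, hr, hsub, hK, hcl⟩
  have hO : IsOpen {y : E3 | r < ‖y‖} := isOpen_lt continuous_const continuous_norm
  have hst := M.isStaticOn hmem
  refine ⟨Φ, r, hΦ, fun a b => ?_⟩
  set G : E3 → ℝ := fun y => M.g Φ (atTimeZero y) a b - minkowski a b with hGdef
  have hsm : ContDiffOn ℝ ∞ G Φ.target :=
    (contDiffOn_atTimeZero (hst.smooth a b)).sub contDiffOn_const
  have hbound : ∃ C, ∀ k ≤ 2, ∀ y : E3, r < ‖y‖ → ‖iteratedFDeriv ℝ k G y‖ ≤ C / ‖y‖ ^ (k + 1) := by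
    -- The mixed time-space components vanish identically in the metric and in `minkowski`, and for
    -- them the constant zero works.
    have hz : G = (fun _ => 0) → ∃ C, ∀ k ≤ 2, ∀ y : E3, r < ‖y‖ →
        ‖iteratedFDeriv ℝ k G y‖ ≤ C / ‖y‖ ^ (k + 1) := fun hG =>
      ⟨0, fun k _ y _ => by
        rw [hG]
        have : iteratedFDeriv ℝ k (fun _ : E3 => (0 : ℝ)) = 0 := iteratedFDeriv_fun_zero
        simp [this]⟩
    rw [hGdef] at hz ⊢
    clear_value G
    revert hz
    refine Fin.cases ?_ (fun i => ?_) a <;> refine Fin.cases ?_ (fun j => ?_) b <;> intro hz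
    · refine ⟨C, fun k hk y hy => ?_⟩
      have : (fun y => M.g Φ (atTimeZero y) 0 0 - minkowski 0 0)
          = fun y => -(M.N (Φ.symm y) ^ 2 - 1) := by
        funext y
        rw [g_time_time, spatial_atTimeZero, minkowski, Matrix.diagonal_apply_eq]
        simp; ring
      rw [this, show (fun y => -(M.N (Φ.symm y) ^ 2 - 1)) = -(fun y => M.N (Φ.symm y) ^ 2 - 1) from rfl,
        iteratedFDeriv_neg_apply, norm_neg]
      exact (hdec k hk y hy).1
    · refine hz ?_
      funext y
      rw [g_time_space, minkowski, Matrix.diagonal_apply_ne _ (Fin.succ_ne_zero j).symm, sub_zero]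
    · refine hz ?_
      funext y
      rw [g_space_time, minkowski, Matrix.diagonal_apply_ne _ (Fin.succ_ne_zero i), sub_zero]
    · refine ⟨C, fun k hk y hy => ?_⟩
      have : (fun y => M.g Φ (atTimeZero y) i.succ j.succ - minkowski i.succ j.succ)
          = fun y => M.hComp Φ y i j - (1 : Matrix (Fin 3) (Fin 3) ℝ) i j := by
        funext y
        rw [g_space_space, spatial_atTimeZero, minkowski]
        simp [Matrix.diagonal_apply, Matrix.one_apply]
      rw [this]
      exact (hdec k hk y hy).2 i j
  obtain ⟨C, hC⟩ := hbound
  obtain ⟨h0, h1, h2⟩ := decays_of_iteratedFDeriv hC (hsm.mono fun y hy =>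
    hsub (Set.mem_ofPred.2 (le_of_lt (Set.mem_ofPred.1 hy))))
  have hpd : ∀ y i, fderiv ℝ (fun z => M.g Φ (atTimeZero z) a b) y (EuclideanSpace.single i 1)
      = fderiv ℝ G y (EuclideanSpace.single i 1) := fun y i => by
    rw [hGdef, fderiv_sub_const]
  have hfirst : ∀ c, Decays 2 fun y => Coord.pd c (fun q => M.g Φ q a b) (atTimeZero y) :=
    hΦ.decays_pd (hst.smooth a b) (hst.timeIndep a b) fun i => by simpa only [hpd] using h1 i
  refine ⟨h0, hfirst, fun c => hΦ.decays_pd (Coord.contDiffOn_pd hst.isOpen (hst.smooth a b) c)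
    ((hst.timeIndep a b).pd c) fun i => ?_⟩
  refine Fin.cases ?_ (fun j => ?_) c
  · simp only [(hst.timeIndep a b).pd_zero]
    simpa using Decays.zero 2
  · refine (h2 i j).congr ?_
    filter_upwards [hΦ.eventually_mem_target] with y hy
    have : (fun z => Coord.pd j.succ (fun q => M.g Φ q a b) (atTimeZero z)) =ᶠ[nhds y]
        fun z => fderiv ℝ G z (EuclideanSpace.single j 1) :=
      Filter.eventuallyEq_of_mem (Φ.open_target.mem_nhds hy) fun z hz => by
        simp only [← hpd]
        exact (fderiv_atTimeZero (Coord.differentiableAt_of_smooth hst.isOpen (hst.smooth a b)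
          (atTimeZero_mem_chartRegion hz)) j).symm
    rw [this.fderiv_eq]

/-- In an asymptotically flat end, the metric and the volume density are controlled. -/
theorem AsymptoticallyFlat.exists_end_metricDecays {M : StaticSpacetime S}
    (h : M.AsymptoticallyFlat) :
    ∃ (Φ : OpenPartialHomeomorph S E3) (r : ℝ), IsEnd Φ r ∧ Coord.MetricDecays (M.g Φ) ∧
      Decays 0 (M.density Φ) := by
  obtain ⟨Φ, r, hΦ, hg⟩ := h.exists_end
  have hdet0 : minkowski.det = -1 := by
    rw [minkowski, Matrix.det_diagonal, Fin.prod_univ_succ]; simp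
  -- Convergence to the Minkowski metric keeps the determinant near `-1`, which bounds the inverse
  -- metric through the adjugate and the density through `√(-det g)`.
  have hlim : Filter.Tendsto (fun y => M.g Φ (atTimeZero y)) (Bornology.cobounded E3)
      (nhds minkowski) := by
    refine tendsto_pi_nhds.2 fun a => tendsto_pi_nhds.2 fun b => ?_
    simpa using ((hg a b).1.tendsto_zero (k := 0)).add_const (minkowski a b)
  have hdet : Filter.Tendsto (fun y => (M.g Φ (atTimeZero y)).det) (Bornology.cobounded E3)
      (nhds (-1)) := by
    rw [← hdet0]
    exact (Continuous.matrix_det continuous_id).continuousAt.tendsto.comp hlim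
  refine ⟨Φ, r, hΦ, ⟨fun a b => ?_, fun a b => (hg a b).2.1, fun a b => (hg a b).2.2⟩, ?_⟩
  · have hadj : Filter.Tendsto (fun y => (M.g Φ (atTimeZero y)).adjugate a b)
        (Bornology.cobounded E3) (nhds (minkowski.adjugate a b)) :=
      ((Continuous.matrix_adjugate continuous_id).matrix_elem a b).continuousAt.tendsto.comp hlim
    have : (fun y => (M.g Φ (atTimeZero y))⁻¹ a b) = fun y => ((M.g Φ (atTimeZero y)).det)⁻¹
        * (M.g Φ (atTimeZero y)).adjugate a b := by
      funext y
      rw [Matrix.inv_def, Matrix.smul_apply, Ring.inverse_eq_inv', smul_eq_mul]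
    rw [this]
    exact Decays.of_tendsto ((hdet.inv₀ (by norm_num)).mul hadj)
  · refine (Decays.of_tendsto (hdet.neg.sqrt)).congr ?_
    filter_upwards [hΦ.eventually_mem_target] with y hy
    rw [M.det_g, neg_neg, spatial_atTimeZero, Real.sqrt_mul (sq_nonneg _),
      Real.sqrt_sq (M.N_pos _).le, density]

end StaticSpacetime

end

/-! ### The flux at infinity -/

section

variable {S : Type*} [TopologicalSpace S] [ChartedSpace E3 S] [IsManifold (𝓡 3) ∞ S]
  {Φ : OpenPartialHomeomorph S E3} {r : ℝ}

theorem pd_scaledBump (R : ℝ) (p : Coord.Pt) (i : Fin 3) :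
    Coord.pd i.succ (fun q => scaledBump R (spatial q)) p = dBump R i (spatial p) :=
  pd_comp_spatial ((contDiff_scaledBump R).differentiable (by simp) _) i

theorem pd_pd_scaledBump (R : ℝ) (p : Coord.Pt) (i j : Fin 3) :
    Coord.pd i.succ (Coord.pd j.succ fun q => scaledBump R (spatial q)) p
      = ddBump R i j (spatial p) := by
  rw [show (Coord.pd j.succ fun q => scaledBump R (spatial q)) = fun q => dBump R j (spatial q) from
    funext fun q => pd_scaledBump R q j]
  exact pd_comp_spatial ((contDiff_dBump R j).differentiable (by simp) _) i

namespace StaticSpacetime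

variable (M : StaticSpacetime S)

/-- The vector field whose divergence appears when the gradient part of the flux is integrated by
parts. -/
noncomputable def boundaryField (Φ : OpenPartialHomeomorph S E3) (u : S → ℝ) (R : ℝ) (a : Fin 4)
    (p : Coord.Pt) : ℝ :=
  M.density Φ (spatial p) * Coord.raise (M.g Φ)
    (fun b => Coord.pd b fun q => scaledBump R (spatial q)) a p * u (Φ.symm (spatial p))

/-- The contracted Christoffel symbols `g^{ab} Γ^c_{ab}`. -/
noncomputable def contractedChristoffel (Φ : OpenPartialHomeomorph S E3) (c : Fin 4)
    (p : Coord.Pt) : ℝ :=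
  ∑ a, ∑ b, (M.g Φ p)⁻¹ a b * Coord.christoffel (M.g Φ) c a b p

theorem smooth_boundaryField (hmem : Φ ∈ IsManifold.maximalAtlas (𝓡 3) ∞ S) {u : S → ℝ}
    (hu : ContMDiff (𝓡 3) 𝓘(ℝ, ℝ) ∞ u) (R : ℝ) (a : Fin 4) :
    ContDiffOn ℝ ∞ (M.boundaryField Φ u R a) (chartRegion Φ) :=
  ((contDiffOn_comp_spatial (M.contDiffOn_density hmem)).mul
    ((M.isStaticOn hmem).smooth_raise (fun b => Coord.contDiffOn_pd (isOpen_chartRegion Φ)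
      ((contDiff_scaledBump R).comp contDiff_spatial).contDiffOn b) a)).mul
    (contDiffOn_comp_spatial (contDiffOn_comp_symm hmem hu))

theorem raise_scaledBump (R : ℝ) (a : Fin 4) (p : Coord.Pt) :
    Coord.raise (M.g Φ) (fun b => Coord.pd b fun q => scaledBump R (spatial q)) a p
      = ∑ i : Fin 3, (M.g Φ p)⁻¹ a i.succ * dBump R i (spatial p) := by
  rw [Coord.raise, Fin.sum_univ_succ, (timeIndep_comp_spatial (scaledBump R)).pd_zero, mul_zero,
    zero_add]
  simp only [pd_scaledBump]

theorem boundaryField_eq_zero {u : S → ℝ} {R : ℝ} (hR : 0 < R) {p : Coord.Pt}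
    (hp : spatial p ∉ annulus R) (a : Fin 4) : M.boundaryField Φ u R a p = 0 := by
  simp [boundaryField, raise_scaledBump, dBump_eq_zero hR (of_notMem_annulus hp)]

/-- The divergence of `u ∇η` is `⟨∇u, ∇η⟩ + u □η`, with `□η` written in coordinates as `g^{ij}
∂_i∂_j η - g^{ab} Γ^i_{ab} ∂_i η`. This trades the uncontrolled gradient of `u` for derivatives of
the cutoff. -/
theorem divergence_boundaryField (hmem : Φ ∈ IsManifold.maximalAtlas (𝓡 3) ∞ S) {u : S → ℝ}
    (hu : ContMDiff (𝓡 3) 𝓘(ℝ, ℝ) ∞ u) (R : ℝ) {y : E3} (hy : y ∈ Φ.target) :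
    ∑ i : Fin 3, fderiv ℝ (fun z => M.boundaryField Φ u R i.succ (atTimeZero z)) y
        (EuclideanSpace.single i 1)
      = (∑ i : Fin 3, Coord.raise (M.g Φ) (fun b => Coord.pd b fun q => u (Φ.symm (spatial q)))
          i.succ (atTimeZero y) * dBump R i y) * M.density Φ y
        + M.density Φ y * u (Φ.symm y) * (∑ i : Fin 3, ∑ j : Fin 3,
            (M.g Φ (atTimeZero y))⁻¹ i.succ j.succ * ddBump R i j y
          - ∑ i : Fin 3, M.contractedChristoffel Φ i.succ (atTimeZero y) * dBump R i y) := by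
  set p := atTimeZero y with hpdef
  have hp : p ∈ chartRegion Φ := atTimeZero_mem_chartRegion hy
  have hsp : spatial p = y := spatial_atTimeZero y
  have hst := M.isStaticOn hmem
  have hg := hst.toIsMetricOn
  set η : Coord.Pt → ℝ := fun q => scaledBump R (spatial q) with hη
  set U : Coord.Pt → ℝ := fun q => u (Φ.symm (spatial q)) with hU
  have hηs : ∀ b, ContDiffOn ℝ ∞ (Coord.pd b η) (chartRegion Φ) := fun b =>
    Coord.contDiffOn_pd (isOpen_chartRegion Φ)
      ((contDiff_scaledBump R).comp contDiff_spatial).contDiffOn b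
  have hηt : Coord.TimeIndep η := timeIndep_comp_spatial (scaledBump R)
  have hUt : Coord.TimeIndep U := timeIndep_comp_spatial fun y => u (Φ.symm y)
  have hws := contDiffOn_comp_spatial (M.contDiffOn_density hmem)
  have hdB := fun a => Coord.differentiableAt_of_smooth hg.isOpen (M.smooth_boundaryField hmem hu R a) hp
  have hwr := fun a => Coord.differentiableAt_of_smooth hg.isOpen (hws.mul (hg.smooth_raise hηs a)) hp
  have hUd : DifferentiableAt ℝ U p := Coord.differentiableAt_of_smooth hg.isOpen
    (contDiffOn_comp_spatial (contDiffOn_comp_symm hmem hu)) hp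
  have ht : Coord.TimeIndep (M.boundaryField Φ u R 0) := by
    refine ((timeIndep_comp_spatial (M.density Φ)).mul fun s q => ?_).mul hUt
    rw [Coord.raise, Coord.raise]
    exact Finset.sum_congr rfl fun b _ =>
      congrArg₂ (· * ·) (hst.timeIndep_inv 0 b s q) (hηt.pd b s q)
  have h1 : ∑ i : Fin 3, fderiv ℝ (fun z => M.boundaryField Φ u R i.succ (atTimeZero z)) y
      (EuclideanSpace.single i 1) = ∑ a, Coord.pd a (M.boundaryField Φ u R a) p := by
    rw [Fin.sum_univ_succ (n := 3), ht.pd_zero, zero_add]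
    exact Finset.sum_congr rfl fun i _ => fderiv_atTimeZero (hdB i.succ) i
  have h2 : ∀ a, Coord.pd a (M.boundaryField Φ u R a) p
      = M.density Φ y * (Coord.raise (M.g Φ) (fun b => Coord.pd b η) a p * Coord.pd a U p)
        + Coord.pd a (fun q => M.density Φ (spatial q)
            * Coord.raise (M.g Φ) (fun b => Coord.pd b η) a q) p * U p := by
    intro a
    rw [show M.boundaryField Φ u R a = fun q => (M.density Φ (spatial q)
      * Coord.raise (M.g Φ) (fun b => Coord.pd b η) a q) * U q from rfl, Coord.pd_mul (hwr a) hUd,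
      hsp]
    ring
  have h3 : ∑ a, Coord.raise (M.g Φ) (fun b => Coord.pd b η) a p * Coord.pd a U p
      = ∑ i : Fin 3, Coord.raise (M.g Φ) (fun b => Coord.pd b U) i.succ p * dBump R i y := by
    have : ∑ a, Coord.raise (M.g Φ) (fun b => Coord.pd b η) a p * Coord.pd a U p
        = ∑ b, Coord.raise (M.g Φ) (fun b => Coord.pd b U) b p * Coord.pd b η p := by
      simp only [Coord.raise, Finset.sum_mul]
      rw [Finset.sum_comm]
      exact Finset.sum_congr rfl fun a _ => Finset.sum_congr rfl fun b _ => by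
        rw [hg.inv_symm_apply hp]; ring
    rw [this, Fin.sum_univ_succ, hηt.pd_zero, mul_zero, zero_add]
    exact Finset.sum_congr rfl fun i _ => by rw [hη, pd_scaledBump, hsp]
  have h4 : ∑ a, ∑ b, (M.g Φ p)⁻¹ a b * Coord.covD1 (M.g Φ) (fun b => Coord.pd b η) a b p
      = ∑ i : Fin 3, ∑ j : Fin 3, (M.g Φ p)⁻¹ i.succ j.succ * ddBump R i j y
        - ∑ i : Fin 3, M.contractedChristoffel Φ i.succ p * dBump R i y := by
    have e1 : ∑ a, ∑ b, (M.g Φ p)⁻¹ a b * Coord.pd a (Coord.pd b η) p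
        = ∑ i : Fin 3, ∑ j : Fin 3, (M.g Φ p)⁻¹ i.succ j.succ * ddBump R i j y := by
      have z1 : ∀ b, Coord.pd 0 (Coord.pd b η) p = 0 := fun b => (hηt.pd b).pd_zero p
      have z2 : ∀ a, Coord.pd a (Coord.pd 0 η) p = 0 := fun a => by
        rw [show Coord.pd 0 η = fun _ => 0 from funext fun q => hηt.pd_zero q, Coord.pd_const]
      have z3 : ∀ i j : Fin 3, Coord.pd i.succ (Coord.pd j.succ η) p = ddBump R i j y := fun i j => by
        rw [hη, pd_pd_scaledBump, hsp]
      simp only [Fin.sum_univ_succ (n := 3), z1, z2, z3, mul_zero, zero_add, Finset.sum_const_zero]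
    have e2 : ∑ a, ∑ b, (M.g Φ p)⁻¹ a b * ∑ m, Coord.christoffel (M.g Φ) m a b p * Coord.pd m η p
        = ∑ i : Fin 3, M.contractedChristoffel Φ i.succ p * dBump R i y := by
      have : ∑ a, ∑ b, (M.g Φ p)⁻¹ a b * ∑ m, Coord.christoffel (M.g Φ) m a b p * Coord.pd m η p
          = ∑ m, M.contractedChristoffel Φ m p * Coord.pd m η p := by
        simp only [contractedChristoffel, Finset.mul_sum, Finset.sum_mul]
        rw [Finset.sum_comm_cycle]
        exact Finset.sum_congr rfl fun m _ => Finset.sum_congr rfl fun a _ =>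
          Finset.sum_congr rfl fun b _ => by ring
      rw [this, Fin.sum_univ_succ, hηt.pd_zero, mul_zero, zero_add]
      exact Finset.sum_congr rfl fun i _ => by rw [hη, pd_scaledBump, hsp]
    simp only [Coord.covD1, mul_sub, Finset.sum_sub_distrib, e1, e2]
  rw [h1]
  simp only [h2, Finset.sum_add_distrib, ← Finset.mul_sum, ← Finset.sum_mul, h3]
  rw [hg.divergence_raise hp hηs hws (M.pd_density hmem hp), h4, hU]
  simp only [hsp]
  ring

/-- The flux at infinity of a vector field that is the sum of a gradient and a rapidly decaying
field vanishes. -/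
theorem tendsto_flux (hΦ : IsEnd Φ r) (hg : Coord.MetricDecays (M.g Φ))
    (hw : Decays 0 (M.density Φ)) {u : S → ℝ} (hu : ContMDiff (𝓡 3) 𝓘(ℝ, ℝ) ∞ u)
    (hud : Decays 2 fun y => u (Φ.symm y)) {W : Fin 4 → Coord.Pt → ℝ}
    (hW : ∀ b, ContDiffOn ℝ ∞ (W b) (chartRegion Φ))
    (hWd : ∀ b, Decays 3 fun y => W b (atTimeZero y)) :
    Filter.Tendsto (fun R => ∫ y in Φ.target, (∑ i : Fin 3, Coord.raise (M.g Φ)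
      (fun b p => Coord.pd b (fun q => u (Φ.symm (spatial q))) p + W b p) i.succ (atTimeZero y)
        * dBump R i y) * M.density Φ y) Filter.atTop (nhds 0) := by
  have hmem := hΦ.mem_atlas
  have hst := M.isStaticOn hmem
  -- The coefficients of `∂η` and `∂²η` after the integration by parts. `A` decays to order three,
  -- since `W` does and `u Γ` decays to order four; `B` inherits the order two of `u`.
  let A : Fin 3 → E3 → ℝ := fun i y => M.density Φ y * (Coord.raise (M.g Φ) W i.succ (atTimeZero y)
    + u (Φ.symm y) * M.contractedChristoffel Φ i.succ (atTimeZero y))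
  let B : Fin 3 → Fin 3 → E3 → ℝ := fun i j y =>
    -(M.density Φ y * (u (Φ.symm y) * (M.g Φ (atTimeZero y))⁻¹ i.succ j.succ))
  have hA : ∀ i, Decays 3 (A i) := fun i =>
    (hw.mul ((hg.raise hWd i.succ).add ((hud.mul (Decays.sum fun a => Decays.sum fun b =>
      (hg.inv a b).mul (hg.christoffel i.succ a b))).mono (by omega)))).mono (by omega)
  have hB : ∀ i j, Decays 2 (B i j) := fun i j => (hw.mul (hud.mul (hg.inv _ _))).neg.mono (by omega)
  have hAc : ∀ i, ContinuousOn (A i) Φ.target := fun i => by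
    refine (M.contDiffOn_density hmem).continuousOn.mul (((contDiffOn_atTimeZero
      (hst.smooth_raise hW i.succ)).continuousOn).add
      ((contDiffOn_comp_symm hmem hu).continuousOn.mul (contDiffOn_atTimeZero
        (f := M.contractedChristoffel Φ i.succ) ?_).continuousOn))
    exact ContDiffOn.sum fun a _ => ContDiffOn.sum fun b _ =>
      (hst.smooth_inv a b).mul (hst.smooth_christoffel _ a b)
  have hBc : ∀ i j, ContinuousOn (B i j) Φ.target := fun i j =>
    ((M.contDiffOn_density hmem).continuousOn.mul ((contDiffOn_comp_symm hmem hu).continuousOn.mul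
      (contDiffOn_atTimeZero (hst.smooth_inv i.succ j.succ)).continuousOn)).neg
  refine (tendsto_integral_bump Φ.open_target.measurableSet hA hB).congr' ?_
  filter_upwards [Filter.eventually_gt_atTop r] with R hR
  have hR0 : 0 < R := hΦ.pos.trans hR
  let G : Fin 3 → E3 → ℝ := fun i y => M.boundaryField Φ u R i.succ (atTimeZero y)
  have hGs : ∀ i, ContDiffOn ℝ ∞ (G i) Φ.target := fun i =>
    contDiffOn_atTimeZero (M.smooth_boundaryField hmem hu R i.succ)
  have hG0 : ∀ i, ∀ y ∈ Φ.target \ annulus R, G i y = 0 := fun i y hy =>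
    M.boundaryField_eq_zero hR0 (by rw [spatial_atTimeZero]; exact hy.2) _
  have hsub := hΦ.annulus_subset hR.le
  have hK := isCompact_annulus R
  have hdG : ∀ i, IntegrableOn (fun y => fderiv ℝ (G i) y (EuclideanSpace.single i 1)) Φ.target := by
    intro i
    refine integrableOn_of_eq_zero_off_compact Φ.open_target hK hsub
      (((hGs i).fderiv_of_isOpen Φ.open_target (m := ∞) (by simp)).clm_apply
        contDiffOn_const).continuousOn fun y hy => ?_
    have : G i =ᶠ[nhds y] fun _ => 0 :=
      Filter.eventuallyEq_of_mem ((Φ.open_target.inter hK.isClosed.isOpen_compl).mem_nhds hy)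
        fun z hz => hG0 i z hz
    rw [this.fderiv_eq]
    simp
  have hAB : IntegrableOn (fun y => ∑ i, A i y * dBump R i y
      + ∑ i, ∑ j, B i j y * ddBump R i j y) Φ.target := by
    refine integrableOn_of_eq_zero_off_compact Φ.open_target hK hsub ?_ fun y hy => ?_
    · exact (continuousOn_finsetSum _ fun i _ =>
        (hAc i).mul (contDiff_dBump R i).continuous.continuousOn).add
        (continuousOn_finsetSum _ fun i _ => continuousOn_finsetSum _ fun j _ =>
          (hBc i j).mul (contDiff_ddBump R i j).continuous.continuousOn)
    · simp [dBump_eq_zero hR0 (of_notMem_annulus hy.2), ddBump_eq_zero hR0 (of_notMem_annulus hy.2)]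
  -- The boundary field is supported in the annulus, so its total divergence integrates to zero and
  -- may be added to the integral of the `A` and `B` terms.
  have hzero : ∫ y in Φ.target, ∑ i, fderiv ℝ (G i) y (EuclideanSpace.single i 1) = 0 := by
    rw [integral_finsetSum _ fun i _ => hdG i]
    exact Finset.sum_eq_zero fun i _ =>
      setIntegral_fderiv_eq_zero Φ.open_target hK hsub (hGs i) (hG0 i) _
  rw [← add_zero (∫ y in Φ.target, _), ← hzero, ← integral_add hAB (integrable_finsetSum _ fun i _ => hdG i)]
  refine setIntegral_congr_fun Φ.open_target.measurableSet fun y hy => ?_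
  simp only [G, M.divergence_boundaryField hmem hu R hy, A, B]
  have hraise : ∀ i : Fin 3, Coord.raise (M.g Φ)
      (fun b p => Coord.pd b (fun q => u (Φ.symm (spatial q))) p + W b p) i.succ (atTimeZero y)
      = Coord.raise (M.g Φ) (fun b => Coord.pd b fun q => u (Φ.symm (spatial q))) i.succ (atTimeZero y)
        + Coord.raise (M.g Φ) W i.succ (atTimeZero y) := fun i => by
    simp only [Coord.raise, mul_add, Finset.sum_add_distrib]
  simp only [hraise, add_mul, mul_add, mul_sub, Finset.sum_add_distrib, Finset.sum_mul, Finset.mul_sum,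
    neg_mul, Finset.sum_neg_distrib]
  have c1 : ∀ i, M.density Φ y * Coord.raise (M.g Φ) W i.succ (atTimeZero y) * dBump R i y
      = Coord.raise (M.g Φ) W i.succ (atTimeZero y) * dBump R i y * M.density Φ y := fun i => by ring
  have c2 : ∀ i, M.density Φ y * (u (Φ.symm y) * M.contractedChristoffel Φ i.succ (atTimeZero y))
      * dBump R i y = M.density Φ y * u (Φ.symm y)
        * (M.contractedChristoffel Φ i.succ (atTimeZero y) * dBump R i y) := fun i => by ring
  have c3 : ∀ i j, M.density Φ y * (u (Φ.symm y) * (M.g Φ (atTimeZero y))⁻¹ i.succ j.succ)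
      * ddBump R i j y = M.density Φ y * u (Φ.symm y)
        * ((M.g Φ (atTimeZero y))⁻¹ i.succ j.succ * ddBump R i j y) := fun i j => by ring
  simp only [c1, c2, c3]
  ring

/-- Vanishing of a signed divergence of the sum of a gradient and a rapidly decaying field. -/
theorem eq_zero_of_divergence [T2Space S] [SigmaCompactSpace S] (hΦ : IsEnd Φ r)
    (hg : Coord.MetricDecays (M.g Φ)) (hw : Decays 0 (M.density Φ)) {u : S → ℝ}
    (hu : ContMDiff (𝓡 3) 𝓘(ℝ, ℝ) ∞ u) (hud : Decays 2 fun y => u (Φ.symm y))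
    {W : OpenPartialHomeomorph S E3 → Fin 4 → Coord.Pt → ℝ} (hW : IsCovectorField W)
    (hWd : ∀ b, Decays 3 fun y => W Φ b (atTimeZero y)) {c : ℝ} (hc : c ≠ 0) {h : S → ℝ}
    (hh : ContMDiff (𝓡 3) 𝓘(ℝ, ℝ) ∞ h) (hh0 : ∀ x, 0 ≤ h x)
    (hdiv : ∀ e ∈ IsManifold.maximalAtlas (𝓡 3) ∞ S, ∀ p ∈ chartRegion e,
      ∑ a, Coord.pd a (fun q => M.density e (spatial q) * Coord.raise (M.g e)
        (fun b p => Coord.pd b (fun q => u (e.symm (spatial q))) p + W e b p) a q) p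
        = M.density e (spatial p) * (c * h (e.symm (spatial p)))) (x : S) : h x = 0 :=
  (M.hasDivergence_sharp ((isCovectorField_pd hu).add hW) (f := fun x => c * h x)
    (contMDiff_const.mul hh) hdiv).eq_zero hΦ hc (fun _ => rfl) hh0 hh.continuous
    (M.tendsto_flux hΦ hg hw hu hud (hW.smooth Φ hΦ.mem_atlas) hWd) x

end StaticSpacetime

end

/-! ### Positivity on static tensors -/

open scoped MatrixOrder in
-- Writing `B = C* C` with `C` invertible turns the trace into the squared Frobenius norm of `C A
-- C*`.
theorem Matrix.PosDef.trace_congruence {n : Type*} [Fintype n] [DecidableEq n] {B : Matrix n n ℝ}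
    (hB : B.PosDef) (A : Matrix n n ℝ) : 0 ≤ (B * A * B.transpose * A.transpose).trace ∧
      ((B * A * B.transpose * A.transpose).trace = 0 → A = 0) := by
  obtain ⟨C, hC⟩ := CStarAlgebra.nonneg_iff_eq_star_mul_self.1 hB.posSemidef.nonneg
  rw [Matrix.star_eq_conjTranspose] at hC
  have hdet : IsUnit C.det := by
    have := hB.det_pos.ne'
    rw [hC, Matrix.det_mul] at this
    exact (right_ne_zero_of_mul this).isUnit
  have key : (B * A * B.transpose * A.transpose).trace
      = ((C * A * C.conjTranspose).conjTranspose * (C * A * C.conjTranspose)).trace := by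
    have h1 : B * A * B.transpose * A.transpose
        = C.conjTranspose * (C * A * C.conjTranspose * C * A.transpose) := by
      rw [hC]
      simp only [Matrix.conjTranspose_eq_transpose_of_trivial, Matrix.transpose_mul,
        Matrix.transpose_transpose, Matrix.mul_assoc]
    rw [h1, Matrix.trace_mul_comm, Matrix.trace_mul_comm (C * A * C.conjTranspose).conjTranspose]
    simp only [Matrix.conjTranspose_eq_transpose_of_trivial, Matrix.transpose_mul,
      Matrix.transpose_transpose, Matrix.mul_assoc]
  rw [key]
  refine ⟨(Matrix.posSemidef_conjTranspose_mul_self _).trace_nonneg, fun h => ?_⟩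
  have h0 : C * A * C.conjTranspose = 0 := Matrix.trace_conjTranspose_mul_self_eq_zero_iff.1 h
  have hCt : IsUnit C.conjTranspose.det := by
    rw [Matrix.conjTranspose_eq_transpose_of_trivial, Matrix.det_transpose]; exact hdet
  have h1 : C * A = 0 := by
    rw [← Matrix.mul_one (C * A), ← Matrix.mul_nonsing_inv _ hCt, ← Matrix.mul_assoc, h0,
      Matrix.zero_mul]
  have := congrArg (C⁻¹ * ·) h1
  simpa [← Matrix.mul_assoc, Matrix.nonsing_inv_mul _ hdet] using this

section

variable {S : Type*} [TopologicalSpace S] [ChartedSpace E3 S] [IsManifold (𝓡 3) ∞ S]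
  {e : OpenPartialHomeomorph S E3} {p : Coord.Pt}
  {ξ : OpenPartialHomeomorph S E3 → Fin 4 → Coord.Pt → ℝ}

namespace StaticSpacetime

variable (M : StaticSpacetime S)

/-- The inverse spatial metric. -/
noncomputable def spatialInv (e : OpenPartialHomeomorph S E3) (p : Coord.Pt) :
    Matrix (Fin 3) (Fin 3) ℝ := Matrix.of fun i j => (M.g e p)⁻¹ i.succ j.succ

theorem spatialInv_posDef (he : e ∈ IsManifold.maximalAtlas (𝓡 3) ∞ S) (hp : p ∈ chartRegion e) :
    (M.spatialInv e p).PosDef := by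
  have hst := M.isStaticOn he
  have h : M.spatialInv e p * M.hComp e (spatial p) = 1 := by
    ext i j
    have := congrFun (congrFun (hst.inv_mul hp) i.succ) j.succ
    rw [Matrix.mul_apply, Fin.sum_univ_succ, hst.inv_space_time hp, zero_mul, zero_add] at this
    rw [Matrix.mul_apply]
    simpa [spatialInv, g_space_space, Matrix.one_apply] using this
  rw [← Matrix.inv_eq_left_inv h]
  exact (M.hComp_posDef he hp).inv

/-- A covector without time component only sees the spatial block of `g⁻¹`, which is positive
definite although `g` is Lorentzian. -/
theorem normSq_nonneg (he : e ∈ IsManifold.maximalAtlas (𝓡 3) ∞ S) (hp : p ∈ chartRegion e)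
    {v : Fin 4 → ℝ} (hv : v 0 = 0) : 0 ≤ ∑ a, ∑ b, (M.g e p)⁻¹ a b * (v a * v b) ∧
      (∑ a, ∑ b, (M.g e p)⁻¹ a b * (v a * v b) = 0 → v = 0) := by
  have hpos := M.spatialInv_posDef he hp
  set w : Fin 3 → ℝ := fun i => v i.succ with hw
  have key : ∑ a, ∑ b, (M.g e p)⁻¹ a b * (v a * v b) = star w ⬝ᵥ (M.spatialInv e p).mulVec w := by
    simp only [Fin.sum_univ_succ (n := 3), hv, zero_mul, mul_zero, Finset.sum_const_zero, zero_add]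
    simp only [dotProduct, Matrix.mulVec, spatialInv, Matrix.of_apply, Finset.mul_sum, star_trivial,
      hw]
    exact Finset.sum_congr rfl fun i _ => Finset.sum_congr rfl fun j _ => by ring
  rw [key]
  by_cases h : w = 0
  · refine ⟨by rw [h]; simp, fun _ => ?_⟩
    ext a
    refine Fin.cases hv (fun i => congrFun h i) a
  · have := hpos.dotProduct_mulVec_pos h
    exact ⟨this.le, fun h0 => absurd h0 this.ne'⟩

/-- For a general Lorentzian metric the mixed components would enter with a negative sign. Staticity
removes them, and what is left is `σ²` plus the squared norm of the spatial part. -/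
theorem ricciSq_nonneg (he : e ∈ IsManifold.maximalAtlas (𝓡 3) ∞ S) (hp : p ∈ chartRegion e) :
    0 ≤ Coord.ricciSq (M.g e) p ∧
      (Coord.ricciSq (M.g e) p = 0 → ∀ a b, Coord.ricci (M.g e) a b p = 0) := by
  have hst := M.isStaticOn he
  set A : Matrix (Fin 3) (Fin 3) ℝ :=
    Matrix.of fun i j => Coord.ricci (M.g e) i.succ j.succ p with hA
  obtain ⟨h1, h2⟩ := (M.spatialInv_posDef he hp).trace_congruence A
  set E := Real.exp (-(2 * M.logLapse e p)) with hE
  have hEpos : 0 < E := Real.exp_pos _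
  have key : Coord.ricciSq (M.g e) p = (E * Coord.ricci (M.g e) 0 0 p) ^ 2
      + (M.spatialInv e p * A * (M.spatialInv e p).transpose * A.transpose).trace := by
    rw [Coord.ricciSq]
    simp only [Fin.sum_univ_succ (n := 3), hst.ricciUp_time_time hp, hst.ricci_time_space hp,
      hst.ricci_space_time hp, mul_zero, Finset.sum_const_zero, add_zero, zero_add]
    congr 1
    · rw [hE]; ring
    · simp only [Matrix.trace, Matrix.diag_apply, Matrix.mul_apply, Matrix.transpose_apply,
        Coord.ricciUp, Fin.sum_univ_succ (n := 3), hst.inv_space_time hp, zero_mul, mul_zero,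
        Finset.sum_const_zero, zero_add, spatialInv, hA, Matrix.of_apply, Finset.sum_mul]
      refine Finset.sum_congr rfl fun i _ => Finset.sum_congr rfl fun j _ => ?_
      rw [Finset.sum_comm]
      exact Finset.sum_congr rfl fun k _ => Finset.sum_congr rfl fun l _ => by ring
  rw [key]
  refine ⟨add_nonneg (sq_nonneg _) h1, fun h => ?_⟩
  have h3 : (E * Coord.ricci (M.g e) 0 0 p) ^ 2 = 0 := by linarith [sq_nonneg (E * Coord.ricci (M.g e) 0 0 p)]
  have h4 := h2 (by linarith [sq_nonneg (E * Coord.ricci (M.g e) 0 0 p)])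
  have h5 : Coord.ricci (M.g e) 0 0 p = 0 :=
    (mul_eq_zero.1 (pow_eq_zero_iff two_ne_zero |>.1 h3)).resolve_left hEpos.ne'
  intro a b
  refine Fin.cases ?_ (fun i => ?_) a <;> refine Fin.cases ?_ (fun j => ?_) b
  · exact h5
  · exact hst.ricci_time_space hp j
  · exact hst.ricci_space_time hp i
  · exact congrFun (congrFun h4 i) j

/-- The square of a covector field is a scalar field. -/
theorem isScalarField_normSq (hξ : IsCovectorField ξ) : IsScalarField (S := S) fun e p =>
    ∑ a, ∑ b, (M.g e p)⁻¹ a b * (ξ e a p * ξ e b p) where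
  smooth := fun e he => ContDiffOn.sum fun a _ => ContDiffOn.sum fun b _ =>
    ((M.isStaticOn he).smooth_inv a b).mul ((hξ.smooth e he a).mul (hξ.smooth e he b))
  timeIndep := fun e he s p => by
    simp only [fun a b => (M.isStaticOn he).timeIndep_inv a b s p, fun a => hξ.timeIndep e he a s p]
  transform := by
    intro e he e' he' x hx hx'
    have key : ∀ e : OpenPartialHomeomorph S E3, ∑ a, ∑ b, (M.g e (atTimeZero (e x)))⁻¹ a b
        * (ξ e a (atTimeZero (e x)) * ξ e b (atTimeZero (e x)))
        = (fun a => ξ e a (atTimeZero (e x))) ⬝ᵥ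
          fun a => Coord.raise (M.g e) (ξ e) a (atTimeZero (e x)) := fun e => by
      simp only [dotProduct, Coord.raise, Finset.mul_sum]
      exact Finset.sum_congr rfl fun a _ => Finset.sum_congr rfl fun b _ => by ring
    rw [key, key, ← M.raise_transform hξ he he' hx hx', hξ.transform e he e' he' x hx hx',
      Matrix.mulVec_transpose, Matrix.dotProduct_mulVec]

end StaticSpacetime

/-- A function on a connected manifold whose coordinate derivatives vanish is constant. -/
theorem eq_of_fderiv_eq_zero [PreconnectedSpace S] {f : S → ℝ}
    (hf : ContMDiff (𝓡 3) 𝓘(ℝ, ℝ) ∞ f)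
    (h : ∀ e ∈ IsManifold.maximalAtlas (𝓡 3) ∞ S, ∀ y ∈ e.target,
      fderiv ℝ (fun y => f (e.symm y)) y = 0) (x x' : S) : f x = f x' := by
  have hloc : IsLocallyConstant f := by
    rw [IsLocallyConstant.iff_eventually_eq]
    intro x
    have he : chartAt E3 x ∈ IsManifold.maximalAtlas (𝓡 3) ∞ S := IsManifold.chart_mem_maximalAtlas x
    set e := chartAt E3 x
    have hx : x ∈ e.source := mem_chart_source E3 x
    obtain ⟨ε, hε, hball⟩ := Metric.isOpen_iff.1 e.open_target (e x) (e.map_source hx)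
    have hd : DifferentiableOn ℝ (fun y => f (e.symm y)) (Metric.ball (e x) ε) :=
      ((contDiffOn_comp_symm he hf).differentiableOn (by simp)).mono hball
    filter_upwards [e.open_source.mem_nhds hx, (e.continuousAt hx) (Metric.ball_mem_nhds (e x) hε)]
      with z hz hz'
    have := Metric.isOpen_ball.is_const_of_fderiv_eq_zero (convex_ball (e x) ε).isPreconnected hd
      (fun y hy => h e he y (hball hy)) hz' (Metric.mem_ball_self hε)
    simpa only [e.left_inv hz, e.left_inv hx] using this
  exact hloc.apply_eq_of_isPreconnected isPreconnected_univ (Set.mem_univ _) (Set.mem_univ _)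

end

namespace Coord

variable {U : Set Pt} {p : Pt} {g : Pt → Matrix (Fin 4) (Fin 4) ℝ}

theorem hess_congr (hU : IsOpen U) {f₁ f₂ : Pt → ℝ} (h : ∀ q ∈ U, f₁ q = f₂ q) (hp : p ∈ U)
    (a b : Fin 4) : hess g f₁ a b p = hess g f₂ a b p := by
  have h1 : ∀ c, ∀ q ∈ U, pd c f₁ q = pd c f₂ q := fun c q hq => pd_congr hU h hq c
  simp only [hess, pd_congr hU (h1 b) hp a, h1 _ p hp]

theorem boxScalar_congr (hU : IsOpen U) {f₁ f₂ : Pt → ℝ} (h : ∀ q ∈ U, f₁ q = f₂ q) (hp : p ∈ U) :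
    boxScalar g f₁ p = boxScalar g f₂ p := by
  simp only [boxScalar, hess_congr hU h hp]

theorem scalarCurv_eq_zero (h : ∀ a b, ricci g a b p = 0) : scalarCurv g p = 0 := by
  simp [scalarCurv, h]

theorem einstein_eq_zero (h : ∀ a b, ricci g a b p = 0) (a b : Fin 4) : einstein g a b p = 0 := by
  simp [einstein, h, scalarCurv_eq_zero h]

/-- Every term of `H_{ab}` contains the Ricci tensor or one of its derivatives. The derivatives
vanish because the Ricci tensor vanishes on an open set, not merely at `p`. -/
theorem fourthOrderH_eq_zero (hU : IsOpen U) (h : ∀ q ∈ U, ∀ a b, ricci g a b q = 0) (hp : p ∈ U)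
    (α β γ κ hbar : ℝ) (a b : Fin 4) : fourthOrderH α β γ κ hbar g a b p = 0 := by
  have hS : ∀ q ∈ U, scalarCurv g q = 0 := fun q hq => scalarCurv_eq_zero (h q hq)
  have hpd : ∀ c a b, ∀ q ∈ U, pd c (ricci g a b) q = 0 := fun c a b q hq => by
    rw [pd_congr hU (fun q hq => h q hq a b) hq, pd_const]
  have hcov : ∀ c a b, ∀ q ∈ U, covD g (ricci g) c a b q = 0 := fun c a b q hq => by
    simp [covD, hpd c a b q hq, h q hq]
  have hcov2 : ∀ d c a b, covD2 g (ricci g) d c a b p = 0 := fun d c a b => by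
    simp [covD2, pd_congr hU (hcov c a b) hp, pd_const, hcov _ _ _ p hp]
  have hhess : ∀ a b, hess g (scalarCurv g) a b p = 0 := fun a b => by
    rw [hess_congr hU hS hp]
    simp [hess, show pd b (fun _ => (0 : ℝ)) = fun _ => 0 from funext fun q => pd_const b 0 q,
      pd_const]
  simp [fourthOrderH, hhess, boxTensor, hcov2, boxScalar, ricciUp, h p hp, hS p hp,
    einstein_eq_zero (h p hp)]

end Coord

/-! ### From the field equations to Ricci flatness -/

section

variable {S : Type*} [TopologicalSpace S] [ChartedSpace E3 S] [IsManifold (𝓡 3) ∞ S]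

omit [IsManifold (𝓡 3) ∞ S] in
theorem isCovectorField_zero : IsCovectorField (S := S) fun _ _ _ => 0 where
  smooth := fun _ _ _ => contDiffOn_const
  timeIndep := fun _ _ _ _ _ => rfl
  transform := fun e _ e' _ x _ _ =>
    (Matrix.mulVec_zero (jacobian4 e e' x).transpose).symm

namespace StaticSpacetime

variable {M : StaticSpacetime S} {T : StaticTensor S} {α β γ κ hbar : ℝ}

/-- If `T = 0` the Einstein tensor vanishes; its trace `-R` vanishes too, so the Ricci tensor does.
-/
theorem SolvesEinstein.ricciFlat_iff (hγ : 0 < γ) (hκ : 0 < κ) (hGR : M.SolvesEinstein γ κ T) :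
    M.RicciFlat ↔ ∀ x, T x = 0 := by
  constructor
  · intro h x
    have he := IsManifold.chart_mem_maximalAtlas (I := 𝓡 3) (n := ∞) x
    have hx := mem_chart_source E3 x
    refine eq_zero_of_comp_eq_zero T he hx ?_
    ext a b
    have hp : spatial (atTimeZero (chartAt E3 x x)) ∈ (chartAt E3 x).target :=
      atTimeZero_mem_chartRegion ((chartAt E3 x).map_source hx)
    have h1 : γ / κ ^ 2 * Coord.einstein _ a b _ = (1 / 2) * _ := hGR _ he _ hp a b
    rw [Coord.einstein_eq_zero (h _ he _ hp)] at h1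
    simpa using h1.symm
  · intro h e he p hp
    have h1 : ∀ a b, Coord.einstein (M.g e) a b p = 0 := fun a b => by
      have h2 : γ / κ ^ 2 * Coord.einstein (M.g e) a b p = (1 / 2) * T.comp e p a b :=
        hGR e he p hp a b
      rw [show T.comp e p a b = 0 by simp [StaticTensor.comp, h], mul_zero] at h2
      exact (mul_eq_zero.1 h2).resolve_left (div_pos hγ (pow_pos hκ 2)).ne'
    have h2 := (M.isStaticOn he).trace_einstein hp
    simp only [h1, mul_zero, Finset.sum_const_zero] at h2
    intro a b
    have h3 := h1 a b
    rw [Coord.einstein, show Coord.scalarCurv (M.g e) p = 0 by linarith, mul_zero, sub_zero] at h3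
    exact h3

theorem RicciFlat.solvesFourthOrder (hR : M.RicciFlat) (hT : ∀ x, T x = 0) :
    M.SolvesFourthOrder α β γ κ hbar T := by
  intro e he p hp a b
  rw [Coord.fourthOrderH_eq_zero (isOpen_chartRegion e) (fun q hq => hR e he q hq) hp,
    show T.comp e p a b = 0 by simp [StaticTensor.comp, hT], mul_zero]

/-- Eliminates the matter tensor. The right side equals the Einstein term already present in
`H_{ab}`, so only the quadratic-curvature part is constrained. -/
theorem SolvesEinstein.fourthOrderH_eq (hκ : 0 < κ) (hhbar : 0 < hbar)
    (hGR : M.SolvesEinstein γ κ T) (hFO : M.SolvesFourthOrder α β γ κ hbar T)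
    {e : OpenPartialHomeomorph S E3} (he : e ∈ IsManifold.maximalAtlas (𝓡 3) ∞ S) {p : Coord.Pt}
    (hp : p ∈ chartRegion e) (a b : Fin 4) : Coord.fourthOrderH α β γ κ hbar (M.g e) a b p
      = - (γ / (hbar * κ ^ 2)) * Coord.einstein (M.g e) a b p := by
  have h1 := hGR e he p hp a b
  rw [hFO e he p hp a b, show - (γ / (hbar * κ ^ 2)) * Coord.einstein (M.g e) a b p
    = -(1 / hbar) * (γ / κ ^ 2 * Coord.einstein (M.g e) a b p) by field_simp, h1]
  field_simp

variable [T2Space S] [SigmaCompactSpace S] [ConnectedSpace S]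

/-- A Liouville argument: `□R = 0` makes `2 |∇R|²` the divergence of the gradient of `R²`, whose
flux at infinity vanishes. Hence `R` is constant, and its decay in the end fixes the constant. -/
theorem SolvesFourthOrder.scalarCurv_eq_zero (hαβ : α ≠ 3 * β) (hγ : 0 < γ) (hκ : 0 < κ)
    (hhbar : 0 < hbar) (hflat : M.AsymptoticallyFlat) (hGR : M.SolvesEinstein γ κ T)
    (hFO : M.SolvesFourthOrder α β γ κ hbar T) {e : OpenPartialHomeomorph S E3}
    (he : e ∈ IsManifold.maximalAtlas (𝓡 3) ∞ S) {p : Coord.Pt} (hp : p ∈ chartRegion e) :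
    Coord.scalarCurv (M.g e) p = 0 := by
  obtain ⟨Φ, r, hΦ, hg, hw⟩ := hflat.exists_end_metricDecays
  have hRf := M.isScalarField_scalarCurv hγ hκ hGR
  set F : S → ℝ := scalarField fun e => Coord.scalarCurv (M.g e) with hF
  have hFsm : ContMDiff (𝓡 3) 𝓘(ℝ, ℝ) ∞ F := hRf.contMDiff
  have hnorm := M.isScalarField_normSq (isCovectorField_pd hFsm)
  have hFdec : Decays 2 fun y => F (Φ.symm y) := by
    refine (hg.scalarCurv (M.isStaticOn hΦ.mem_atlas).toIsMetricOn hΦ.eventually_mem_chartRegion).congr ?_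
    filter_upwards [hΦ.eventually_mem_target] with y hy
    rw [← hRf.apply_symm hΦ.mem_atlas (atTimeZero_mem_chartRegion hy), spatial_atTimeZero]
  have hnn : ∀ e ∈ IsManifold.maximalAtlas (𝓡 3) ∞ S, ∀ p ∈ chartRegion e, _ := fun e he p hp =>
    M.normSq_nonneg he hp (v := fun a => Coord.pd a (fun q => F (e.symm (spatial q))) p)
      ((timeIndep_comp_spatial fun y => F (e.symm y)).pd_zero p)
  -- The potential is `R²`, with no additional covector field. Decay of order two is enough, so the
  -- order four of the square is more than needed.
  have hzero := M.eq_zero_of_divergence hΦ hg hw (hFsm.mul hFsm)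
    ((hFdec.mul hFdec).mono (by omega)) isCovectorField_zero (fun _ => Decays.zero 3)
    (c := 2) two_ne_zero hnorm.contMDiff (fun x => (hnn _ (IsManifold.chart_mem_maximalAtlas x) _
      (atTimeZero_mem_chartRegion (mem_chart_target E3 x))).1) (by
      intro e he p hp
      have hst := M.isStaticOn he
      have hfs := contDiffOn_comp_spatial (contDiffOn_comp_symm he hFsm)
      have hdiv := hst.divergence_raise hp (fun b => Coord.contDiffOn_pd hst.isOpen (hfs.mul hfs) b)
        (contDiffOn_comp_spatial (M.contDiffOn_density he)) (M.pd_density he hp)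
      have hbox := hst.boxScalar_sq hp hfs
      rw [Coord.boxScalar_congr hst.isOpen (fun q hq => hRf.apply_symm he hq) hp,
        hst.boxScalar_scalarCurv_eq_zero hp hαβ
          (hGR.fourthOrderH_eq hκ hhbar hFO he hp), mul_zero, zero_add] at hbox
      simp only [add_zero]
      rw [hnorm.apply_symm he hp]
      refine hdiv.trans ?_
      rw [← hbox]
      rfl)
  have hder : ∀ e ∈ IsManifold.maximalAtlas (𝓡 3) ∞ S, ∀ y ∈ e.target,
      fderiv ℝ (fun y => F (e.symm y)) y = 0 := by
    intro e he y hy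
    have hp := atTimeZero_mem_chartRegion hy
    have h1 := hzero (e.symm (spatial (atTimeZero y)))
    rw [hnorm.apply_symm he hp] at h1
    have h2 := (hnn e he _ hp).2 h1
    ext v
    rw [euclidean_eq_sum v, map_sum]
    refine Finset.sum_eq_zero fun i _ => ?_
    have hd : DifferentiableAt ℝ (fun y => F (e.symm y)) (spatial (atTimeZero y)) := by
      rw [spatial_atTimeZero]
      exact ((contDiffOn_comp_symm he hFsm).contDiffAt (e.open_target.mem_nhds hy)).differentiableAt
        (by simp)
    have h3 := pd_comp_spatial hd i
    rw [congrFun h2 i.succ, spatial_atTimeZero] at h3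
    rw [map_smul, ← h3]
    simp
  -- The end reaches infinity, so a constant function that tends to zero there is zero.
  have hlim := hFdec.tendsto_zero (k := 1)
  rw [show (fun y => F (Φ.symm y)) = fun _ => F (e.symm (spatial p)) from
    funext fun y => eq_of_fderiv_eq_zero hFsm hder _ _] at hlim
  rw [← hRf.apply_symm he hp]
  exact tendsto_nhds_unique tendsto_const_nhds hlim

/-- The vanishing theorem applied to the potential `σ`, the field `2 R_{bc} ∂^c L` and the signed
divergence `-½ R^{ab} R_{ab}`. The field decays to order four, being a product of curvature and
`∂L`, and order three is used. -/
theorem SolvesFourthOrder.ricciFlat (hα : α ≠ 0) (hαβ : α ≠ 3 * β) (hγ : 0 < γ) (hκ : 0 < κ)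
    (hhbar : 0 < hbar) (hflat : M.AsymptoticallyFlat) (hGR : M.SolvesEinstein γ κ T)
    (hFO : M.SolvesFourthOrder α β γ κ hbar T) : M.RicciFlat := by
  obtain ⟨Φ, r, hΦ, hg, hw⟩ := hflat.exists_end_metricDecays
  have hstΦ := M.isStaticOn hΦ.mem_atlas
  have hR : ∀ e ∈ IsManifold.maximalAtlas (𝓡 3) ∞ S, ∀ p ∈ chartRegion e,
      Coord.scalarCurv (M.g e) p = 0 := fun e he p hp =>
    hFO.scalarCurv_eq_zero hαβ hγ hκ hhbar hflat hGR he hp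
  have hσ := M.isScalarField_ricciEnergy hγ hκ hGR
  have hsq := M.isScalarField_ricciSq hγ hκ hGR
  set F : S → ℝ := scalarField fun e => Coord.ricciEnergy (M.g e) (M.logLapse e) with hF
  have hFsm : ContMDiff (𝓡 3) 𝓘(ℝ, ℝ) ∞ F := hσ.contMDiff
  have hlog : ContMDiff (𝓡 3) 𝓘(ℝ, ℝ) ∞ fun x => Real.log (M.N x) :=
    contMDiff_of_contDiffOn fun e he => (contDiffOn_comp_symm he M.N_smooth).log
      fun y _ => (M.N_pos _).ne'
  have hW := M.isCovectorField_ricci_raise hγ hκ hGR (isCovectorField_pd hlog)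
  have hFdec : Decays 2 fun y => F (Φ.symm y) := by
    refine (hg.ricciEnergy hΦ.eventually_mem_chartRegion hstΦ).congr ?_
    filter_upwards [hΦ.eventually_mem_target] with y hy
    rw [← hσ.apply_symm hΦ.mem_atlas (atTimeZero_mem_chartRegion hy), spatial_atTimeZero]
  have hWdec : ∀ b, Decays 3 fun y => 2 * ∑ c, Coord.ricci (M.g Φ) b c (atTimeZero y)
      * Coord.raise (M.g Φ) (fun d => Coord.pd d (M.logLapse Φ)) c (atTimeZero y) := fun b =>
    (Decays.sum fun c => ((hg.ricci hstΦ.toIsMetricOn hΦ.eventually_mem_chartRegion b c).mul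
      (hg.raise (hg.pd_log hΦ.eventually_mem_chartRegion hstΦ) c)).mono (by omega)).const_mul _
  have hnn : ∀ e ∈ IsManifold.maximalAtlas (𝓡 3) ∞ S, ∀ p ∈ chartRegion e, _ :=
    fun e he p hp => M.ricciSq_nonneg (e := e) he (p := p) hp
  have hzero := M.eq_zero_of_divergence hΦ hg hw hFsm hFdec hW hWdec
    (c := -(1 / 2)) (by norm_num) hsq.contMDiff
    (fun x => (hnn _ (IsManifold.chart_mem_maximalAtlas x) _
      (atTimeZero_mem_chartRegion (mem_chart_target E3 x))).1) (by
      intro e he p hp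
      have hst := M.isStaticOn he
      have hws := contDiffOn_comp_spatial (M.contDiffOn_density he)
      have hdiv := hst.divergence_current hp hα (hR e he)
        (hGR.fourthOrderH_eq hκ hhbar hFO he hp 0 0) hws (M.pd_density he hp)
      have hsplit : ∀ a, ∀ q ∈ chartRegion e, M.density e (spatial q) * Coord.raise (M.g e)
          (fun b p => Coord.pd b (fun q => F (e.symm (spatial q))) p
            + 2 * ∑ c, Coord.ricci (M.g e) b c p
              * Coord.raise (M.g e) (fun d => Coord.pd d (M.logLapse e)) c p) a q
          = M.density e (spatial q) * Coord.raise (M.g e)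
              (fun b => Coord.pd b (Coord.ricciEnergy (M.g e) (M.logLapse e))) a q
            + M.density e (spatial q) * Coord.raise (M.g e) (fun b q => 2 * ∑ c,
              Coord.ricci (M.g e) b c q
                * Coord.raise (M.g e) (fun d => Coord.pd d (M.logLapse e)) c q) a q := by
        intro a q hq
        rw [← mul_add]
        congr 1
        have hpd : ∀ b, Coord.pd b (fun q => F (e.symm (spatial q))) q
            = Coord.pd b (Coord.ricciEnergy (M.g e) (M.logLapse e)) q :=
          Coord.pd_congr hst.isOpen (fun q hq => hσ.apply_symm he hq) hq
        simp only [Coord.raise, mul_add, Finset.sum_add_distrib, hpd]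
      rw [hsq.apply_symm he hp]
      have hd1 := fun a => Coord.differentiableAt_of_smooth hst.isOpen (hws.mul (hst.smooth_raise
        (fun b => Coord.contDiffOn_pd hst.isOpen hst.smooth_ricciEnergy b) a)) hp
      have hd2 := fun a => Coord.differentiableAt_of_smooth hst.isOpen (hws.mul (hst.smooth_raise
        (hW.smooth e he) a)) hp
      have hpd : ∀ a, Coord.pd a (fun q => M.density e (spatial q) * Coord.raise (M.g e)
          (fun b p => Coord.pd b (fun q => F (e.symm (spatial q))) p
            + 2 * ∑ c, Coord.ricci (M.g e) b c p
              * Coord.raise (M.g e) (fun d => Coord.pd d (M.logLapse e)) c p) a q) p = _ := fun a =>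
        (Coord.pd_congr hst.isOpen (hsplit a) hp a).trans (Coord.pd_add (hd1 a) (hd2 a) a)
      refine (Finset.sum_congr rfl fun a _ => hpd a).trans ?_
      rw [Finset.sum_add_distrib]
      refine hdiv.trans ?_
      ring)
  intro e he p hp
  refine (hnn e he p hp).2 ?_
  rw [← hsq.apply_symm he hp]
  exact hzero _

end StaticSpacetime

end

theorem mainTheorem3 {S : Type*} [TopologicalSpace S] [T2Space S] [SigmaCompactSpace S]
    [ConnectedSpace S] [ChartedSpace E3 S] [IsManifold (𝓡 3) ∞ S]
    [MeasurableSpace S] [BorelSpace S]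
    (M : StaticSpacetime S) (T : StaticTensor S) (α β γ κ hbar : ℝ)
    (hα : α ≠ 0) (hαβ : α ≠ 3 * β) (hγ : 0 < γ) (hκ : 0 < κ) (hhbar : 0 < hbar)
    (hflat : M.AsymptoticallyFlat) (hGR : M.SolvesEinstein γ κ T) :
    (M.RicciFlat ↔ ∀ x, T x = 0) ∧
    (0 ≤ ∫ x, M.cubicTrace T x ∂M.volumeMeasure →
      (M.SolvesFourthOrder α β γ κ hbar T ↔ M.RicciFlat)) ∧
    (M.IsBarotropicFluid (-(3 : ℝ) ^ (-(1 / 3) : ℝ)) T →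
      (M.SolvesFourthOrder α β γ κ hbar T ↔ M.RicciFlat)) := by
  have hflat_iff := hGR.ricciFlat_iff hγ hκ
  have key : M.SolvesFourthOrder α β γ κ hbar T ↔ M.RicciFlat :=
    ⟨fun h => h.ricciFlat hα hαβ hγ hκ hhbar hflat hGR,
      fun h => h.solvesFourthOrder (hflat_iff.1 h)⟩
  exact ⟨hflat_iff, fun _ => key, fun _ => key⟩
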